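/- Let $\mathfrak h$ be a finite-dimensional complex vector space, $W\subset GL(\mathfrak h)$ a finite complex reflection group with set of pseudo-reflections $\mathcal R$, $t\in\mathbb C$ and $c:\mathcal R\to\mathbb C$ a $W$-invariant function. Let $\mathbf H=\mathbf H_{t,c}$ be the rational Cherednik algebra: it is generated by $\mathfrak h$, $\mathfrak h^*$ and $W$, with $wvw^{-1}=w(v)$, $[x,x']=[y,y']=0$ and $$[y,x]=t\langle y,x\rangle-\sum_{s\in\mathcal R}c(s)\frac{\langle y,\alpha_s\rangle\langle\alpha_s^\vee,x\rangle}{\langle\alpha_s^\vee,\alpha_s\rangle}\,s\qquad(y\in\mathfrak h,\ x\in\mathfrak h^*),$$ where $\alpha_s\in\mathfrak h^*$ and $\alpha_s^\vee\in\mathfrak h$ are a root and a coroot of $s$. Let $y_i$ be a basis of $\mathfrak h$ with dual basis $x_i$ of $\mathfrak h^*$, and let $C(V)$ be the Clifford algebra of $V=\mathfrak h\oplus\mathfrak h^*$ with relations $x_ix_j+x_jx_i=y_iy_j+y_jy_i=0$, $x_iy_j+y_jx_i=-2\delta_{ij}$. It acts on the spinor module $S=\bigwedge\mathfrak h$: $y\in\mathfrak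 h$ acts by left exterior multiplication and $x\in\mathfrak h^*$ by $-2$ times contraction. Let $p:\widetilde W\to W$ be the pull-back to $W$ of the Pin double cover of $O(V)$, so $\widetilde W\subset C(V)^\times$; put $\Delta(\widetilde w)=p(\widetilde w)\otimes\widetilde w\in\mathbf H\otimes C(V)$, extended linearly to $\mathbb C[\widetilde W]$. Put $D_x=\sum_i x_i\otimes y_i$ and $D_y=\sum_i y_i\otimes x_i$. Let $\mathbf A\subset\mathbf H\otimes C(V)$ be the subalgebra of invariants of the $\mathbb C^*$-action for which, in both factors, $\mathfrak h$ has weight $1$ and $\mathfrak h^*$ has weight $-1$, and $W$ has weight $0$. Let $\mathbf A^{\widetilde W}$ be the commutant of $\Delta(\mathbb C[\widetilde W])$ in $\mathbf A$, let $\epsilon$ be the parity automorphism of $\mathbf H\otimes C(V)$ coming from $C(V)$, and on $\mathbf A^{\widetilde W}$ put $\delta_d(a)=D_xa-\epsilon(a)D_x$ and $\delta_\partial(a)=D_ya-\epsilon(a)D_y$. Then $\ker\delta_d=\operatorname{im}\delta_d\oplus\Delta(\mathbb C[\widetilde W]^{\widetilde W})$ and $\ker\delta_\partial=\operatorname{im}\delta_\partial\oplus\Delta(\mathbb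 C[\widetilde W]^{\widetilde W})$. There is a (unique) character $\chi$ of $\widetilde W$ such that every $\widetilde w\in\widetilde W$ acts on $S=\bigwedge\mathfrak h$ as $\chi(\widetilde w)$ times the natural action of $p(\widetilde w)$; it is genuine ($\chi(-1)=-1$) and $\chi^2=\det_{\mathfrak h^*}\circ\, p$. Let $\mathcal B$ be an abelian (unital) subalgebra of $\ker\delta_d\cap(\mathbf H\otimes C^{\mathrm{even}}(V))$, and let $\zeta_d:\mathcal B\to\Delta(\mathbb C[\widetilde W]^{\widetilde W})$ be the restriction to $\mathcal B$ of the projection along $\operatorname{im}\delta_d$. Then $\zeta_d$ is an algebra homomorphism. For every genuine irreducible $\widetilde W$-module $\widetilde\sigma$ there is a unique character $\zeta_d^*(\widetilde\sigma)$ of $\mathcal B$ such that, for all $b\in\mathcal B$, $\zeta_d(b)$ acts on $\widetilde\sigma$ by the scalar $\zeta_d^*(\widetilde\sigma)(b)$. Let $M$ be an $\mathbf H$-module and $\beta$ a character of $\mathcal B$. (i) If $\widetilde\sigma$ is an irreducible $\widetilde W$-module and $\widetilde\sigma\otimes\beta$ is an isotypic component (with nonzero multiplicity) of the $\mathbb C[\widetilde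 W]\otimes\mathcal B$-module $\ker D_x/\operatorname{im}D_x$, for the action of $D_x$ on $M\otimes S$, then $\zeta_d^*(\widetilde\sigma)=\beta$. (ii) Let $H^\bullet(\mathfrak h^*,M)=\bigoplus_p H^p(\mathfrak h^*,M)$ be the cohomology of $M\otimes\bigwedge\mathfrak h$ with differential $d(m\otimes\omega)=\sum_j x_jm\otimes y_j\wedge\omega$, on which $W$ acts diagonally and $\mathcal B$ acts through $M\otimes\bigwedge\mathfrak h=M\otimes S$, $d=D_x$. If $\sigma$ is an irreducible $W$-module and $\sigma\otimes\beta$ is an isotypic component of $H^\bullet(\mathfrak h^*,M)$, then $\zeta_d^*(\sigma\otimes\chi)=\beta$. The same statements hold with $\delta_d,D_x,\zeta_d$ and $H^\bullet(\mathfrak h^*,M)$ replaced by $\delta_\partial,D_y,\zeta_\partial$ and the homology $H_\bullet(\mathfrak h,M)$ of $M\otimes\bigwedge\mathfrak h$ with differential $\partial(m\otimes v_1\wedge\dots\wedge v_p)=\sum_k(-1)^k v_km\otimes v_1\wedge\dots\widehat{v_k}\dots\wedge v_p$, where $\mathcal B$ is now an abelian subalgebra of $\ker\delta_\partial\cap(\mathbf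 H\otimes C^{\mathrm{even}}(V))$ and acts through $D_y=2\partial$. -/

import Mathlib

open scoped TensorProduct

universe u v w

noncomputable section

namespace Cherednik

section Groups

variable {h : Type u} [AddCommGroup h] [Module ℂ h]

/-- The symplectic/orthogonal space `V = 𝔥* ⊕ 𝔥`. -/
abbrev V (h : Type u) [AddCommGroup h] [Module ℂ h] : Type u := Module.Dual ℂ h × h

/-- The contragredient action of `g ∈ GL(𝔥)` on `𝔥*`, so that `⟨g y, g x⟩ = ⟨y, x⟩`. -/
def dualAct (g : h ≃ₗ[ℂ] h) (x : Module.Dual ℂ h) : Module.Dual ℂ h :=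
  x ∘ₗ (g⁻¹ : h ≃ₗ[ℂ] h).toLinearMap

/-- The action of `g ∈ GL(𝔥)` on `V = 𝔥* ⊕ 𝔥`. -/
def actV (g : h ≃ₗ[ℂ] h) (v : V h) : V h := (dualAct g v.1, g v.2)

/-- `s` is a pseudo-reflection: `s - 1` has rank one (its fixed space is a hyperplane). -/
def IsPseudoReflection (s : h ≃ₗ[ℂ] h) : Prop :=
  Module.finrank ℂ (LinearMap.range (s.toLinearMap - LinearMap.id)) = 1

/-- The set `𝓡` of pseudo-reflections in `W`. -/
abbrev Reflections (W : Subgroup (h ≃ₗ[ℂ] h)) : Type u :=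
  {s : W // IsPseudoReflection (s : h ≃ₗ[ℂ] h)}

/-- A finite subgroup `W` of `GL(𝔥)` is a complex reflection group if it is generated by the
pseudo-reflections it contains. -/
def IsComplexReflectionGroup (W : Subgroup (h ≃ₗ[ℂ] h)) : Prop :=
  Subgroup.closure {s : h ≃ₗ[ℂ] h | s ∈ W ∧ IsPseudoReflection s} = W

/-- The form `⟨y, αₛ⟩⟨αₛ^∨, x⟩ / ⟨αₛ^∨, αₛ⟩` attached to a pseudo-reflection `s`, written without
a choice of `αₛ`, `αₛ^∨` as `⟨y - s y, x⟩ / (1 - λₛ)`, where `λₛ = det_𝔥 s`;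
see `reflForm_eq`. -/
def reflForm (s : h ≃ₗ[ℂ] h) (y : h) (x : Module.Dual ℂ h) : ℂ :=
  x (y - s y) / (1 - LinearMap.det s.toLinearMap)

/-- `reflForm` is the usual expression in a root `α` (vanishing on the hyperplane of `s`)
and a coroot `αc` (an eigenvector for the nontrivial eigenvalue of `s`). -/
theorem reflForm_eq [FiniteDimensional ℂ h] (s : h ≃ₗ[ℂ] h) (hs : IsPseudoReflection s)
    (α : Module.Dual ℂ h) (αc : h) (hα : ∀ y, s y = y → α y = 0)
    (hαc : s αc = LinearMap.det s.toLinearMap • αc) (hne : α αc ≠ 0)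
    (y : h) (x : Module.Dual ℂ h) :
    reflForm s y x = α y * x αc / α αc := by
  have hdet : (1 : ℂ) - LinearMap.det s.toLinearMap ≠ 0 := by
    intro h0
    rw [← sub_eq_zero.mp h0, one_smul] at hαc
    exact hne (hα _ hαc)
  have hle : LinearMap.ker (s.toLinearMap - LinearMap.id) ≤ LinearMap.ker α := by
    intro z hz
    refine hα z ?_
    simpa [sub_eq_zero] using hz
  have h1 := LinearMap.finrank_range_add_finrank_ker (s.toLinearMap - LinearMap.id)
  have h2 := LinearMap.finrank_range_add_finrank_ker α
  have h3 : Module.finrank ℂ (LinearMap.range α) = 1 := by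
    have : LinearMap.range α = ⊤ := LinearMap.range_eq_top.mpr
      (LinearMap.surjective (by rintro rfl; exact hne rfl))
    rw [this]; simp
  have hker : LinearMap.ker (s.toLinearMap - LinearMap.id) = LinearMap.ker α := by
    refine Submodule.eq_of_le_of_finrank_eq hle ?_
    unfold IsPseudoReflection at hs
    omega
  have hy : s (y - (α y / α αc) • αc) = y - (α y / α αc) • αc := by
    have : y - (α y / α αc) • αc ∈ LinearMap.ker (s.toLinearMap - LinearMap.id) := by
      rw [hker]; simp [hne]
    simpa [sub_eq_zero] using this
  have hsy : y - s y = ((1 - LinearMap.det s.toLinearMap) * (α y / α αc)) • αc := by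
    rw [map_sub, map_smul, hαc, smul_smul, sub_eq_sub_iff_add_eq_add] at hy
    rw [sub_mul, sub_smul, one_mul, mul_comm (LinearMap.det _), sub_eq_sub_iff_add_eq_add,
      add_comm ((α y / α αc) • αc), hy]
  unfold reflForm
  rw [hsy, map_smul, smul_eq_mul]
  field_simp

end Groups

section Algebra

variable {h : Type u} [AddCommGroup h] [Module ℂ h]

/-- Generators of the rational Cherednik algebra. -/
inductive Gen (W : Subgroup (h ≃ₗ[ℂ] h)) : Type u
  | vec (v : V h) : Gen W
  | grp (g : W) : Gen W

/-- The generator of the free algebra given by a vector of `V`. -/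
def fv (W : Subgroup (h ≃ₗ[ℂ] h)) (v : V h) : FreeAlgebra ℂ (Gen W) :=
  FreeAlgebra.ι ℂ (Gen.vec v)

/-- The generator of the free algebra given by an element of `W`. -/
def fg (W : Subgroup (h ≃ₗ[ℂ] h)) (g : W) : FreeAlgebra ℂ (Gen W) :=
  FreeAlgebra.ι ℂ (Gen.grp g)

/-- The defining relations of the rational Cherednik algebra `H_{t,c}`: those of the smash
product `T(V) ⋊ ℂ[W]`, the commutation relations in `𝔥` and in `𝔥*`, and
`[y, x] = t ⟨y, x⟩ - ∑ₛ c(s) (⟨y, αₛ⟩⟨αₛ^∨, x⟩ / ⟨αₛ^∨, αₛ⟩) s`. -/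
inductive Rel (W : Subgroup (h ≃ₗ[ℂ] h)) (t : ℂ) (c : Reflections W → ℂ) :
    FreeAlgebra ℂ (Gen W) → FreeAlgebra ℂ (Gen W) → Prop
  | add (v v' : V h) : Rel W t c (fv W (v + v')) (fv W v + fv W v')
  | smul (a : ℂ) (v : V h) : Rel W t c (fv W (a • v)) (a • fv W v)
  | one : Rel W t c (fg W 1) 1
  | mul (g g' : W) : Rel W t c (fg W (g * g')) (fg W g * fg W g')
  | conj (g : W) (v : V h) :
      Rel W t c (fg W g * fv W v) (fv W (actV (g : h ≃ₗ[ℂ] h) v) * fg W g)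
  | comm_x (x x' : Module.Dual ℂ h) :
      Rel W t c (fv W (x, 0) * fv W (x', 0)) (fv W (x', 0) * fv W (x, 0))
  | comm_y (y y' : h) :
      Rel W t c (fv W (0, y) * fv W (0, y')) (fv W (0, y') * fv W (0, y))
  | comm_yx (y : h) (x : Module.Dual ℂ h) :
      Rel W t c (fv W (0, y) * fv W (x, 0) - fv W (x, 0) * fv W (0, y))
        (algebraMap ℂ _ (t * x y) -
          ∑ᶠ s : Reflections W, (c s * reflForm ((s : W) : h ≃ₗ[ℂ] h) y x) • fg W (s : W))

/-- The rational Cherednik algebra `H_{t,c}(W, 𝔥)`. -/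
def RCA (W : Subgroup (h ≃ₗ[ℂ] h)) (t : ℂ) (c : Reflections W → ℂ) : Type u :=
  RingQuot (Rel W t c)

variable (W : Subgroup (h ≃ₗ[ℂ] h)) (t : ℂ) (c : Reflections W → ℂ)

instance : Ring (RCA W t c) := inferInstanceAs (Ring (RingQuot (Rel W t c)))

instance : Algebra ℂ (RCA W t c) := inferInstanceAs (Algebra ℂ (RingQuot (Rel W t c)))

/-- The quotient map from the free algebra. -/
def RCA.mk : FreeAlgebra ℂ (Gen W) →ₐ[ℂ] RCA W t c := RingQuot.mkAlgHom ℂ (Rel W t c)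

theorem RCA.mk_rel {a b : FreeAlgebra ℂ (Gen W)} (hab : Rel W t c a b) :
    RCA.mk W t c a = RCA.mk W t c b := RingQuot.mkAlgHom_rel ℂ hab

/-- The image of `V` in `H_{t,c}`. -/
def RCA.vec : V h →ₗ[ℂ] RCA W t c where
  toFun v := RCA.mk W t c (fv W v)
  map_add' v v' := by rw [RCA.mk_rel W t c (Rel.add v v'), map_add]
  map_smul' a v := by rw [RCA.mk_rel W t c (Rel.smul a v), map_smul]; rfl

/-- The image of `W` in `H_{t,c}`. -/
def RCA.grp : W →* RCA W t c where
  toFun g := RCA.mk W t c (fg W g)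
  map_one' := by rw [RCA.mk_rel W t c Rel.one, map_one]
  map_mul' g g' := by rw [RCA.mk_rel W t c (Rel.mul g g'), map_mul]

theorem RCA.grp_mul_vec (g : W) (v : V h) :
    RCA.grp W t c g * RCA.vec W t c v =
      RCA.vec W t c (actV (g : h ≃ₗ[ℂ] h) v) * RCA.grp W t c g := by
  have := RCA.mk_rel W t c (Rel.conj g v)
  rwa [map_mul, map_mul] at this

/-- The quadratic form on `V` whose Clifford algebra has the relations
`xᵢxⱼ + xⱼxᵢ = yᵢyⱼ + yⱼyᵢ = 0`, `xᵢyⱼ + yⱼxᵢ = -2δᵢⱼ`. -/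
def Q (h : Type u) [AddCommGroup h] [Module ℂ h] : QuadraticForm ℂ (V h) :=
  (-2 : ℂ) • QuadraticForm.dualProd ℂ h

/-- The Clifford algebra `C(V)`. -/
abbrev Cl (h : Type u) [AddCommGroup h] [Module ℂ h] : Type u := CliffordAlgebra (Q h)

theorem cl_anticomm (v v' : V h) :
    CliffordAlgebra.ι (Q h) v * CliffordAlgebra.ι (Q h) v' +
      CliffordAlgebra.ι (Q h) v' * CliffordAlgebra.ι (Q h) v =
      algebraMap ℂ (Cl h) (-2 * (v.1 v'.2 + v'.1 v.2)) := by
  rw [CliffordAlgebra.ι_mul_ι_add_swap]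
  congr 1
  simp [QuadraticMap.polar, Q]
  ring

/-- The algebra `H ⊗ C(V)`. -/
abbrev HC : Type u := RCA W t c ⊗[ℂ] Cl h

/-- The parity automorphism `ε` of `H ⊗ C(V)`: it is `1` on `H ⊗ C^even(V)` and `-1` on
`H ⊗ C^odd(V)`. -/
def eps : HC W t c →ₐ[ℂ] HC W t c :=
  Algebra.TensorProduct.map (AlgHom.id ℂ (RCA W t c)) CliffordAlgebra.involute

/-- The subalgebra `H ⊗ C^even(V)`. -/
def evenPart : Subalgebra ℂ (HC W t c) :=
  (Algebra.TensorProduct.map (AlgHom.id ℂ (RCA W t c)) (CliffordAlgebra.even (Q h)).val).range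

end Algebra

section Scaling

variable {h : Type u} [AddCommGroup h] [Module ℂ h]
variable (W : Subgroup (h ≃ₗ[ℂ] h)) (t : ℂ) (c : Reflections W → ℂ)

/-- `a ∈ ℂ*` acts on `V` by `a⁻¹` on `𝔥*` and by `a` on `𝔥`. -/
def scaleV (a : ℂˣ) : V h →ₗ[ℂ] V h :=
  LinearMap.prodMap (((a⁻¹ : ℂˣ) : ℂ) • LinearMap.id) ((a : ℂ) • LinearMap.id)

/-- The action of `a ∈ ℂ*` on the generators of `H`. -/
def scaleFree (a : ℂˣ) : FreeAlgebra ℂ (Gen W) →ₐ[ℂ] RCA W t c :=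
  FreeAlgebra.lift ℂ fun s => match s with
    | Gen.vec v => RCA.vec W t c (scaleV a v)
    | Gen.grp g => RCA.grp W t c g

theorem scaleFree_fv (a : ℂˣ) (v : V h) :
    scaleFree W t c a (fv W v) = RCA.vec W t c (scaleV a v) := by
  simp [scaleFree, fv]

theorem scaleFree_fg (a : ℂˣ) (g : W) :
    scaleFree W t c a (fg W g) = RCA.grp W t c g := by
  simp [scaleFree, fg]

theorem RCA.comm_yx' (y : h) (x : Module.Dual ℂ h) (u : ℂ) (hu : u = 1) :
    u • (RCA.vec W t c (0, y) * RCA.vec W t c (x, 0) -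
      RCA.vec W t c (x, 0) * RCA.vec W t c (0, y)) =
    RCA.mk W t c (algebraMap ℂ _ (t * x y) -
          ∑ᶠ s : Reflections W, (c s * reflForm ((s : W) : h ≃ₗ[ℂ] h) y x) • fg W (s : W)) := by
  rw [hu, one_smul, ← RCA.mk_rel W t c (Rel.comm_yx y x)]
  rw [map_sub, map_mul, map_mul]
  rfl

theorem scaleFree_rel [Finite W] (a : ℂˣ) {p q : FreeAlgebra ℂ (Gen W)} (hpq : Rel W t c p q) :
    scaleFree W t c a p = scaleFree W t c a q := by
  have hx : ∀ x : Module.Dual ℂ h,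
      RCA.vec W t c (scaleV a (x, 0)) = ((a⁻¹ : ℂˣ) : ℂ) • RCA.vec W t c (x, 0) := by
    intro x; rw [← map_smul]; congr 1; simp [scaleV]
  have hy : ∀ y : h,
      RCA.vec W t c (scaleV a (0, y)) = (a : ℂ) • RCA.vec W t c (0, y) := by
    intro y; rw [← map_smul]; congr 1; simp [scaleV]
  cases hpq with
  | add v v' => simp [scaleFree_fv]
  | smul b v => simp [scaleFree_fv]
  | one => simp [scaleFree_fg]
  | mul g g' => simp [scaleFree_fg]
  | conj g v =>
    simp only [map_mul, scaleFree_fv, scaleFree_fg, RCA.grp_mul_vec]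
    congr 2
    ext <;> simp [scaleV, actV, dualAct]
  | comm_x x x' =>
    have := RCA.mk_rel W t c (Rel.comm_x x x')
    rw [map_mul, map_mul] at this
    change RCA.vec W t c (x, 0) * RCA.vec W t c (x', 0) =
      RCA.vec W t c (x', 0) * RCA.vec W t c (x, 0) at this
    simp only [map_mul, scaleFree_fv, hx, smul_mul_assoc, mul_smul_comm, this]
  | comm_y y y' =>
    have := RCA.mk_rel W t c (Rel.comm_y y y')
    rw [map_mul, map_mul] at this
    change RCA.vec W t c (0, y) * RCA.vec W t c (0, y') =
      RCA.vec W t c (0, y') * RCA.vec W t c (0, y) at this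
    simp only [map_mul, scaleFree_fv, hy, smul_mul_assoc, mul_smul_comm, this]
  | comm_yx y x =>
    have hfin : Finite (Reflections W) := inferInstance
    have := Fintype.ofFinite (Reflections W)
    have key := RCA.comm_yx' W t c y x ((a : ℂ) * ((a⁻¹ : ℂˣ) : ℂ)) (by simp)
    have e1 : scaleFree W t c a (fv W (0, y) * fv W (x, 0) - fv W (x, 0) * fv W (0, y)) =
        ((a : ℂ) * ((a⁻¹ : ℂˣ) : ℂ)) • (RCA.vec W t c (0, y) * RCA.vec W t c (x, 0) -
          RCA.vec W t c (x, 0) * RCA.vec W t c (0, y)) := by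
      simp only [map_sub, map_mul, scaleFree_fv, hx, hy, smul_mul_assoc, mul_smul_comm, smul_smul,
        smul_sub, mul_comm]
    rw [e1, key, finsum_eq_sum_of_fintype]
    simp only [map_sub, map_sum, map_smul, AlgHom.commutes, scaleFree_fg]
    rfl

/-- The `ℂ*`-action on `H` by algebra homomorphisms: `a·x = a⁻¹x`, `a·y = ay`, `a·w = w`. -/
def scaleH [Finite W] (a : ℂˣ) : RCA W t c →ₐ[ℂ] RCA W t c :=
  RingQuot.liftAlgHom ℂ ⟨scaleFree W t c a, fun _ _ hpq => scaleFree_rel W t c a hpq⟩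

/-- `scaleV` preserves the quadratic form. -/
def scaleIso (a : ℂˣ) : Q h →qᵢ Q h where
  toLinearMap := scaleV a
  map_app' v := by simp [scaleV, Q]

/-- The `ℂ*`-action on `C(V)` by algebra homomorphisms: `a·x = a⁻¹x`, `a·y = ay`. -/
def scaleCl (a : ℂˣ) : Cl h →ₐ[ℂ] Cl h := CliffordAlgebra.map (scaleIso a)

/-- The subalgebra `𝐀 = (H ⊗ C(V))^{ℂ*}`. -/
def algA [Finite W] : Subalgebra ℂ (HC W t c) :=
  ⨅ a : ℂˣ, AlgHom.equalizer
    (Algebra.TensorProduct.map (scaleH W t c a) (scaleCl a)) (AlgHom.id ℂ (HC W t c))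

end Scaling

section DoubleCover

variable {h : Type u} [AddCommGroup h] [Module ℂ h]

theorem actV_one (v : V h) : actV (1 : h ≃ₗ[ℂ] h) v = v := by
  ext <;> simp [actV, dualAct]

theorem actV_mul (g g' : h ≃ₗ[ℂ] h) (v : V h) : actV (g * g') v = actV g (actV g' v) := by
  ext <;> simp [actV, dualAct]

/-- The double cover `W̃` of `W`: the pull-back of the Pin cover `Pin(V) → O(V)` along
`W → O(V)`, as pairs `(g, a)`. Since `W` acts on `V = 𝔥* ⊕ 𝔥` with determinant one, the preimage
of `W` consists of even elements `a`, with `aᵗa = 1`, such that conjugation by `a` is the action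
of `g` on `V`. -/
def doubleCover (W : Subgroup (h ≃ₗ[ℂ] h)) : Subgroup (W × (Cl h)ˣ) where
  carrier := {p | (p.2 : Cl h) ∈ CliffordAlgebra.even (Q h) ∧ star (p.2 : Cl h) * p.2 = 1 ∧
    ∀ v : V h, (p.2 : Cl h) * CliffordAlgebra.ι (Q h) v =
      CliffordAlgebra.ι (Q h) (actV (p.1 : h ≃ₗ[ℂ] h) v) * p.2}
  one_mem' := by
    refine ⟨Subalgebra.one_mem _, by simp, fun v => ?_⟩
    simp [actV_one]
  mul_mem' := by
    rintro ⟨g, a⟩ ⟨g', a'⟩ ⟨h1, h2, h3⟩ ⟨h1', h2', h3'⟩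
    refine ⟨Subalgebra.mul_mem _ h1 h1', ?_, fun v => ?_⟩
    · simp only [Prod.mk_mul_mk, Units.val_mul, star_mul]
      simp only at h2 h2'
      rw [mul_assoc, ← mul_assoc (star (a : Cl h)), h2, one_mul, h2']
    · simp only [Prod.mk_mul_mk, Units.val_mul, Subgroup.coe_mul, actV_mul]
      simp only at h3 h3'
      rw [mul_assoc, h3', ← mul_assoc, h3, mul_assoc]
  inv_mem' := by
    rintro ⟨g, a⟩ ⟨h1, h2, h3⟩
    simp only at h1 h2 h3
    have hinv : ((a⁻¹ : (Cl h)ˣ) : Cl h) = star (a : Cl h) := by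
      rw [← mul_one (star (a : Cl h)), ← Units.mul_inv a, ← mul_assoc, h2, one_mul]
    refine ⟨?_, ?_, fun v => ?_⟩
    · simp only [Prod.inv_mk, hinv]
      rw [CliffordAlgebra.star_def]
      have h1' : (a : Cl h) ∈ CliffordAlgebra.evenOdd (Q h) 0 := h1
      change _ ∈ CliffordAlgebra.evenOdd (Q h) 0
      rwa [CliffordAlgebra.reverse_mem_evenOdd_iff,
        CliffordAlgebra.involute_mem_evenOdd_iff]
    · simp only [Prod.inv_mk, hinv, star_star]
      rw [← hinv, Units.mul_inv]
    · have := h3 (actV (g : h ≃ₗ[ℂ] h)⁻¹ v)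
      rw [← actV_mul, mul_inv_cancel, actV_one] at this
      simp only [Prod.inv_mk, Subgroup.coe_inv]
      rw [Units.inv_mul_eq_iff_eq_mul, ← mul_assoc, this, mul_assoc, Units.mul_inv, mul_one]

/-- The covering map `p : W̃ → W`. -/
def coverMap (W : Subgroup (h ≃ₗ[ℂ] h)) : doubleCover W →* W :=
  (MonoidHom.fst W (Cl h)ˣ).comp (doubleCover W).subtype

/-- The inclusion `W̃ → C(V)ˣ ⊂ C(V)`. -/
def coverIncl (W : Subgroup (h ≃ₗ[ℂ] h)) : doubleCover W →* Cl h :=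
  (Units.coeHom (Cl h)).comp ((MonoidHom.snd W (Cl h)ˣ).comp (doubleCover W).subtype)

/-- The element `-1 ∈ W̃`, the nontrivial element of the kernel of `p`. -/
def negOne (W : Subgroup (h ≃ₗ[ℂ] h)) : doubleCover W :=
  ⟨(1, -1), by
    refine ⟨?_, ?_, fun v => ?_⟩
    · simp only [Units.val_neg, Units.val_one]
      exact Subalgebra.neg_mem _ (Subalgebra.one_mem (CliffordAlgebra.even (Q h)))
    · simp
    · simp [actV_one]⟩

/-- A representation of `W̃` is genuine if `-1` acts by `-1`. -/
def IsGenuine {W : Subgroup (h ≃ₗ[ℂ] h)} {E : Type v} [AddCommGroup E] [Module ℂ E]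
    (ρ : Representation ℂ (doubleCover W) E) : Prop :=
  ∀ e : E, ρ (negOne W) e = -e

/-- The action of `C(V)` on the spinor module `S = ⋀𝔥`: `y ∈ 𝔥` acts by left multiplication
and `x ∈ 𝔥*` by `-2` times the contraction. -/
def spinor : Cl h →ₐ[ℂ] Module.End ℂ (ExteriorAlgebra ℂ h) :=
  CliffordAlgebra.lift (Q h) ⟨
    ((-2 : ℂ) • (CliffordAlgebra.contractLeft (Q := (0 : QuadraticForm ℂ h)))).coprod
      ((LinearMap.mul ℂ (ExteriorAlgebra ℂ h)).comp (ExteriorAlgebra.ι ℂ)), by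
    rintro ⟨x, y⟩
    refine LinearMap.ext fun z => ?_
    have h1 : CliffordAlgebra.contractLeft (Q := (0 : QuadraticForm ℂ h)) x
        (ExteriorAlgebra.ι ℂ y * z) = x y • z -
          ExteriorAlgebra.ι ℂ y * CliffordAlgebra.contractLeft x z :=
      CliffordAlgebra.contractLeft_ι_mul (Q := (0 : QuadraticForm ℂ h)) x y z
    have h2 : ExteriorAlgebra.ι ℂ y * (ExteriorAlgebra.ι ℂ y * z) = 0 := by
      rw [← mul_assoc, ExteriorAlgebra.ι_sq_zero, zero_mul]
    have h3 := CliffordAlgebra.contractLeft_contractLeft (Q := (0 : QuadraticForm ℂ h)) x z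
    simp only [LinearMap.coprod_apply, Module.End.mul_apply, LinearMap.add_apply,
      LinearMap.smul_apply, LinearMap.comp_apply, LinearMap.mul_apply',
      mul_add, mul_smul_comm, h1, h2, h3, Q, Module.algebraMap_end_apply,
      smul_apply, QuadraticForm.dualProd_apply, smul_zero, add_zero, zero_add,
      smul_sub, smul_assoc]
    abel⟩

/-- `χ` is the character by which `W̃` acts on the spinor module relative to the natural action of
`W` on `⋀𝔥`: `S ≅ ⋀𝔥 ⊗ χ` via the identity map. -/
def IsSpinCharacter (W : Subgroup (h ≃ₗ[ℂ] h)) (χ : doubleCover W →* ℂˣ) : Prop :=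
  ∀ (g : doubleCover W) (z : ExteriorAlgebra ℂ h),
    spinor (coverIncl W g) z =
      (χ g : ℂ) • ExteriorAlgebra.map ((coverMap W g : W) : h ≃ₗ[ℂ] h).toLinearMap z

/-- The `W̃`-representation `σ ⊗ χ`, for a representation `σ` of `W` and a character `χ`. -/
def twist {W : Subgroup (h ≃ₗ[ℂ] h)} {E : Type v} [AddCommGroup E] [Module ℂ E]
    (σ : Representation ℂ W E) (χ : doubleCover W →* ℂˣ) :
    Representation ℂ (doubleCover W) E where
  toFun g := (χ g : ℂ) • σ (coverMap W g)
  map_one' := by simp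
  map_mul' g g' := by
    simp only [map_mul, Units.val_mul, smul_mul_assoc, mul_smul_comm, smul_smul]
    rw [mul_comm]

end DoubleCover

section Vogan

variable {h : Type u} [AddCommGroup h] [Module ℂ h]
variable (W : Subgroup (h ≃ₗ[ℂ] h)) (t : ℂ) (c : Reflections W → ℂ)

/-- The diagonal map `Δ : ℂ[W̃] → H ⊗ C(V)`, `w̃ ↦ p(w̃) ⊗ w̃`. -/
def diag : MonoidAlgebra ℂ (doubleCover W) →ₐ[ℂ] HC W t c :=
  MonoidAlgebra.lift ℂ (HC W t c) (doubleCover W)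
    { toFun := fun g => RCA.grp W t c (coverMap W g) ⊗ₜ[ℂ] coverIncl W g
      map_one' := by simp [Algebra.TensorProduct.one_def]
      map_mul' := fun g g' => by simp }

/-- `Δ(ℂ[W̃]^W̃)`; the conjugation invariants of `ℂ[W̃]` are its centre. -/
def diagCenter : Subalgebra ℂ (HC W t c) :=
  (Subalgebra.center ℂ (MonoidAlgebra ℂ (doubleCover W))).map (diag W t c)

/-- The invariants `𝐀^W̃`. -/
def algAW [Finite W] : Subalgebra ℂ (HC W t c) :=
  algA W t c ⊓ Subalgebra.centralizer ℂ ((diag W t c).range : Set (HC W t c))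

/-- `D_x = ∑ᵢ xᵢ ⊗ yᵢ`, for a basis `yᵢ` of `𝔥` and the dual basis `xᵢ` of `𝔥*`. -/
def Dx [FiniteDimensional ℂ h] : HC W t c :=
  ∑ i, RCA.vec W t c ((Module.finBasis ℂ h).coord i, 0) ⊗ₜ[ℂ]
    CliffordAlgebra.ι (Q h) (0, Module.finBasis ℂ h i)

/-- `D_y = ∑ᵢ yᵢ ⊗ xᵢ`. -/
def Dy [FiniteDimensional ℂ h] : HC W t c :=
  ∑ i, RCA.vec W t c (0, Module.finBasis ℂ h i) ⊗ₜ[ℂ]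
    CliffordAlgebra.ι (Q h) ((Module.finBasis ℂ h).coord i, 0)

variable {W t c}

/-- The operator `δ(a) = D a - ε(a) D`; it is `δ_d` for `D = D_x` and `δ_∂` for `D = D_y`. -/
def delta (D : HC W t c) : HC W t c →ₗ[ℂ] HC W t c :=
  LinearMap.mulLeft ℂ D - (LinearMap.mulRight ℂ D).comp (eps W t c).toLinearMap

/-- The kernel of `δ : 𝐀^W̃ → 𝐀^W̃`. -/
def kerDelta [Finite W] (D : HC W t c) : Submodule ℂ (HC W t c) :=
  (algAW W t c).toSubmodule ⊓ LinearMap.ker (delta D)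

/-- The image of `δ : 𝐀^W̃ → 𝐀^W̃`. -/
def imDelta [Finite W] (D : HC W t c) : Submodule ℂ (HC W t c) :=
  (algAW W t c).toSubmodule.map (delta D)

/-- `B` is an abelian subalgebra of `ker δ ∩ (H ⊗ C^even(V))`. -/
structure IsVoganSubalgebra [Finite W] (D : HC W t c) (B : Subalgebra ℂ (HC W t c)) : Prop where
  comm : ∀ a ∈ B, ∀ b ∈ B, a * b = b * a
  mem_ker : ∀ b ∈ B, b ∈ kerDelta D
  even : B ≤ evenPart W t c

theorem eps_of_even {a : HC W t c} (ha : a ∈ evenPart W t c) : eps W t c a = a := by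
  obtain ⟨b, rfl⟩ := ha
  induction b using TensorProduct.induction_on with
  | zero => simp
  | tmul p q =>
    have : CliffordAlgebra.involute (q : Cl h) = q :=
      CliffordAlgebra.involute_eq_of_mem_even q.2
    simp [eps, this]
  | add p q hp hq =>
    simp only [AlgHom.toRingHom_eq_coe, RingHom.coe_coe, map_add] at hp hq ⊢
    rw [hp, hq]

theorem IsVoganSubalgebra.commute [Finite W] {D : HC W t c} {B : Subalgebra ℂ (HC W t c)}
    (hB : IsVoganSubalgebra D B) (b : B) : Commute (b : HC W t c) D := by
  have h1 : delta D (b : HC W t c) = 0 := (hB.mem_ker b b.2).2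
  simp only [delta, LinearMap.sub_apply, LinearMap.mulLeft_apply, LinearMap.comp_apply,
    AlgHom.toLinearMap_apply, LinearMap.mulRight_apply, eps_of_even (hB.even b.2)] at h1
  exact (sub_eq_zero.mp h1).symm

/-- `ζ : B → Δ(ℂ[W̃]^W̃)` is the restriction to `B` of the projection of `ker δ` onto
`Δ(ℂ[W̃]^W̃)` along `im δ`. -/
def IsVoganProjection [Finite W] (D : HC W t c) (B : Subalgebra ℂ (HC W t c))
    (ζ : B →ₐ[ℂ] diagCenter W t c) : Prop :=
  ∀ b : B, (b : HC W t c) - (ζ b : HC W t c) ∈ imDelta D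

/-- `ζ*(ρ) = β`: for each `b ∈ B`, the element `ζ(b)` of `Δ(ℂ[W̃]^W̃)` acts on `ρ`
by the scalar `β(b)`. -/
def IsVoganValue {B : Subalgebra ℂ (HC W t c)} (ζ : B →ₐ[ℂ] diagCenter W t c)
    {E : Type v} [AddCommGroup E] [Module ℂ E]
    (ρ : Representation ℂ (doubleCover W) E) (β : B →ₐ[ℂ] ℂ) : Prop :=
  ∀ b : B, ∀ z ∈ Subalgebra.center ℂ (MonoidAlgebra ℂ (doubleCover W)),
    diag W t c z = (ζ b : HC W t c) → ∀ e : E, ρ.asAlgebraHom z e = β b • e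

end Vogan

section Homology

variable {X : Type v} [AddCommGroup X] [Module ℂ X]

/-- The (co)homology `ker D / im D` of an operator `D` (with `D² = 0`). -/
abbrev Homology (D : Module.End ℂ X) : Type v :=
  LinearMap.ker D ⧸ (LinearMap.range D).submoduleOf (LinearMap.ker D)

/-- The restriction to `ker D` of an operator commuting with `D`. -/
def kerMap (D T : Module.End ℂ X) (hT : Commute T D) :
    LinearMap.ker D →ₗ[ℂ] LinearMap.ker D :=
  T.restrict fun m hm => by
    rw [LinearMap.mem_ker] at hm ⊢
    rw [← Module.End.mul_apply, ← hT.eq, Module.End.mul_apply, hm, map_zero]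

/-- The map induced on `ker D / im D` by an operator commuting with `D`. -/
def homologyMap (D T : Module.End ℂ X) (hT : Commute T D) :
    Homology D →ₗ[ℂ] Homology D :=
  Submodule.mapQ _ _ (kerMap D T hT) (by
      rintro ⟨m, hm⟩ ⟨n, hn⟩
      refine ⟨T n, ?_⟩
      have hn' : D n = m := hn
      change D (T n) = T m
      rw [← Module.End.mul_apply, ← hT.eq, Module.End.mul_apply, hn'])

/-- The action on `ker D / im D` of the algebra of operators commuting with `D`. -/
def homologyAction (D : Module.End ℂ X) :
    Subalgebra.centralizer ℂ ({D} : Set (Module.End ℂ X)) →ₐ[ℂ] Module.End ℂ (Homology D) :=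
  AlgHom.ofLinearMap
    { toFun := fun T => homologyMap D T (T.2 D rfl).symm
      map_add' := fun S T => by
        ext m; rfl
      map_smul' := fun a T => by
        ext m; rfl }
    (by ext m; rfl)
    (fun S T => by ext m; rfl)

/-- A representation on `X` commuting with `D` acts on `ker D / im D`. -/
def homologyRep {G : Type w} [Group G] (D : Module.End ℂ X) (R : Representation ℂ G X)
    (hR : ∀ g, Commute (R g) D) : Representation ℂ G (Homology D) where
  toFun g := homologyMap D (R g) (hR g)
  map_one' := by
    ext m
    exact congrArg (Submodule.Quotient.mk) (Subtype.ext (by simp [kerMap]))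
  map_mul' g g' := by
    ext m
    exact congrArg (Submodule.Quotient.mk) (Subtype.ext (by simp [kerMap]))

/-- An algebra acting on `X` by operators commuting with `D` acts on `ker D / im D`. -/
def homologyAlg {B : Type w} [Ring B] [Algebra ℂ B] (D : Module.End ℂ X)
    (φ : B →ₐ[ℂ] Module.End ℂ X) (hφ : ∀ b, Commute (φ b) D) :
    B →ₐ[ℂ] Module.End ℂ (Homology D) :=
  (homologyAction D).comp (φ.codRestrict _ fun b => by
    rw [Subalgebra.mem_centralizer_iff]
    rintro _ rfl
    exact (hφ b).eq.symm)

/-- `σ ⊗ β` is an isotypic component (that is, has a nonzero isotypic component) in a space `X` on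
which a group `G` and an algebra `B` act: there is a nonzero `G`- and `B`-equivariant map from
`σ ⊗ β` to `X`. -/
def HasIsotypic {G : Type*} [Group G] {B : Type*} [Ring B] [Algebra ℂ B]
    {E : Type*} [AddCommGroup E] [Module ℂ E] (σ : Representation ℂ G E) (β : B →ₐ[ℂ] ℂ)
    (R : Representation ℂ G X) (φ : B →ₐ[ℂ] Module.End ℂ X) : Prop :=
  ∃ f : E →ₗ[ℂ] X, f ≠ 0 ∧ (∀ g e, f (σ g e) = R g (f e)) ∧ ∀ b e, φ b (f e) = β b • f e

end Homology

section Modules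

variable {h : Type u} [AddCommGroup h] [Module ℂ h]
variable {W : Subgroup (h ≃ₗ[ℂ] h)} {t : ℂ} {c : Reflections W → ℂ}
variable (M : Type v) [AddCommGroup M] [Module ℂ M] [Module (RCA W t c) M]
  [IsScalarTower ℂ (RCA W t c) M]

/-- The space `M ⊗ S = M ⊗ ⋀𝔥`. -/
abbrev MS (h : Type u) [AddCommGroup h] [Module ℂ h] (M : Type v) [AddCommGroup M]
    [Module ℂ M] : Type (max u v) := M ⊗[ℂ] ExteriorAlgebra ℂ h

/-- The action of `H` on `M`. -/
def actM : RCA W t c →ₐ[ℂ] Module.End ℂ M := Algebra.lsmul ℂ ℂ M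

/-- The action of `H ⊗ C(V)` on `M ⊗ S`. -/
def actMS : HC W t c →ₐ[ℂ] Module.End ℂ (MS h M) :=
  (Module.endTensorEndAlgHom (R := ℂ) (S := ℂ) (A := ℂ)).comp
    (Algebra.TensorProduct.map (actM M) spinor)

theorem actMS_tmul (a : RCA W t c) (b : Cl h) :
    actMS M (a ⊗ₜ[ℂ] b) = TensorProduct.map (actM M a) (spinor b) := by
  rfl

theorem spinor_x (x : Module.Dual ℂ h) :
    spinor (CliffordAlgebra.ι (Q h) (x, 0)) =
      (-2 : ℂ) • CliffordAlgebra.contractLeft (Q := (0 : QuadraticForm ℂ h)) x := by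
  rw [spinor, CliffordAlgebra.lift_ι_apply]
  simp only [LinearMap.coprod_apply, LinearMap.smul_apply, map_zero, add_zero]

theorem spinor_y (y : h) :
    spinor (CliffordAlgebra.ι (Q h) (0, y)) =
      LinearMap.mulLeft ℂ (ExteriorAlgebra.ι ℂ y) := by
  rw [spinor, CliffordAlgebra.lift_ι_apply]
  simp only [LinearMap.coprod_apply, map_zero, zero_add]
  rfl

theorem contractLeft_map (g : h ≃ₗ[ℂ] h) (x : Module.Dual ℂ h) (z : ExteriorAlgebra ℂ h) :
    ExteriorAlgebra.map g.toLinearMap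
        (CliffordAlgebra.contractLeft (Q := (0 : QuadraticForm ℂ h)) x z) =
      CliffordAlgebra.contractLeft (Q := (0 : QuadraticForm ℂ h)) (dualAct g x)
        (ExteriorAlgebra.map g.toLinearMap z) := by
  induction z using CliffordAlgebra.left_induction with
  | algebraMap r =>
    rw [CliffordAlgebra.contractLeft_algebraMap, AlgHom.commutes,
      CliffordAlgebra.contractLeft_algebraMap, map_zero]
  | add a b ha hb => rw [map_add, map_add, map_add, ha, hb, map_add]
  | ι_mul z y hz =>
    have h1 : ExteriorAlgebra.map g.toLinearMap (CliffordAlgebra.ι 0 y) =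
        CliffordAlgebra.ι 0 (g y) := ExteriorAlgebra.map_apply_ι _ _
    have h2 : dualAct g x (g y) = x y := by
      simp [dualAct]
    rw [CliffordAlgebra.contractLeft_ι_mul, map_sub, map_smul, map_mul, map_mul, h1, hz,
      CliffordAlgebra.contractLeft_ι_mul, h2]

theorem diag_single_mul_tmul (g : doubleCover W) (v v' : V h) :
    diag W t c (MonoidAlgebra.of ℂ _ g) *
        (RCA.vec W t c v ⊗ₜ[ℂ] CliffordAlgebra.ι (Q h) v') =
      (RCA.vec W t c (actV ((coverMap W g : W) : h ≃ₗ[ℂ] h) v) ⊗ₜ[ℂ]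
        CliffordAlgebra.ι (Q h) (actV ((coverMap W g : W) : h ≃ₗ[ℂ] h) v')) *
      diag W t c (MonoidAlgebra.of ℂ _ g) := by
  have h1 : diag W t c (MonoidAlgebra.of ℂ _ g) =
      RCA.grp W t c (coverMap W g) ⊗ₜ[ℂ] coverIncl W g := by
    rw [diag, MonoidAlgebra.lift_of]; rfl
  have h2 : coverIncl W g * CliffordAlgebra.ι (Q h) v' =
      CliffordAlgebra.ι (Q h) (actV ((coverMap W g : W) : h ≃ₗ[ℂ] h) v') * coverIncl W g :=
    g.2.2.2 v'
  rw [h1, Algebra.TensorProduct.tmul_mul_tmul, Algebra.TensorProduct.tmul_mul_tmul, h2,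
    RCA.grp_mul_vec]

variable [FiniteDimensional ℂ h]

/-- The differential of the complex `M ⊗ ⋀^• 𝔥` computing `H^•(𝔥*, M)` (on the total space):
`d (m ⊗ ω) = ∑ⱼ xⱼ m ⊗ yⱼ ∧ ω`. -/
def cohomD (W : Subgroup (h ≃ₗ[ℂ] h)) (t : ℂ) (c : Reflections W → ℂ) (M : Type v)
    [AddCommGroup M] [Module ℂ M] [Module (RCA W t c) M] [IsScalarTower ℂ (RCA W t c) M] :
    Module.End ℂ (MS h M) :=
  ∑ j, TensorProduct.map (actM M (RCA.vec W t c ((Module.finBasis ℂ h).coord j, 0)))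
    (LinearMap.mulLeft ℂ (ExteriorAlgebra.ι ℂ (Module.finBasis ℂ h j)))

/-- The differential of the complex `M ⊗ ⋀^• 𝔥` computing `H_•(𝔥, M)` (on the total space):
`∂ (m ⊗ v₁ ∧ … ∧ vₚ) = ∑ₖ (-1)ᵏ vₖ m ⊗ v₁ ∧ … v̂ₖ … ∧ vₚ`. -/
def homD (W : Subgroup (h ≃ₗ[ℂ] h)) (t : ℂ) (c : Reflections W → ℂ) (M : Type v)
    [AddCommGroup M] [Module ℂ M] [Module (RCA W t c) M] [IsScalarTower ℂ (RCA W t c) M] :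
    Module.End ℂ (MS h M) :=
  -∑ j, TensorProduct.map (actM M (RCA.vec W t c (0, Module.finBasis ℂ h j)))
    (CliffordAlgebra.contractLeft (Q := (0 : QuadraticForm ℂ h)) ((Module.finBasis ℂ h).coord j))

theorem actMS_Dx : actMS M (Dx W t c) = cohomD W t c M := by
  simp only [Dx, cohomD, map_sum, actMS_tmul, spinor_y]

theorem actMS_Dy : actMS M (Dy W t c) = (2 : ℂ) • homD W t c M := by
  simp only [Dy, homD, map_sum, actMS_tmul, spinor_x, TensorProduct.map_smul_right, smul_neg,
    ← Finset.smul_sum, neg_smul]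

/-- The diagonal action of `W` on `M ⊗ ⋀𝔥`. -/
def repW (W : Subgroup (h ≃ₗ[ℂ] h)) (t : ℂ) (c : Reflections W → ℂ) (M : Type v)
    [AddCommGroup M] [Module ℂ M] [Module (RCA W t c) M] [IsScalarTower ℂ (RCA W t c) M] :
    Representation ℂ W (MS h M) where
  toFun g := TensorProduct.map (actM M (RCA.grp W t c g))
    (ExteriorAlgebra.map (g : h ≃ₗ[ℂ] h).toLinearMap).toLinearMap
  map_one' := by
    ext m z
    simp
  map_mul' g g' := by
    have h2 : ExteriorAlgebra.map ((g * g' : W) : h ≃ₗ[ℂ] h).toLinearMap =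
        (ExteriorAlgebra.map (g : h ≃ₗ[ℂ] h).toLinearMap).comp
          (ExteriorAlgebra.map (g' : h ≃ₗ[ℂ] h).toLinearMap) := by
      ext y; simp
    rw [h2, map_mul, map_mul, AlgHom.comp_toLinearMap]
    exact TensorProduct.map_comp _ _ _ _

theorem sum_dual_invariant {Y : Type w} [AddCommGroup Y] [Module ℂ Y]
    (φ : Module.Dual ℂ h →ₗ[ℂ] h →ₗ[ℂ] Y) (g : h ≃ₗ[ℂ] h) :
    ∑ i, φ (dualAct g ((Module.finBasis ℂ h).coord i)) (g (Module.finBasis ℂ h i)) =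
      ∑ i, φ ((Module.finBasis ℂ h).coord i) (Module.finBasis ℂ h i) := by
  set b := Module.finBasis ℂ h
  have h1 : ∀ i, φ (dualAct g (b.coord i)) (g (b i)) =
      ∑ j, φ (b.coord j (g (b i)) • dualAct g (b.coord i)) (b j) := by
    intro i
    conv_lhs => rw [← b.sum_repr (g (b i))]
    simp only [map_sum, map_smul, LinearMap.smul_apply, Module.Basis.coord_apply]
  simp only [h1]
  rw [Finset.sum_comm]
  refine Finset.sum_congr rfl fun j _ => ?_
  rw [← LinearMap.sum_apply, ← map_sum]
  congr 2
  ext y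
  have h2 : g (g⁻¹ y) = y := g.apply_symm_apply y
  conv_rhs => rw [← h2, ← b.sum_repr (g⁻¹ y)]
  simp only [map_sum, map_smul, LinearMap.sum_apply, LinearMap.smul_apply, dualAct,
    LinearMap.comp_apply, smul_eq_mul, Module.Basis.coord_apply, LinearEquiv.coe_coe]
  exact Finset.sum_congr rfl fun i _ => mul_comm _ _

theorem repW_commute_cohomD (g : W) : Commute (repW W t c M g) (cohomD W t c M) := by
  let φ : Module.Dual ℂ h →ₗ[ℂ] h →ₗ[ℂ] Module.End ℂ (MS h M) :=
    (TensorProduct.mapBilinear (.id ℂ) M (ExteriorAlgebra ℂ h) M (ExteriorAlgebra ℂ h)).compl₁₂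
      ((actM M).toLinearMap ∘ₗ RCA.vec W t c ∘ₗ LinearMap.inl ℂ (Module.Dual ℂ h) h)
      (LinearMap.mul ℂ (ExteriorAlgebra ℂ h) ∘ₗ ExteriorAlgebra.ι ℂ)
  have key : ∀ (x : Module.Dual ℂ h) (y : h),
      repW W t c M g * φ x y =
      φ (dualAct (g : h ≃ₗ[ℂ] h) x) ((g : h ≃ₗ[ℂ] h) y) * repW W t c M g := by
    intro x y
    have hv := RCA.grp_mul_vec W t c g (x, 0)
    have hv' : actV (g : h ≃ₗ[ℂ] h) (x, 0) = (dualAct (g : h ≃ₗ[ℂ] h) x, 0) := by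
      simp [actV]
    rw [hv'] at hv
    refine TensorProduct.ext' fun m z => ?_
    change actM M (RCA.grp W t c g) (actM M (RCA.vec W t c (x, 0)) m) ⊗ₜ[ℂ]
      ExteriorAlgebra.map (g : h ≃ₗ[ℂ] h).toLinearMap (ExteriorAlgebra.ι ℂ y * z) =
      actM M (RCA.vec W t c (dualAct (g : h ≃ₗ[ℂ] h) x, 0)) (actM M (RCA.grp W t c g) m) ⊗ₜ[ℂ]
        (ExteriorAlgebra.ι ℂ ((g : h ≃ₗ[ℂ] h) y) *
          ExteriorAlgebra.map (g : h ≃ₗ[ℂ] h).toLinearMap z)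
    have hz : ExteriorAlgebra.map (g : h ≃ₗ[ℂ] h).toLinearMap (ExteriorAlgebra.ι ℂ y * z) =
        ExteriorAlgebra.ι ℂ ((g : h ≃ₗ[ℂ] h) y) *
          ExteriorAlgebra.map (g : h ≃ₗ[ℂ] h).toLinearMap z := by
      rw [map_mul (ExteriorAlgebra.map _), ExteriorAlgebra.map_apply_ι]
      rfl
    rw [hz, ← Module.End.mul_apply, ← Module.End.mul_apply, ← map_mul, ← map_mul, hv]
  have hd : cohomD W t c M =
      ∑ i, φ ((Module.finBasis ℂ h).coord i) (Module.finBasis ℂ h i) := rfl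
  change _ * _ = _ * _
  rw [hd, Finset.mul_sum, Finset.sum_congr rfl fun i _ => key _ _, ← Finset.sum_mul,
    sum_dual_invariant φ (g : h ≃ₗ[ℂ] h)]

theorem repW_commute_homD (g : W) : Commute (repW W t c M g) (homD W t c M) := by
  let φ : Module.Dual ℂ h →ₗ[ℂ] h →ₗ[ℂ] Module.End ℂ (MS h M) :=
    ((TensorProduct.mapBilinear (.id ℂ) M (ExteriorAlgebra ℂ h) M (ExteriorAlgebra ℂ h)).compl₁₂
      ((actM M).toLinearMap ∘ₗ RCA.vec W t c ∘ₗ LinearMap.inr ℂ (Module.Dual ℂ h) h)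
      (CliffordAlgebra.contractLeft (Q := (0 : QuadraticForm ℂ h)))).flip
  have key : ∀ (x : Module.Dual ℂ h) (y : h),
      repW W t c M g * φ x y =
      φ (dualAct (g : h ≃ₗ[ℂ] h) x) ((g : h ≃ₗ[ℂ] h) y) * repW W t c M g := by
    intro x y
    have hv := RCA.grp_mul_vec W t c g (0, y)
    have hv' : actV (g : h ≃ₗ[ℂ] h) (0, y) = (0, (g : h ≃ₗ[ℂ] h) y) := by
      simp [actV, dualAct]
    rw [hv'] at hv
    refine TensorProduct.ext' fun m z => ?_
    change actM M (RCA.grp W t c g) (actM M (RCA.vec W t c (0, y)) m) ⊗ₜ[ℂ]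
      ExteriorAlgebra.map (g : h ≃ₗ[ℂ] h).toLinearMap (CliffordAlgebra.contractLeft x z) =
      actM M (RCA.vec W t c (0, (g : h ≃ₗ[ℂ] h) y)) (actM M (RCA.grp W t c g) m) ⊗ₜ[ℂ]
        (CliffordAlgebra.contractLeft (dualAct (g : h ≃ₗ[ℂ] h) x)
          (ExteriorAlgebra.map (g : h ≃ₗ[ℂ] h).toLinearMap z))
    rw [← Module.End.mul_apply, ← Module.End.mul_apply, ← map_mul, ← map_mul, hv,
      contractLeft_map]
  have hd : homD W t c M =
      -∑ i, φ ((Module.finBasis ℂ h).coord i) (Module.finBasis ℂ h i) := rfl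
  have hn : ∀ S T : Module.End ℂ (MS h M), S * T = T * S → Commute S (-T) := fun S T hST =>
    LinearMap.ext fun m => by
      have := LinearMap.congr_fun hST m
      simp only [Module.End.mul_apply] at this
      simp only [Module.End.mul_apply, LinearMap.neg_apply, map_neg, this]
  rw [hd]
  refine hn _ _ ?_
  rw [Finset.mul_sum, Finset.sum_congr rfl fun i _ => key _ _, ← Finset.sum_mul,
    sum_dual_invariant φ (g : h ≃ₗ[ℂ] h)]

variable (W t c) in
/-- The bilinear map `(x, y) ↦ x ⊗ y` from `𝔥* × 𝔥` to `H ⊗ C(V)`. -/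
def tensXY : Module.Dual ℂ h →ₗ[ℂ] h →ₗ[ℂ] HC W t c :=
  (TensorProduct.mk ℂ (RCA W t c) (Cl h)).compl₁₂
    (RCA.vec W t c ∘ₗ LinearMap.inl ℂ (Module.Dual ℂ h) h)
    (CliffordAlgebra.ι (Q h) ∘ₗ LinearMap.inr ℂ (Module.Dual ℂ h) h)

variable (W t c) in
/-- The bilinear map `(x, y) ↦ y ⊗ x` from `𝔥* × 𝔥` to `H ⊗ C(V)`. -/
def tensYX : Module.Dual ℂ h →ₗ[ℂ] h →ₗ[ℂ] HC W t c :=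
  ((TensorProduct.mk ℂ (RCA W t c) (Cl h)).compl₁₂
    (RCA.vec W t c ∘ₗ LinearMap.inr ℂ (Module.Dual ℂ h) h)
    (CliffordAlgebra.ι (Q h) ∘ₗ LinearMap.inl ℂ (Module.Dual ℂ h) h)).flip

variable (t c) in
theorem diag_commute_Dx (g : doubleCover W) :
    Commute (diag W t c (MonoidAlgebra.of ℂ _ g)) (Dx W t c) := by
  change _ * _ = _ * _
  have h1 := sum_dual_invariant (tensXY W t c) ((coverMap W g : W) : h ≃ₗ[ℂ] h)
  have hd : Dx W t c =
      ∑ i, tensXY W t c ((Module.finBasis ℂ h).coord i) (Module.finBasis ℂ h i) := rfl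
  rw [← hd] at h1
  conv_rhs => rw [← h1]
  rw [Dx, Finset.mul_sum, Finset.sum_mul]
  refine Finset.sum_congr rfl fun i _ => ?_
  rw [diag_single_mul_tmul]
  simp [tensXY, actV, dualAct]

variable (t c) in
theorem diag_commute_Dy (g : doubleCover W) :
    Commute (diag W t c (MonoidAlgebra.of ℂ _ g)) (Dy W t c) := by
  change _ * _ = _ * _
  have h1 := sum_dual_invariant (tensYX W t c) ((coverMap W g : W) : h ≃ₗ[ℂ] h)
  have hd : Dy W t c =
      ∑ i, tensYX W t c ((Module.finBasis ℂ h).coord i) (Module.finBasis ℂ h i) := rfl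
  rw [← hd] at h1
  conv_rhs => rw [← h1]
  rw [Dy, Finset.mul_sum, Finset.sum_mul]
  refine Finset.sum_congr rfl fun i _ => ?_
  rw [diag_single_mul_tmul]
  simp [tensYX, actV, dualAct]

/-- The representation of `W̃` on `M ⊗ S` through `Δ`. -/
def repCover (W : Subgroup (h ≃ₗ[ℂ] h)) (t : ℂ) (c : Reflections W → ℂ) (M : Type v)
    [AddCommGroup M] [Module ℂ M] [Module (RCA W t c) M] [IsScalarTower ℂ (RCA W t c) M] :
    Representation ℂ (doubleCover W) (MS h M) :=
  ((actMS M).toMonoidHom.comp (diag W t c).toMonoidHom).comp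
    (MonoidAlgebra.of ℂ (doubleCover W))

/-- `ker D_x / im D_x`, as a representation of `W̃`. -/
def repKerDx (W : Subgroup (h ≃ₗ[ℂ] h)) (t : ℂ) (c : Reflections W → ℂ) (M : Type v)
    [AddCommGroup M] [Module ℂ M] [Module (RCA W t c) M] [IsScalarTower ℂ (RCA W t c) M] :
    Representation ℂ (doubleCover W) (Homology (actMS M (Dx W t c))) :=
  homologyRep _ (repCover W t c M) fun g => (diag_commute_Dx t c g).map (actMS M)

/-- `ker D_y / im D_y`, as a representation of `W̃`. -/
def repKerDy (W : Subgroup (h ≃ₗ[ℂ] h)) (t : ℂ) (c : Reflections W → ℂ) (M : Type v)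
    [AddCommGroup M] [Module ℂ M] [Module (RCA W t c) M] [IsScalarTower ℂ (RCA W t c) M] :
    Representation ℂ (doubleCover W) (Homology (actMS M (Dy W t c))) :=
  homologyRep _ (repCover W t c M) fun g => (diag_commute_Dy t c g).map (actMS M)

/-- `H^•(𝔥*, M)`, the sum of all cohomology groups, as a representation of `W`. -/
def repCohom (W : Subgroup (h ≃ₗ[ℂ] h)) (t : ℂ) (c : Reflections W → ℂ) (M : Type v)
    [AddCommGroup M] [Module ℂ M] [Module (RCA W t c) M] [IsScalarTower ℂ (RCA W t c) M] :
    Representation ℂ W (Homology (cohomD W t c M)) :=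
  homologyRep _ (repW W t c M) (repW_commute_cohomD M)

/-- `H_•(𝔥, M)`, the sum of all homology groups, as a representation of `W`. -/
def repHom (W : Subgroup (h ≃ₗ[ℂ] h)) (t : ℂ) (c : Reflections W → ℂ) (M : Type v)
    [AddCommGroup M] [Module ℂ M] [Module (RCA W t c) M] [IsScalarTower ℂ (RCA W t c) M] :
    Representation ℂ W (Homology (homD W t c M)) :=
  homologyRep _ (repW W t c M) (repW_commute_homD M)

variable [Finite W] {B : Subalgebra ℂ (HC W t c)}

/-- The action of `B` on `ker D / im D` in `M ⊗ S`, for `D = D_x` or `D_y`. -/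
def algKer {D : HC W t c} (hB : IsVoganSubalgebra D B) :
    B →ₐ[ℂ] Module.End ℂ (Homology (actMS M D)) :=
  homologyAlg _ ((actMS M).comp B.val) fun b => (hB.commute b).map (actMS M)

/-- The action of `B` on `H^•(𝔥*, M)`, through `M ⊗ ⋀𝔥 = M ⊗ S`, `d = D_x`. -/
def algCohom (hB : IsVoganSubalgebra (Dx W t c) B) :
    B →ₐ[ℂ] Module.End ℂ (Homology (cohomD W t c M)) :=
  homologyAlg _ ((actMS M).comp B.val) fun b => by
    rw [← actMS_Dx]
    exact (hB.commute b).map (actMS M)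

/-- The action of `B` on `H_•(𝔥, M)`, through `M ⊗ ⋀𝔥 = M ⊗ S`, `2∂ = D_y`. -/
def algHomol (hB : IsVoganSubalgebra (Dy W t c) B) :
    B →ₐ[ℂ] Module.End ℂ (Homology (homD W t c M)) :=
  homologyAlg _ ((actMS M).comp B.val) fun b => by
    have h1 : homD W t c M = (2 : ℂ)⁻¹ • actMS M (Dy W t c) := by
      rw [actMS_Dy, smul_smul, inv_mul_cancel₀ two_ne_zero, one_smul]
    rw [h1]
    exact ((hB.commute b).map (actMS M)).smul_right _

end Modules

end Cherednik

end

open Cherednik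

/-! The substance is the cohomology of δ on the `ℂ*`-invariants of `H ⊗ C(V)`; the statements about
modules then follow formally. To treat D_x and D_y together, the argument is run for an abstract
pair `U`, `U'` in duality and a Dirac element `∑ xᵢ ⊗ yᵢ` with `xᵢ ∈ U`, `yᵢ ∈ U'`: D_x is the case
`U = 𝔥*`, D_y the case `U = 𝔥`.

A Poincaré-Birkhoff-Witt theorem (`HeckeDatum.Realization.pbw`) identifies `H` with `S(U) ⊗ S(U') ⊗
ℂ[W]`. It is proved by letting `H` act on that space, where the Jacobi-type identities for the
commutator form are exactly what makes the operators satisfy the relations. Each `g ∈ W` also has an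
even lift `a(g)` in the Pin group, given explicitly for pseudo-reflections
(`exists_isLift_reflection`) and extended to `W` because these generate it. So `f ⊗ c ⊗ k ⊗ g ↦ f k
g ⊗ c a(g)` is an isomorphism from `(S(U) ⊗ C) ⊗ (S(U') ⊗ ℂ[W])` to `H ⊗ C`. As `g ⊗ a(g)` is even
and commutes with the Dirac element, δ becomes, up to terms with fewer factors from `U'`, the Koszul
differential on `S(U) ⊗ C` tensored with the identity (`CliffordDatum.diff_sub_koszul_mem`).

The Koszul differential and its homotopy have a diagonalizable Laplacian, with eigenvalue `-2` times
the number of factors from `U`, in `S(U)` and `C` together. On its kernel only factors from `U'`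
survive; these all have the same sign of weight, so the degree-zero part of the kernel is spanned by
the elements `g ⊗ a(g)`, that is, by `Δ(ℂ[W̃])`. An induction on the filtration by the number of
factors from `U'` carries this from the Koszul differential to δ (`CliffordDatum.diff_cohomology`),
and averaging over the finite group `W̃` gives the decomposition of `ker δ` on `W̃`-invariants
(`IsDiracElement.kerDelta_eq`, `IsDiracElement.disjoint`).

Since δ is an ε-derivation, the projection ζ is multiplicative (`exists_voganProjection`). If `b -
ζ(b) = D a - ε(a) D`, then `b` and `ζ(b)` agree on `ker D / im D`, so on a joint isotypic component
the scalar by which `b` acts is the one by which `ζ(b)` acts (`isVoganValue_of_hasIsotypic`). The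
passage from `W̃` to `W` uses that `Δ(w̃)` acts on `M ⊗ S` as `χ(w̃)` times the diagonal action of
`p(w̃)` (`actMS_diag_of`). -/

namespace Cherednik

/-! ### Eigenvectors, pseudoinverses and filtered homotopies. -/

section LinearAlgebra

open Module.End

variable {X : Type*} [AddCommGroup X] [Module ℂ X]

/-- Eigenspaces for different eigenvalues are independent. The vectors `v i` only need to be
eigenvectors, not linearly independent, so this applies to spanning sets of monomials without
choosing bases. -/
theorem mem_span_of_apply_eq_smul {I : Type*} (T : Module.End ℂ X) (v : I → X) (e : I → ℂ)
    (hv : ∀ i, T (v i) = e i • v i) {s : Set I} {a : X} {μ : ℂ}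
    (ha : a ∈ Submodule.span ℂ (v '' s)) (hT : T a = μ • a) :
    a ∈ Submodule.span ℂ (v '' {i | i ∈ s ∧ e i = μ}) := by
  have hs : v '' s = v '' {i | i ∈ s ∧ e i = μ} ∪ v '' {i | i ∈ s ∧ e i ≠ μ} := by
    rw [← Set.image_union]
    congr 1
    ext i
    by_cases h : e i = μ <;> simp [h]
  rw [hs, Submodule.span_union, Submodule.mem_sup] at ha
  obtain ⟨b, hb, d, hd, rfl⟩ := ha
  have hb' : b ∈ eigenspace T μ := by
    refine Submodule.span_le.mpr ?_ hb
    rintro _ ⟨i, hi, rfl⟩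
    simpa [hi.2] using hv i
  have hd' : d ∈ ⨆ ν, ⨆ (_ : ν ≠ μ), eigenspace T ν := by
    refine Submodule.span_le.mpr ?_ hd
    rintro _ ⟨i, hi, rfl⟩
    exact Submodule.mem_iSup_of_mem (e i) (Submodule.mem_iSup_of_mem hi.2
      (mem_eigenspace_iff.mpr (hv i)))
  have hd'' : d ∈ eigenspace T μ := by
    have := Submodule.sub_mem _ (mem_eigenspace_iff.mpr hT) hb'
    rwa [add_sub_cancel_left] at this
  have h0 := (Submodule.disjoint_def.mp ((eigenspaces_iSupIndep T) μ)) d hd'' hd'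
  rwa [h0, add_zero]

/-- A diagonalizable operator is inverted on its nonzero eigenspaces; the complement `1 - N R` is
the projection onto the kernel. Both act by scalars on each eigenspace, hence commute with
everything that commutes with `N`. -/
theorem exists_pseudoinverse (N : Module.End ℂ X) (hN : ⨆ μ, eigenspace N μ = ⊤) :
    ∃ R π : Module.End ℂ X, (∀ x, N (R x) + π x = x) ∧ (∀ x, N (π x) = 0) ∧
      (∀ x, N x = 0 → R x = 0) ∧
      ∀ T : Module.End ℂ X, Commute T N → Commute T R ∧ Commute T π := by
  classical
  have hint : DirectSum.IsInternal (eigenspace N) :=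
    DirectSum.isInternal_submodule_of_iSupIndep_of_iSup_eq_top (eigenspaces_iSupIndep N) hN
  let e := LinearEquiv.ofBijective (DirectSum.coeLinearMap (eigenspace N)) hint
  -- The convention `0⁻¹ = 0` makes `R` vanish on the kernel of `N` with no case distinction.
  let R : Module.End ℂ X := (DirectSum.toModule ℂ ℂ X
    fun μ => μ⁻¹ • (eigenspace N μ).subtype) ∘ₗ e.symm.toLinearMap
  have hR : ∀ μ x, x ∈ eigenspace N μ → R x = μ⁻¹ • x := by
    intro μ x hx
    have : e.symm x = DirectSum.lof ℂ ℂ (fun μ => eigenspace N μ) μ ⟨x, hx⟩ := by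
      rw [LinearEquiv.symm_apply_eq]
      exact (DirectSum.coeLinearMap_lof (eigenspace N) μ ⟨x, hx⟩).symm
    simp [R, this]
  have hind : ∀ (A B : Module.End ℂ X), (∀ μ x, x ∈ eigenspace N μ → A x = B x) → A = B := by
    intro A B hAB
    ext x
    have hx : x ∈ ⨆ μ, eigenspace N μ := by rw [hN]; trivial
    induction hx using Submodule.iSup_induction' with
    | mem μ x hx => exact hAB μ x hx
    | zero => simp
    | add x y _ _ h1 h2 => rw [map_add, map_add, h1, h2]
  have hcomm : ∀ T : Module.End ℂ X, Commute T N → Commute T R := by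
    intro T hT
    refine hind _ _ fun μ x hx => ?_
    have hTx : T x ∈ eigenspace N μ := by
      rw [mem_eigenspace_iff] at hx ⊢
      rw [← Module.End.mul_apply, ← hT.eq, Module.End.mul_apply, hx, map_smul]
    simp [hR μ x hx, hR μ _ hTx]
  refine ⟨R, 1 - N * R, fun x => by simp, fun x => ?_, fun x hx => ?_, fun T hT => ?_⟩
  · have : N * (1 - N * R) = 0 := by
      refine hind _ _ fun μ x hx => ?_
      have hx' := mem_eigenspace_iff.mp hx
      by_cases hμ : μ = 0
      · simp [hR μ x hx, hx', hμ]
      · simp [hR μ x hx, hx', smul_smul, hμ]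
    exact LinearMap.congr_fun this x
  · have : x ∈ eigenspace N 0 := by simpa [mem_eigenspace_iff] using hx
    simp [hR 0 x this]
  · exact ⟨hcomm T hT, (Commute.one_right T).sub_right (hT.mul_right (hcomm T hT))⟩

/-- A differential which differs from an acyclic one by a filtration-lowering operator has
cohomology represented by `Z`. -/
theorem exists_eq_add_of_filtered_homotopy {Z A : Submodule ℂ X} (F : ℕ → Submodule ℂ X)
    (δ κ π : Module.End ℂ X) (hA : ∀ x ∈ A, δ x ∈ A ∧ κ x ∈ A ∧ π x ∈ Z) (hZA : Z ≤ A)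
    (hδ : ∀ x, δ (δ x) = 0) (hZ : ∀ z ∈ Z, δ z = 0) (hF0 : F 0 = ⊥)
    (hF : ∀ k, ∀ x ∈ F (k + 1), δ (κ x) + κ (δ x) + π x - x ∈ F k) {k : ℕ} :
    ∀ x ∈ A, x ∈ F k → δ x = 0 → ∃ y ∈ A, ∃ z ∈ Z, x = δ y + z := by
  induction k with
  | zero =>
    intro x hx hxF _
    rw [hF0, Submodule.mem_bot] at hxF
    exact ⟨0, A.zero_mem, 0, Z.zero_mem, by simp [hxF]⟩
  | succ k ih =>
    intro x hx hxF hx0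
    have h1 := hF k x hxF
    rw [hx0, map_zero, add_zero] at h1
    have hκ := (hA x hx).2.1
    have hπ := (hA x hx).2.2
    -- A cocycle `x` is `δ (κ x) + π x` minus an error one step lower in the filtration; the error
    -- is again a cocycle in `A`, so the induction hypothesis applies to it.
    obtain ⟨y, hy, z, hz, hyz⟩ := ih (δ (κ x) + π x - x)
      (A.sub_mem (A.add_mem (hA _ hκ).1 (hZA hπ)) hx) h1
      (by rw [map_sub, map_add, hδ, hZ _ hπ, hx0, add_zero, sub_zero])
    refine ⟨κ x - y, A.sub_mem hκ hy, π x - z, Z.sub_mem hπ hz, ?_⟩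
    rw [map_sub]
    have : x = δ (κ x) + π x - (δ (κ x) + π x - x) := by abel
    conv_lhs => rw [this, hyz]
    abel

/-- This makes the sum of `im δ` and `Z` direct. If `δ x ∈ Z`, then `κ` kills `δ x`, so the error `δ
(κ x) + π x - x` lies lower in the filtration while its differential is `-δ x`; one descends until
`x` lies in `F 0 = ⊥`. -/
theorem eq_zero_of_filtered_homotopy {Z A : Submodule ℂ X} (F : ℕ → Submodule ℂ X)
    (δ κ π : Module.End ℂ X) (hA : ∀ x ∈ A, δ x ∈ A ∧ κ x ∈ A ∧ π x ∈ Z) (hZA : Z ≤ A)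
    (hδ : ∀ x, δ (δ x) = 0) (hZ : ∀ z ∈ Z, δ z = 0) (hκZ : ∀ z ∈ Z, κ z = 0) (hF0 : F 0 = ⊥)
    (hF : ∀ k, ∀ x ∈ F (k + 1), δ (κ x) + κ (δ x) + π x - x ∈ F k) {k : ℕ} :
    ∀ x ∈ A, x ∈ F k → δ x ∈ Z → δ x = 0 := by
  induction k with
  | zero =>
    intro x hx hxF _
    rw [hF0, Submodule.mem_bot] at hxF
    rw [hxF, map_zero]
  | succ k ih =>
    intro x hx hxF hxZ
    have h1 := hF k x hxF
    rw [hκZ _ hxZ, add_zero] at h1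
    have hκ := (hA x hx).2.1
    have hπ := (hA x hx).2.2
    have h2 : δ (δ (κ x) + π x - x) = -δ x := by
      rw [map_sub, map_add, hδ, hZ _ hπ, add_zero, zero_sub]
    have := ih (δ (κ x) + π x - x) (A.sub_mem (A.add_mem (hA _ hκ).1 (hZA hπ)) hx) h1
      (by rw [h2]; exact Z.neg_mem hxZ)
    rwa [h2, neg_eq_zero] at this

end LinearAlgebra

/-! ### Operators on symmetric algebras defined by their commutators with the generators. -/

section SymmetricAlgebra

variable {U : Type*} [AddCommGroup U] [Module ℂ U]

/-- The extension to the symmetric algebra of a linear map with commuting values in a not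
necessarily commutative algebra. -/
noncomputable def symLift {A : Type*} [Ring A] [Algebra ℂ A] (φ : U →ₗ[ℂ] A)
    (hφ : ∀ u v, φ u * φ v = φ v * φ u) : SymmetricAlgebra ℂ U →ₐ[ℂ] A :=
  RingCon.liftₐ _ (TensorAlgebra.lift ℂ φ) <| by
    refine RingCon.ringConGen_le.2 fun x y h => ?_
    cases h with
    | mul_comm x y =>
      rw [RingCon.ker_apply]
      simpa using hφ x y

theorem symLift_ι {A : Type*} [Ring A] [Algebra ℂ A] (φ : U →ₗ[ℂ] A)
    (hφ : ∀ u v, φ u * φ v = φ v * φ u) (x : U) :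
    symLift φ hφ (SymmetricAlgebra.ι ℂ U x) = φ x := by
  have h1 : symLift φ hφ (SymmetricAlgebra.ι ℂ U x) =
      TensorAlgebra.lift ℂ φ (TensorAlgebra.ι ℂ x) := rfl
  rw [h1, TensorAlgebra.lift_ι_apply]

theorem span_list_prod_ι :
    Submodule.span ℂ (Set.range fun l : List U => (l.map (SymmetricAlgebra.ι ℂ U)).prod) = ⊤ := by
  rw [eq_top_iff]
  rintro f -
  induction f using SymmetricAlgebra.induction with
  | algebraMap r =>
    rw [Algebra.algebraMap_eq_smul_one]
    exact Submodule.smul_mem _ _ (Submodule.subset_span ⟨[], by simp⟩)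
  | ι x => exact Submodule.subset_span ⟨[x], by simp⟩
  | add a b ha hb => exact Submodule.add_mem _ ha hb
  | mul a b ha hb =>
    have := Submodule.mul_mem_mul ha hb
    rw [Submodule.span_mul_span] at this
    refine Submodule.span_mono ?_ this
    rintro _ ⟨_, ⟨l, rfl⟩, _, ⟨l', rfl⟩, rfl⟩
    exact ⟨l ++ l', by simp⟩

variable {G : Type*} [AddCommGroup G] [Module ℂ G]

-- Used to compare operators on `S(U) ⊗ G` that are known on `1 ⊗ G` and have known commutators with
-- multiplication by `U`.
@[elab_as_elim]
theorem sym_tensor_induction {motive : SymmetricAlgebra ℂ U ⊗[ℂ] G → Prop}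
    (one : ∀ g, motive (1 ⊗ₜ[ℂ] g))
    (smul : ∀ u p, motive p → motive (SymmetricAlgebra.ι ℂ U u • p))
    (add : ∀ p q, motive p → motive q → motive (p + q)) (p : SymmetricAlgebra ℂ U ⊗[ℂ] G) :
    motive p := by
  induction p using TensorProduct.induction_on with
  | zero => simpa using one 0
  | add p q hp hq => exact add p q hp hq
  | tmul f g =>
    have hf : f ∈ Submodule.span ℂ
        (Set.range fun l : List U => (l.map (SymmetricAlgebra.ι ℂ U)).prod) := by
      rw [span_list_prod_ι]; trivial
    induction hf using Submodule.span_induction generalizing g with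
    | mem x hx =>
      obtain ⟨l, rfl⟩ := hx
      induction l with
      | nil => simpa using one g
      | cons u l ih => simpa [TensorProduct.smul_tmul'] using smul u _ ih
    | zero => simpa using one 0
    | add x y _ _ h1 h2 => rw [TensorProduct.add_tmul]; exact add _ _ (h1 g) (h2 g)
    | smul a x _ h1 => rw [TensorProduct.smul_tmul]; exact h1 _

/-- An operator on `S(U) ⊗ G` can be prescribed by its values on `1 ⊗ G` and its commutators `K u`
with multiplication by `u`, as soon as `[T, uv]` comes out the same as `[T, vu]`, which is `hK`.
This extends derivations to commutators that are themselves operators. -/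
theorem exists_symExtension (K : U →ₗ[ℂ] Module.End ℂ (SymmetricAlgebra ℂ U ⊗[ℂ] G))
    (hK : ∀ u v p, K u (SymmetricAlgebra.ι ℂ U v • p) + SymmetricAlgebra.ι ℂ U u • K v p =
      K v (SymmetricAlgebra.ι ℂ U u • p) + SymmetricAlgebra.ι ℂ U v • K u p)
    (T₀ : G →ₗ[ℂ] SymmetricAlgebra ℂ U ⊗[ℂ] G) :
    ∃ T : Module.End ℂ (SymmetricAlgebra ℂ U ⊗[ℂ] G),
      (∀ u p, T (SymmetricAlgebra.ι ℂ U u • p) = K u p + SymmetricAlgebra.ι ℂ U u • T p) ∧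
      ∀ g, T (1 ⊗ₜ[ℂ] g) = T₀ g := by
  let P := SymmetricAlgebra ℂ U ⊗[ℂ] G
  let L : SymmetricAlgebra ℂ U →ₐ[ℂ] Module.End ℂ P := Algebra.lsmul ℂ ℂ P
  -- Lower triangular block matrices with `u` on the diagonal and `K u` below it. By `hK` they
  -- commute, so they define an action of `S(U)`; the second component of this action on `(1 ⊗ g, T₀
  -- g)` is the operator sought.
  let φ : U →ₗ[ℂ] Module.End ℂ (P × P) :=
    { toFun := fun u => ((L (SymmetricAlgebra.ι ℂ U u)).comp (LinearMap.fst ℂ P P)).prod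
        ((K u).comp (LinearMap.fst ℂ P P) +
          (L (SymmetricAlgebra.ι ℂ U u)).comp (LinearMap.snd ℂ P P))
      map_add' := fun u v => by
        refine LinearMap.ext fun p => Prod.ext ?_ ?_
        · simp
        · simp only [map_add, LinearMap.prod_apply, LinearMap.add_apply, LinearMap.comp_apply,
            Function.prod_apply]
          simp only [Prod.snd_add]
          abel
      map_smul' := fun a u => by
        refine LinearMap.ext fun p => Prod.ext ?_ ?_ <;> simp }
  have hφ1 : ∀ u p, (φ u p).1 = SymmetricAlgebra.ι ℂ U u • p.1 := fun u p => rfl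
  have hφ2 : ∀ u p, (φ u p).2 = K u p.1 + SymmetricAlgebra.ι ℂ U u • p.2 := fun u p => rfl
  have hcomm : ∀ u v, φ u * φ v = φ v * φ u := by
    intro u v
    refine LinearMap.ext fun p => Prod.ext ?_ ?_
    · simp only [Module.End.mul_apply, hφ1, smul_smul, mul_comm]
    · simp only [Module.End.mul_apply, hφ1, hφ2, smul_add, smul_smul, ← add_assoc, hK u v p.1,
        mul_comm]
  let Φ := symLift (A := Module.End ℂ (P × P)) φ hcomm
  have hΦ : ∀ f p, (Φ f p).1 = f • p.1 := by
    intro f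
    induction f using SymmetricAlgebra.induction with
    | algebraMap r => intro p; rw [AlgHom.commutes]; simp
    | ι x => intro p; simp only [Φ, symLift_ι, hφ1]
    | mul a b ha hb => intro p; rw [map_mul, Module.End.mul_apply, ha, hb, mul_smul]
    | add a b ha hb => intro p; rw [map_add, LinearMap.add_apply, Prod.fst_add, ha, hb, add_smul]
  let T : Module.End ℂ P := TensorProduct.lift
    (LinearMap.mk₂ ℂ (fun f g => (Φ f (1 ⊗ₜ g, T₀ g)).2)
      (fun f f' g => by simp)
      (fun a f g => by simp)
      (fun f g g' => by
        rw [TensorProduct.tmul_add, map_add T₀, ← Prod.mk_add_mk, map_add, Prod.snd_add])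
      (fun a f g => by
        rw [TensorProduct.tmul_smul, map_smul T₀, ← Prod.smul_mk, map_smul, Prod.smul_snd]))
  have hT : ∀ f g, T (f ⊗ₜ g) = (Φ f (1 ⊗ₜ g, T₀ g)).2 := fun f g => rfl
  refine ⟨T, fun u p => ?_, fun g => ?_⟩
  · induction p using TensorProduct.induction_on with
    | zero => simp
    | add p q hp hq => rw [smul_add, map_add, map_add, map_add, smul_add, hp, hq]; abel
    | tmul f g =>
      rw [TensorProduct.smul_tmul', smul_eq_mul, hT, hT, map_mul, Module.End.mul_apply]
      simp only [Φ, symLift_ι, hφ2]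
      rw [hΦ, TensorProduct.smul_tmul', smul_eq_mul, mul_one]
  · rw [hT, map_one]; rfl

/-- Scalar commutators `φ u` commute with multiplication, so the symmetry condition of
`exists_symExtension` is automatic; take `G = ℂ` and `T₀ = 0`. -/
theorem exists_symDerivation (φ : U →ₗ[ℂ] ℂ) :
    ∃ T : Module.End ℂ (SymmetricAlgebra ℂ U), T 1 = 0 ∧
      ∀ u f, T (SymmetricAlgebra.ι ℂ U u * f) = φ u • f + SymmetricAlgebra.ι ℂ U u * T f := by
  obtain ⟨T, h1, h2⟩ := exists_symExtension (U := U) (G := ℂ)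
    (φ.smulRight (1 : Module.End ℂ (SymmetricAlgebra ℂ U ⊗[ℂ] ℂ))) (fun u v p => by
      simp only [LinearMap.smulRight_apply, LinearMap.smul_apply, Module.End.one_apply,
        smul_comm (SymmetricAlgebra.ι ℂ U u), smul_comm (SymmetricAlgebra.ι ℂ U v)]
      rw [add_comm]) 0
  let e := TensorProduct.rid ℂ (SymmetricAlgebra ℂ U)
  have he : ∀ u p, e (SymmetricAlgebra.ι ℂ U u • p) = SymmetricAlgebra.ι ℂ U u * e p := by
    intro u p
    induction p using TensorProduct.induction_on with
    | zero => simp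
    | add p q hp hq => rw [smul_add, map_add, map_add, mul_add, hp, hq]
    | tmul f z => simp [e, TensorProduct.smul_tmul']
  have he' : ∀ f, e.symm f = f ⊗ₜ[ℂ] 1 := fun f => rfl
  refine ⟨e.toLinearMap ∘ₗ T ∘ₗ e.symm.toLinearMap, ?_, fun u f => ?_⟩
  · simp [he', h2]
  · have h3 : e.symm (SymmetricAlgebra.ι ℂ U u * f) =
        SymmetricAlgebra.ι ℂ U u • e.symm f := by
      rw [LinearEquiv.symm_apply_eq, he, LinearEquiv.apply_symm_apply]
    simp only [LinearMap.comp_apply, LinearEquiv.coe_coe, h3, h1, map_add, he]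
    simp

end SymmetricAlgebra

/-! ### A Poincaré-Birkhoff-Witt theorem for commutator forms with values in a group algebra. -/

section PBW

/-- The action of a group on a symmetric algebra. -/
noncomputable def symRep {W U : Type*} [Group W] [AddCommGroup U] [Module ℂ U]
    (ρ : Representation ℂ W U) : W →* (SymmetricAlgebra ℂ U →ₐ[ℂ] SymmetricAlgebra ℂ U) where
  toFun g := SymmetricAlgebra.lift (SymmetricAlgebra.ι ℂ U ∘ₗ ρ g)
  map_one' := by
    apply SymmetricAlgebra.algHom_ext
    ext x
    simp
  map_mul' g g' := by
    apply SymmetricAlgebra.algHom_ext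
    ext x
    simp

theorem symRep_ι {W U : Type*} [Group W] [AddCommGroup U] [Module ℂ U]
    (ρ : Representation ℂ W U) (g : W) (x : U) :
    symRep ρ g (SymmetricAlgebra.ι ℂ U x) = SymmetricAlgebra.ι ℂ U (ρ g x) := by
  simp [symRep]

/-- A commutator form `U' × U → ℂ[W]`, given by its coefficients `κ g`, subject to the conditions
under which the algebra generated by `U`, `U'` and `W` has a Poincaré-Birkhoff-Witt basis. -/
structure HeckeDatum (W U U' : Type*) [Group W] [AddCommGroup U] [Module ℂ U]
    [AddCommGroup U'] [Module ℂ U'] where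
  /-- the action on `U` -/
  ρ : Representation ℂ W U
  /-- the action on `U'` -/
  ρ' : Representation ℂ W U'
  /-- the coefficients of the commutator form -/
  κ : W → U' →ₗ[ℂ] U →ₗ[ℂ] ℂ
  κ_conj : ∀ g s y x, κ (g * s * g⁻¹) (ρ' g y) (ρ g x) = κ s y x
  κ_left : ∀ g y x x', κ g y x • (x' - ρ g x') = κ g y x' • (x - ρ g x)
  κ_right : ∀ g y y' x, κ g y x • (y' - ρ' g y') = κ g y' x • (y - ρ' g y)

namespace HeckeDatum

variable {W U U' : Type*} [Group W] [AddCommGroup U] [Module ℂ U]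
  [AddCommGroup U'] [Module ℂ U'] (D : HeckeDatum W U U')

local notation "SU" => SymmetricAlgebra ℂ U
local notation "SU'" => SymmetricAlgebra ℂ U'
local notation "ιU" => SymmetricAlgebra.ι ℂ U
local notation "ιU'" => SymmetricAlgebra.ι ℂ U'

/-- The space `S(U') ⊗ ℂ[W]`. -/
abbrev Fiber (_ : HeckeDatum W U U') := SymmetricAlgebra ℂ U' ⊗[ℂ] MonoidAlgebra ℂ W

/-- The space `S(U) ⊗ S(U') ⊗ ℂ[W]`. -/
abbrev Model := SymmetricAlgebra ℂ U ⊗[ℂ] D.Fiber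

/-- The action of `W` on `S(U') ⊗ ℂ[W]`. -/
noncomputable def fiberGrp (g : W) : Module.End ℂ D.Fiber :=
  TensorProduct.map (symRep D.ρ' g).toLinearMap
    (LinearMap.mulLeft ℂ (MonoidAlgebra.of ℂ W g))

/-- The action of `W` on `S(U) ⊗ S(U') ⊗ ℂ[W]`. -/
noncomputable def grpOp : W →* Module.End ℂ D.Model where
  toFun g := TensorProduct.map (symRep D.ρ g).toLinearMap (D.fiberGrp g)
  map_one' := by
    refine TensorProduct.ext' fun f p => ?_
    induction p using TensorProduct.induction_on with
    | zero => simp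
    | add p q hp hq => rw [TensorProduct.tmul_add, map_add, hp, hq, ← map_add]
    | tmul a b => simp [fiberGrp, ← MonoidAlgebra.one_def]
  map_mul' g g' := by
    refine TensorProduct.ext' fun f p => ?_
    induction p using TensorProduct.induction_on with
    | zero => simp
    | add p q hp hq => rw [TensorProduct.tmul_add, map_add, hp, hq, ← map_add]
    | tmul a b =>
      simp only [fiberGrp, Module.End.mul_apply, TensorProduct.map_tmul, map_mul,
        AlgHom.toLinearMap_apply, AlgHom.mul_apply, LinearMap.mulLeft_apply, mul_assoc]

theorem grpOp_tmul (g : W) (f : SU) (p : D.Fiber) :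
    D.grpOp g (f ⊗ₜ[ℂ] p) = symRep D.ρ g f ⊗ₜ[ℂ] D.fiberGrp g p := rfl

theorem fiberGrp_tmul (g : W) (f : SU') (z : MonoidAlgebra ℂ W) :
    D.fiberGrp g (f ⊗ₜ[ℂ] z) = symRep D.ρ' g f ⊗ₜ[ℂ] (MonoidAlgebra.of ℂ W g * z) := rfl

theorem fiberGrp_smul (g : W) (y : U') (p : D.Fiber) :
    D.fiberGrp g (ιU' y • p) = ιU' (D.ρ' g y) • D.fiberGrp g p := by
  induction p using TensorProduct.induction_on with
  | zero => simp
  | add p q hp hq => rw [smul_add, map_add, map_add, smul_add, hp, hq]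
  | tmul f z =>
    simp only [TensorProduct.smul_tmul', smul_eq_mul, fiberGrp_tmul, map_mul, symRep_ι]

theorem grpOp_smul (g : W) (x : U) (p : D.Model) :
    D.grpOp g (ιU x • p) = ιU (D.ρ g x) • D.grpOp g p := by
  induction p using TensorProduct.induction_on with
  | zero => simp
  | add p q hp hq => rw [smul_add, map_add, map_add, smul_add, hp, hq]
  | tmul f z =>
    simp only [TensorProduct.smul_tmul', smul_eq_mul, grpOp_tmul, map_mul, symRep_ι]

/-- The span of the monomials with fewer than `k` factors in `U'`. -/
noncomputable def filtration (k : ℕ) : Submodule ℂ D.Model :=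
  Submodule.span ℂ {p | ∃ (f : SU) (l : List U') (g : W), l.length < k ∧
    p = f ⊗ₜ[ℂ] ((l.map ιU').prod ⊗ₜ[ℂ] MonoidAlgebra.of ℂ W g)}

theorem filtration_mono {j k : ℕ} (h : j ≤ k) : D.filtration j ≤ D.filtration k := by
  refine Submodule.span_mono ?_
  rintro _ ⟨f, l, g, hl, rfl⟩
  exact ⟨f, l, g, hl.trans_le h, rfl⟩

theorem tmul_mem_filtration (f : SU) (l : List U') (g : W) {k : ℕ} (hl : l.length < k) :
    f ⊗ₜ[ℂ] ((l.map ιU').prod ⊗ₜ[ℂ] MonoidAlgebra.of ℂ W g) ∈ D.filtration k :=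
  Submodule.subset_span ⟨f, l, g, hl, rfl⟩

theorem smul_mem_filtration (f : SU) {k : ℕ} {p : D.Model} (hp : p ∈ D.filtration k) :
    f • p ∈ D.filtration k := by
  induction hp using Submodule.span_induction with
  | mem p hp =>
    obtain ⟨f', l, g, hl, rfl⟩ := hp
    rw [TensorProduct.smul_tmul']
    exact D.tmul_mem_filtration _ l g hl
  | zero => simp
  | add p q _ _ hp hq => rw [smul_add]; exact Submodule.add_mem _ hp hq
  | smul a p _ hp => rw [smul_comm]; exact Submodule.smul_mem _ _ hp

theorem grpOp_mem_filtration (g : W) {k : ℕ} {p : D.Model} (hp : p ∈ D.filtration k) :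
    D.grpOp g p ∈ D.filtration k := by
  induction hp using Submodule.span_induction with
  | mem p hp =>
    obtain ⟨f', l, g', hl, rfl⟩ := hp
    rw [grpOp_tmul, fiberGrp_tmul, ← map_mul, map_list_prod, List.map_map]
    have : (l.map (⇑(symRep D.ρ' g) ∘ ⇑ιU')) = (l.map (D.ρ' g)).map ιU' := by
      rw [List.map_map]
      exact List.map_congr_left fun y _ => symRep_ι _ _ _
    rw [this]
    exact D.tmul_mem_filtration _ _ _ (by simpa using hl)
  | zero => simp
  | add p q _ _ hp hq => rw [map_add]; exact Submodule.add_mem _ hp hq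
  | smul a p _ hp => rw [map_smul]; exact Submodule.smul_mem _ _ hp

variable [Fintype W]

/-- The operator by which the commutator `[y, x]` acts. -/
noncomputable def commOp (y : U') : U →ₗ[ℂ] Module.End ℂ D.Model where
  toFun x := ∑ g, D.κ g y x • D.grpOp g
  map_add' x x' := by simp only [map_add, add_smul, Finset.sum_add_distrib]
  map_smul' a x := by simp only [map_smul, smul_eq_mul, mul_smul, Finset.smul_sum,
    RingHom.id_apply]

theorem commOp_apply (y : U') (x : U) (p : D.Model) :
    D.commOp y x p = ∑ g, D.κ g y x • D.grpOp g p := by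
  simp [commOp]

/-- The Jacobi identity for `y, x, x'`, which holds separately for each group element by `κ_left`.
-/
theorem commOp_symm (y : U') (x x' : U) (p : D.Model) :
    D.commOp y x (ιU x' • p) + ιU x • D.commOp y x' p =
      D.commOp y x' (ιU x • p) + ιU x' • D.commOp y x p := by
  simp only [commOp_apply, Finset.smul_sum, ← Finset.sum_add_distrib]
  refine Finset.sum_congr rfl fun g _ => ?_
  have h0 := sub_eq_sub_iff_add_eq_add.mp
    ((smul_sub _ _ _).symm.trans ((D.κ_left g y x x').trans (smul_sub _ _ _)))
  have h := congrArg (fun z => ιU z • D.grpOp g p) h0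
  simp only [map_smul, map_add, add_smul, smul_assoc] at h
  simp only [grpOp_smul, smul_comm (ιU x) (D.κ g y x'), smul_comm (ιU x') (D.κ g y x)]
  rw [add_comm, ← h, add_comm]

/-- The action of `y` is forced: its commutators with `U` are those of the algebra, and on `1 ⊗
S(U') ⊗ ℂ[W]` it is multiplication. -/
theorem exists_vecOp (y : U') : ∃ T : Module.End ℂ D.Model,
    (∀ x p, T (ιU x • p) = D.commOp y x p + ιU x • T p) ∧
      ∀ p, T (1 ⊗ₜ[ℂ] p) = 1 ⊗ₜ[ℂ] (ιU' y • p) :=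
  exists_symExtension (D.commOp y) (D.commOp_symm y)
    (TensorProduct.mk ℂ SU D.Fiber 1 ∘ₗ
      (Algebra.lsmul ℂ ℂ D.Fiber (ιU' y) : D.Fiber →ₗ[ℂ] D.Fiber))

theorem commOp_add (y y' : U') (x : U) : D.commOp (y + y') x = D.commOp y x + D.commOp y' x := by
  simp [commOp, add_smul, Finset.sum_add_distrib]

theorem commOp_smul (a : ℂ) (y : U') (x : U) : D.commOp (a • y) x = a • D.commOp y x := by
  simp [commOp, mul_smul, Finset.smul_sum]

/-- The action of `y ∈ U'` on `S(U) ⊗ S(U') ⊗ ℂ[W]`. -/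
noncomputable def vecOpFun (y : U') : Module.End ℂ D.Model := (D.exists_vecOp y).choose

theorem vecOpFun_smul (y : U') (x : U) (p : D.Model) :
    D.vecOpFun y (ιU x • p) = D.commOp y x p + ιU x • D.vecOpFun y p :=
  (D.exists_vecOp y).choose_spec.1 x p

theorem vecOpFun_one (y : U') (p : D.Fiber) :
    D.vecOpFun y (1 ⊗ₜ[ℂ] p) = 1 ⊗ₜ[ℂ] (ιU' y • p) :=
  (D.exists_vecOp y).choose_spec.2 p

/-- The action of `U'` on `S(U) ⊗ S(U') ⊗ ℂ[W]`. -/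
noncomputable def vecOp : U' →ₗ[ℂ] Module.End ℂ D.Model where
  toFun y := D.vecOpFun y
  map_add' y y' := by
    refine LinearMap.ext fun p => ?_
    -- The chosen operators depend linearly on `y`, since they are determined by data which do.
    induction p using sym_tensor_induction with
    | one p =>
      simp only [LinearMap.add_apply, vecOpFun_one, map_add, add_smul, TensorProduct.tmul_add]
    | smul x p hp =>
      rw [LinearMap.add_apply] at hp ⊢
      simp only [vecOpFun_smul, hp, commOp_add, smul_add, LinearMap.add_apply]
      abel
    | add p q hp hq => rw [map_add, hp, hq, map_add]
  map_smul' a y := by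
    refine LinearMap.ext fun p => ?_
    induction p using sym_tensor_induction with
    | one p =>
      simp only [LinearMap.smul_apply, vecOpFun_one, map_smul, smul_assoc,
        TensorProduct.tmul_smul, RingHom.id_apply]
    | smul x p hp =>
      rw [LinearMap.smul_apply] at hp ⊢
      simp only [vecOpFun_smul, hp, commOp_smul, smul_add, LinearMap.smul_apply,
        RingHom.id_apply, smul_comm (ιU x) a]
    | add p q hp hq => rw [map_add, hp, hq, map_add]

theorem vecOp_smul (y : U') (x : U) (p : D.Model) :
    D.vecOp y (ιU x • p) = D.commOp y x p + ιU x • D.vecOp y p :=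
  D.vecOpFun_smul y x p

theorem vecOp_one (y : U') (p : D.Fiber) :
    D.vecOp y (1 ⊗ₜ[ℂ] p) = 1 ⊗ₜ[ℂ] (ιU' y • p) :=
  D.vecOpFun_one y p

/-- Conjugation by `g` permutes the summands, and `κ_conj` matches their coefficients. -/
theorem grpOp_commOp (g : W) (y : U') (x : U) (p : D.Model) :
    D.grpOp g (D.commOp y x p) = D.commOp (D.ρ' g y) (D.ρ g x) (D.grpOp g p) := by
  rw [commOp_apply, commOp_apply, map_sum]
  refine Fintype.sum_equiv (MulAut.conj g).toEquiv
    (fun s => D.grpOp g (D.κ s y x • D.grpOp s p))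
    (fun s => D.κ s (D.ρ' g y) (D.ρ g x) • D.grpOp s (D.grpOp g p)) fun s => ?_
  have h : D.grpOp g (D.grpOp s p) = D.grpOp (g * s * g⁻¹) (D.grpOp g p) := by
    rw [← Module.End.mul_apply, ← map_mul, ← Module.End.mul_apply, ← map_mul,
      inv_mul_cancel_right]
  rw [map_smul, h, MulEquiv.toEquiv_eq_coe, MulEquiv.coe_toEquiv, MulAut.conj_apply, D.κ_conj]

theorem grpOp_vecOp (g : W) (y : U') (p : D.Model) :
    D.grpOp g (D.vecOp y p) = D.vecOp (D.ρ' g y) (D.grpOp g p) := by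
  induction p using sym_tensor_induction with
  | one p => simp only [vecOp_one, grpOp_tmul, map_one, fiberGrp_smul]
  | smul x p hp => simp only [vecOp_smul, map_add, grpOp_commOp, grpOp_smul, hp]
  | add p q hp hq => rw [map_add, map_add, hp, hq, map_add, map_add]

/-- On `1 ⊗ S(U') ⊗ ℂ[W]` the operators are multiplications. Moving past a factor `x` produces
commutator terms, which match by the other Jacobi identity, `κ_right`. -/
theorem vecOp_comm (y y' : U') (p : D.Model) :
    D.vecOp y (D.vecOp y' p) = D.vecOp y' (D.vecOp y p) := by
  induction p using sym_tensor_induction with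
  | one p => simp only [vecOp_one, smul_smul, mul_comm]
  | smul x p hp =>
    have key : D.vecOp y (D.commOp y' x p) + D.commOp y x (D.vecOp y' p) =
        D.vecOp y' (D.commOp y x p) + D.commOp y' x (D.vecOp y p) := by
      simp only [commOp_apply, map_sum, map_smul, grpOp_vecOp, ← Finset.sum_add_distrib]
      refine Finset.sum_congr rfl fun g _ => ?_
      have h := congrArg (fun z => D.vecOp z (D.grpOp g p)) (D.κ_right g y y' x)
      simp only [map_smul, map_sub, LinearMap.smul_apply, LinearMap.sub_apply, smul_sub] at h
      have := sub_eq_sub_iff_add_eq_add.mp h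
      rw [← this, add_comm]
    simp only [vecOp_smul, map_add, hp, ← add_assoc, key]
  | add p q hp hq => simp only [map_add, hp, hq]

theorem commOp_mem_filtration (y : U') (x : U) {k : ℕ} {p : D.Model}
    (hp : p ∈ D.filtration k) : D.commOp y x p ∈ D.filtration k := by
  rw [commOp_apply]
  exact Submodule.sum_mem _ fun g _ => Submodule.smul_mem _ _ (D.grpOp_mem_filtration g hp)

/-- Moving `y` to the right through factors from `U` only creates group elements, which preserve the
number of factors from `U'`; `y` itself adds one. -/
theorem vecOp_mem_filtration (y : U') {k : ℕ} {p : D.Model} (hp : p ∈ D.filtration k) :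
    D.vecOp y p ∈ D.filtration (k + 1) := by
  induction hp using Submodule.span_induction with
  | mem p hp =>
    obtain ⟨f, l, g, hl, rfl⟩ := hp
    have hf : f ∈ Submodule.span ℂ (Set.range fun l : List U => (l.map ιU).prod) := by
      rw [span_list_prod_ι]; trivial
    induction hf using Submodule.span_induction with
    | mem f hf =>
      obtain ⟨m, rfl⟩ := hf
      induction m with
      | nil =>
        simp only [List.map_nil, List.prod_nil]
        rw [vecOp_one, TensorProduct.smul_tmul', smul_eq_mul]
        exact D.tmul_mem_filtration _ (y :: l) _ (by simpa using hl)
      | cons x m ih =>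
        simp only [List.map_cons, List.prod_cons] at ih ⊢
        rw [← smul_eq_mul, ← TensorProduct.smul_tmul', vecOp_smul]
        exact Submodule.add_mem _ (D.commOp_mem_filtration _ _
          (D.tmul_mem_filtration _ _ _ (hl.trans (Nat.lt_succ_self _))))
          (D.smul_mem_filtration _ ih)
    | zero => simp
    | add p q _ _ hp hq => rw [TensorProduct.add_tmul, map_add]; exact Submodule.add_mem _ hp hq
    | smul a p _ hp =>
      rw [← TensorProduct.smul_tmul', map_smul]; exact Submodule.smul_mem _ _ hp
  | zero => simp
  | add p q _ _ hp hq => rw [map_add]; exact Submodule.add_mem _ hp hq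
  | smul a p _ hp => rw [map_smul]; exact Submodule.smul_mem _ _ hp

/-- An algebra generated by `U`, `U'` and `W` with the commutation relations of `D`, which acts on
`S(U) ⊗ S(U') ⊗ ℂ[W]`. -/
structure Realization (H : Type*) [Ring H] [Algebra ℂ H] where
  /-- the image of `U` -/
  X : U →ₗ[ℂ] H
  /-- the image of `U'` -/
  Y : U' →ₗ[ℂ] H
  /-- the image of `W` -/
  γ : W →* H
  X_comm : ∀ x x', X x * X x' = X x' * X x
  Y_comm : ∀ y y', Y y * Y y' = Y y' * Y y
  γ_X : ∀ g x, γ g * X x = X (D.ρ g x) * γ g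
  γ_Y : ∀ g y, γ g * Y y = Y (D.ρ' g y) * γ g
  Y_X : ∀ y x, Y y * X x = X x * Y y + ∑ g, D.κ g y x • γ g
  adjoin_eq : Algebra.adjoin ℂ (Set.range X ∪ Set.range Y ∪ Set.range γ) = ⊤
  /-- the action on `S(U) ⊗ S(U') ⊗ ℂ[W]` -/
  rep : H →ₐ[ℂ] Module.End ℂ D.Model
  rep_X : ∀ x p, rep (X x) p = ιU x • p
  rep_Y : ∀ y p, rep (Y y) p = D.vecOp y p
  rep_γ : ∀ g p, rep (γ g) p = D.grpOp g p
  /-- the grading in which `U` has weight `-1` and `U'` has weight `1` -/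
  scale : ℂˣ → H →ₐ[ℂ] H
  scale_X : ∀ z x, scale z (X x) = ((z⁻¹ : ℂˣ) : ℂ) • X x
  scale_Y : ∀ z y, scale z (Y y) = (z : ℂ) • Y y
  scale_γ : ∀ z g, scale z (γ g) = γ g

namespace Realization

variable {D} {H : Type*} [Ring H] [Algebra ℂ H] (R : D.Realization H)

/-- The map `S(U) → H`. -/
noncomputable def symX : SU →ₐ[ℂ] H := symLift R.X R.X_comm

/-- The map `S(U') → H`. -/
noncomputable def symY : SU' →ₐ[ℂ] H := symLift R.Y R.Y_comm

/-- The map `S(U') ⊗ ℂ[W] → H`, `g ⊗ w ↦ g w`. -/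
noncomputable def fiberMap : D.Fiber →ₗ[ℂ] H :=
  LinearMap.mul' ℂ H ∘ₗ TensorProduct.map R.symY.toLinearMap
    (MonoidAlgebra.lift ℂ H W R.γ).toLinearMap

/-- The map `S(U) ⊗ S(U') ⊗ ℂ[W] → H`, `f ⊗ g ⊗ w ↦ f g w`. -/
noncomputable def ordered : D.Model →ₗ[ℂ] H :=
  LinearMap.mul' ℂ H ∘ₗ TensorProduct.map R.symX.toLinearMap R.fiberMap

theorem fiberMap_tmul (f : SU') (z : MonoidAlgebra ℂ W) :
    R.fiberMap (f ⊗ₜ[ℂ] z) = R.symY f * MonoidAlgebra.lift ℂ H W R.γ z := rfl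

theorem ordered_tmul (f : SU) (p : D.Fiber) :
    R.ordered (f ⊗ₜ[ℂ] p) = R.symX f * R.fiberMap p := rfl

theorem fiberMap_smul (y : U') (p : D.Fiber) :
    R.fiberMap (ιU' y • p) = R.Y y * R.fiberMap p := by
  induction p using TensorProduct.induction_on with
  | zero => simp
  | add p q hp hq => rw [smul_add, map_add, map_add, mul_add, hp, hq]
  | tmul f z =>
    simp only [TensorProduct.smul_tmul', smul_eq_mul, fiberMap_tmul, map_mul, symY, symLift_ι,
      mul_assoc]

theorem ordered_smul (x : U) (p : D.Model) :
    R.ordered (ιU x • p) = R.X x * R.ordered p := by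
  induction p using TensorProduct.induction_on with
  | zero => simp
  | add p q hp hq => rw [smul_add, map_add, map_add, mul_add, hp, hq]
  | tmul f z =>
    simp only [TensorProduct.smul_tmul', smul_eq_mul, ordered_tmul, map_mul, symX, symLift_ι,
      mul_assoc]

theorem ordered_one (p : D.Fiber) : R.ordered (1 ⊗ₜ[ℂ] p) = R.fiberMap p := by
  rw [ordered_tmul, map_one, one_mul]

theorem fiberMap_fiberGrp (g : W) (p : D.Fiber) :
    R.fiberMap (D.fiberGrp g p) = R.γ g * R.fiberMap p := by
  induction p using sym_tensor_induction with
  | one z =>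
    simp only [fiberGrp_tmul, fiberMap_tmul, map_one, one_mul, map_mul, MonoidAlgebra.lift_of]
  | smul y p hp =>
    rw [fiberGrp_smul, fiberMap_smul, hp, fiberMap_smul, ← mul_assoc, ← mul_assoc, R.γ_Y]
  | add p q hp hq => rw [map_add, map_add, map_add, mul_add, hp, hq]

theorem ordered_grpOp (g : W) (p : D.Model) :
    R.ordered (D.grpOp g p) = R.γ g * R.ordered p := by
  induction p using sym_tensor_induction with
  | one z => rw [grpOp_tmul, map_one, ordered_one, ordered_one, fiberMap_fiberGrp]
  | smul y p hp =>
    rw [grpOp_smul, ordered_smul, hp, ordered_smul, ← mul_assoc, ← mul_assoc, R.γ_X]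
  | add p q hp hq => rw [map_add, map_add, map_add, mul_add, hp, hq]

theorem ordered_vecOp (y : U') (p : D.Model) :
    R.ordered (D.vecOp y p) = R.Y y * R.ordered p := by
  induction p using sym_tensor_induction with
  | one z => rw [vecOp_one, ordered_one, ordered_one, fiberMap_smul]
  | smul x p hp =>
    rw [vecOp_smul, map_add, ordered_smul, hp, ordered_smul, ← mul_assoc, ← mul_assoc, R.Y_X,
      commOp_apply, map_sum, add_mul, add_comm, Finset.sum_mul]
    simp only [map_smul, ordered_grpOp, smul_mul_assoc]
  | add p q hp hq => rw [map_add, map_add, map_add, mul_add, hp, hq]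

/-- The ordered product intertwines the action on the model with left multiplication; it suffices to
check generators. -/
theorem ordered_rep (a : H) (p : D.Model) : R.ordered (R.rep a p) = a * R.ordered p := by
  have ha : a ∈ Algebra.adjoin ℂ (Set.range R.X ∪ Set.range R.Y ∪ Set.range R.γ) := by
    rw [R.adjoin_eq]; trivial
  induction ha using Algebra.adjoin_induction generalizing p with
  | mem a ha =>
    rcases ha with (⟨x, rfl⟩ | ⟨y, rfl⟩) | ⟨g, rfl⟩
    · rw [R.rep_X, ordered_smul]
    · rw [R.rep_Y, ordered_vecOp]
    · rw [R.rep_γ, ordered_grpOp]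
  | algebraMap r =>
    rw [AlgHom.commutes, Module.algebraMap_end_apply, map_smul, ← Algebra.smul_def]
  | add a b _ _ ha hb => rw [map_add, LinearMap.add_apply, map_add, ha, hb, add_mul]
  | mul a b _ _ ha hb => rw [map_mul, Module.End.mul_apply, ha, hb, mul_assoc]

/-- The action of `H` on the vector `1`. -/
noncomputable def eval : H →ₗ[ℂ] D.Model where
  toFun a := R.rep a (1 ⊗ₜ[ℂ] (1 ⊗ₜ[ℂ] 1))
  map_add' a b := by simp
  map_smul' r a := by simp

theorem ordered_eval (a : H) : R.ordered (R.eval a) = a := by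
  change R.ordered (R.rep a _) = a
  rw [ordered_rep, ordered_one, fiberMap_tmul]
  simp

theorem eval_mul (a b : H) : R.eval (a * b) = R.rep a (R.eval b) := by
  change R.rep (a * b) _ = _
  rw [map_mul]
  rfl

theorem eval_γ (g : W) : R.eval (R.γ g) = 1 ⊗ₜ[ℂ] (1 ⊗ₜ[ℂ] MonoidAlgebra.of ℂ W g) := by
  change R.rep (R.γ g) _ = _
  rw [R.rep_γ, grpOp_tmul, fiberGrp_tmul, map_one, map_one, mul_one]

/-- This is the linear independence half of the theorem: an ordered monomial, applied to the vector
`1`, reproduces itself. -/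
theorem eval_ordered (p : D.Model) : R.eval (R.ordered p) = p := by
  induction p using sym_tensor_induction with
  | add p q hp hq => rw [map_add, map_add, hp, hq]
  | smul x p hp => rw [ordered_smul, eval_mul, hp, R.rep_X]
  | one p =>
    rw [ordered_one]
    induction p using sym_tensor_induction with
    | add p q hp hq => rw [map_add, map_add, hp, hq, TensorProduct.tmul_add]
    | smul y p hp => rw [fiberMap_smul, eval_mul, hp, R.rep_Y, vecOp_one]
    | one z =>
      induction z using MonoidAlgebra.induction_on with
      | of g => rw [fiberMap_tmul, map_one, one_mul, MonoidAlgebra.lift_of, eval_γ]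
      | add p q hp hq =>
        rw [TensorProduct.tmul_add, map_add, map_add, hp, hq, TensorProduct.tmul_add]
      | smul r p hp =>
        rw [TensorProduct.tmul_smul, map_smul, map_smul, hp, TensorProduct.tmul_smul]

/-- The Poincaré-Birkhoff-Witt isomorphism. -/
noncomputable def pbw : D.Model ≃ₗ[ℂ] H :=
  LinearEquiv.ofLinearMap R.ordered R.eval (LinearMap.ext R.ordered_eval)
    (LinearMap.ext R.eval_ordered)

theorem pbw_tmul (f : SU) (k : SU') (g : W) :
    R.pbw (f ⊗ₜ[ℂ] (k ⊗ₜ[ℂ] MonoidAlgebra.of ℂ W g)) = R.symX f * R.symY k * R.γ g := by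
  change R.ordered _ = _
  rw [ordered_tmul, fiberMap_tmul, MonoidAlgebra.lift_of, mul_assoc]

theorem rep_symX (f : SU) (p : D.Model) : R.rep (R.symX f) p = f • p := by
  induction f using SymmetricAlgebra.induction generalizing p with
  | algebraMap r => rw [AlgHom.commutes, AlgHom.commutes]; simp
  | ι x => rw [symX, symLift_ι, R.rep_X]
  | mul a b ha hb => rw [map_mul, map_mul, Module.End.mul_apply, ha, hb, mul_smul]
  | add a b ha hb => rw [map_add, map_add, LinearMap.add_apply, ha, hb, add_smul]

/-- Each commutation of some `y` past `x` replaces the pair by group elements, leaving at most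
`l.length - 1` factors from `U'`; `filtration l.length` is exactly the span of such terms. -/
theorem rep_symY_sub_mem (l : List U') (x : U) (g : W) :
    R.rep (R.symY (l.map ιU').prod) (ιU x ⊗ₜ[ℂ] (1 ⊗ₜ[ℂ] MonoidAlgebra.of ℂ W g)) -
      ιU x ⊗ₜ[ℂ] ((l.map ιU').prod ⊗ₜ[ℂ] MonoidAlgebra.of ℂ W g) ∈ D.filtration l.length := by
  induction l with
  | nil => simp
  | cons y l ih =>
    have h1 := D.vecOp_mem_filtration y ih
    rw [map_sub] at h1
    have hx : ∀ p : D.Fiber, ιU x ⊗ₜ[ℂ] p = ιU x • ((1 : SU) ⊗ₜ[ℂ] p) := fun p => by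
      rw [TensorProduct.smul_tmul', smul_eq_mul, mul_one]
    have h2 : D.vecOp y (ιU x ⊗ₜ[ℂ] ((l.map ιU').prod ⊗ₜ[ℂ] MonoidAlgebra.of ℂ W g)) =
        D.commOp y x (1 ⊗ₜ[ℂ] ((l.map ιU').prod ⊗ₜ[ℂ] MonoidAlgebra.of ℂ W g)) +
        ιU x ⊗ₜ[ℂ] (((y :: l).map ιU').prod ⊗ₜ[ℂ] MonoidAlgebra.of ℂ W g) := by
      rw [hx, vecOp_smul, vecOp_one, hx, List.map_cons, List.prod_cons, ← smul_eq_mul (ιU' y),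
        ← TensorProduct.smul_tmul' (ιU' y)]
    have h3 : D.commOp y x (1 ⊗ₜ[ℂ] ((l.map ιU').prod ⊗ₜ[ℂ] MonoidAlgebra.of ℂ W g)) ∈
        D.filtration (l.length + 1) :=
      D.commOp_mem_filtration _ _ (D.tmul_mem_filtration _ _ _ (Nat.lt_succ_self _))
    have h4 : ∀ p, R.rep (R.symY ((y :: l).map ιU').prod) p =
        D.vecOp y (R.rep (R.symY (l.map ιU').prod) p) := fun p => by
      rw [List.map_cons, List.prod_cons, map_mul, map_mul, Module.End.mul_apply, ← R.rep_Y, symY,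
        symLift_ι]
    rw [h4, List.length_cons]
    have h5 := Submodule.add_mem _ h1 h3
    rw [h2] at h5
    convert h5 using 1
    abel

/-- Moving `x` to the left through a monomial changes it by terms of lower degree in `U'`. -/
theorem eval_mul_sub_mem (f : SU) (l : List U') (x : U) (g : W) :
    R.eval (R.symX f * R.symY (l.map ιU').prod * R.X x * R.γ g -
      R.symX f * R.X x * R.symY (l.map ιU').prod * R.γ g) ∈ D.filtration l.length := by
  have h1 : R.eval (R.X x * R.γ g) = ιU x ⊗ₜ[ℂ] (1 ⊗ₜ[ℂ] MonoidAlgebra.of ℂ W g) := by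
    rw [eval_mul, eval_γ, R.rep_X, TensorProduct.smul_tmul', smul_eq_mul, mul_one]
  have h2 : R.eval (R.X x * R.symY (l.map ιU').prod * R.γ g) =
      ιU x ⊗ₜ[ℂ] ((l.map ιU').prod ⊗ₜ[ℂ] MonoidAlgebra.of ℂ W g) := by
    have := R.eval_ordered (ιU x ⊗ₜ[ℂ] ((l.map ιU').prod ⊗ₜ[ℂ] MonoidAlgebra.of ℂ W g))
    rwa [ordered_tmul, fiberMap_tmul, MonoidAlgebra.lift_of, symX, symLift_ι, ← mul_assoc] at this
  rw [mul_assoc (R.symX f), mul_assoc (R.symX f), mul_assoc (R.symX f), mul_assoc (R.symX f),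
    ← mul_sub, eval_mul, rep_symX, map_sub, h2, mul_assoc (R.symY _), eval_mul, h1]
  exact D.smul_mem_filtration _ (R.rep_symY_sub_mem l x g)

end Realization

end HeckeDatum

end PBW

/-! ### The Koszul complex on `S(U) ⊗ C` and its Laplacian. -/

section Koszul

theorem eq_zero_of_eq_neg {X : Type*} [AddCommGroup X] [Module ℂ X] {x : X} (h : x = -x) :
    x = 0 := by
  have h2 : (2 : ℂ) • x = 0 := by
    rw [two_smul]
    nth_rewrite 1 [h]
    exact neg_add_cancel x
  rw [← one_smul ℂ x, ← inv_mul_cancel₀ (two_ne_zero' ℂ), mul_smul, h2, smul_zero]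

/-- The grading of `S(U)` in which `U` has weight `-1`. -/
noncomputable def scaleSym {U : Type*} [AddCommGroup U] [Module ℂ U] (z : ℂˣ) :
    SymmetricAlgebra ℂ U →ₐ[ℂ] SymmetricAlgebra ℂ U :=
  SymmetricAlgebra.lift (((z⁻¹ : ℂˣ) : ℂ) • SymmetricAlgebra.ι ℂ U)

theorem scaleSym_ι {U : Type*} [AddCommGroup U] [Module ℂ U] (z : ℂˣ) (x : U) :
    scaleSym z (SymmetricAlgebra.ι ℂ U x) = ((z⁻¹ : ℂˣ) : ℂ) • SymmetricAlgebra.ι ℂ U x := by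
  simp [scaleSym]

/-- An algebra generated by totally isotropic subspaces `U` and `U'` in duality, with the Clifford
relations, together with even lifts of the elements of `W`. -/
structure CliffordDatum {W U U' : Type*} [Group W] [AddCommGroup U] [Module ℂ U]
    [AddCommGroup U'] [Module ℂ U'] (D : HeckeDatum W U U') (C : Type*) [Ring C]
    [Algebra ℂ C] where
  /-- the image of `U` -/
  X : U →ₗ[ℂ] C
  /-- the image of `U'` -/
  Y : U' →ₗ[ℂ] C
  /-- the pairing -/
  pair : U' →ₗ[ℂ] U →ₗ[ℂ] ℂ
  /-- the parity automorphism -/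
  ε : C →ₐ[ℂ] C
  /-- the grading in which `U` has weight `-1` and `U'` has weight `1` -/
  scale : ℂˣ → C →ₐ[ℂ] C
  /-- the dimension of `U` -/
  dim : ℕ
  /-- a basis of `U` -/
  ux : Fin dim → U
  /-- the dual basis of `U'` -/
  uy : Fin dim → U'
  /-- the lifts of the elements of `W` -/
  lift : W → Cˣ
  X_X : ∀ x x', X x * X x' = -(X x' * X x)
  Y_Y : ∀ y y', Y y * Y y' = -(Y y' * Y y)
  Y_X : ∀ y x, Y y * X x = (-2 * pair y x) • 1 - X x * Y y
  ε_X : ∀ x, ε (X x) = -X x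
  ε_Y : ∀ y, ε (Y y) = -Y y
  ε_ε : ∀ c, ε (ε c) = c
  scale_X : ∀ z x, scale z (X x) = ((z⁻¹ : ℂˣ) : ℂ) • X x
  scale_Y : ∀ z y, scale z (Y y) = (z : ℂ) • Y y
  scale_ε : ∀ z c, scale z (ε c) = ε (scale z c)
  adjoin_eq : Algebra.adjoin ℂ (Set.range X ∪ Set.range Y) = ⊤
  sum_pair : ∀ x, ∑ i, pair (uy i) x • ux i = x
  sum_tmul : ∀ g, ∑ i, D.ρ g (ux i) ⊗ₜ[ℂ] D.ρ' g (uy i) = ∑ i, ux i ⊗ₜ[ℂ] uy i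
  ε_lift : ∀ g, ε (lift g) = lift g
  scale_lift : ∀ z g, scale z (lift g) = lift g
  lift_Y : ∀ g y, (lift g : C) * Y y = Y (D.ρ' g y) * lift g

namespace CliffordDatum

variable {W U U' : Type*} [Group W] [AddCommGroup U] [Module ℂ U]
  [AddCommGroup U'] [Module ℂ U'] {D : HeckeDatum W U U'} {C : Type*} [Ring C] [Algebra ℂ C]
  (L : CliffordDatum D C)

local notation "SU" => SymmetricAlgebra ℂ U
local notation "SU'" => SymmetricAlgebra ℂ U'
local notation "ιU" => SymmetricAlgebra.ι ℂ U
local notation "ιU'" => SymmetricAlgebra.ι ℂ U'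

/-- The span of the monomials `x ⋯ x y ⋯ y`. -/
theorem span_monomials : Submodule.span ℂ (Set.range fun p : List U × List U' =>
    (p.1.map L.X).prod * (p.2.map L.Y).prod) = ⊤ := by
  set S := Submodule.span ℂ (Set.range fun p : List U × List U' =>
    (p.1.map L.X).prod * (p.2.map L.Y).prod) with hS
  have hmem : ∀ (l : List U) (m : List U'), (l.map L.X).prod * (m.map L.Y).prod ∈ S := fun l m =>
    Submodule.subset_span ⟨(l, m), rfl⟩
  have hX : ∀ x, ∀ s ∈ S, L.X x * s ∈ S := by
    intro x s hs
    induction hs using Submodule.span_induction with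
    | mem s hs =>
      obtain ⟨⟨l, m⟩, rfl⟩ := hs
      simpa [mul_assoc] using hmem (x :: l) m
    | zero => simp
    | add p q _ _ hp hq => rw [mul_add]; exact S.add_mem hp hq
    | smul a p _ hp => rw [mul_smul_comm]; exact S.smul_mem _ hp
  have hY : ∀ y, ∀ s ∈ S, L.Y y * s ∈ S := by
    intro y s hs
    induction hs using Submodule.span_induction with
    | mem s hs =>
      obtain ⟨⟨l, m⟩, rfl⟩ := hs
      dsimp only
      induction l with
      | nil => simpa using hmem [] (y :: m)
      | cons x l ih =>
        simp only [List.map_cons, List.prod_cons]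
        rw [mul_assoc (L.X x), ← mul_assoc, L.Y_X, sub_mul, smul_mul_assoc, one_mul,
          mul_assoc (L.X x)]
        exact S.sub_mem (S.smul_mem _ (hmem l m)) (hX _ _ ih)
    | zero => simp
    | add p q _ _ hp hq => rw [mul_add]; exact S.add_mem hp hq
    | smul a p _ hp => rw [mul_smul_comm]; exact S.smul_mem _ hp
  rw [eq_top_iff]
  rintro c -
  have hc : c ∈ Algebra.adjoin ℂ (Set.range L.X ∪ Set.range L.Y) := by
    rw [L.adjoin_eq]; trivial
  have key : ∀ s ∈ S, c * s ∈ S := by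
    induction hc using Algebra.adjoin_induction with
    | mem a ha =>
      rcases ha with ⟨x, rfl⟩ | ⟨y, rfl⟩
      · exact hX x
      · exact hY y
    | algebraMap r =>
      intro s hs
      rw [← Algebra.smul_def]
      exact S.smul_mem _ hs
    | add a b _ _ ha hb => intro s hs; rw [add_mul]; exact S.add_mem (ha s hs) (hb s hs)
    | mul a b _ _ ha hb => intro s hs; rw [mul_assoc]; exact ha _ (hb s hs)
  simpa using key 1 (by simpa using hmem [] [])

/-- The supercommutator with `y ∈ U'`. -/
noncomputable def ad (y : U') : Module.End ℂ C :=
  LinearMap.mulLeft ℂ (L.Y y) - LinearMap.mulRight ℂ (L.Y y) ∘ₗ L.ε.toLinearMap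

theorem ad_apply (y : U') (c : C) : L.ad y c = L.Y y * c - L.ε c * L.Y y := rfl

theorem ad_one (y : U') : L.ad y 1 = 0 := by simp [ad_apply]

/-- Together with `ad_Y_mul` this shows that the supercommutator with `y` acts as `-2` times
contraction in the factors from `U` and ignores those from `U'`. -/
theorem ad_X_mul (y : U') (x : U) (c : C) :
    L.ad y (L.X x * c) = (-2 * L.pair y x) • c - L.X x * L.ad y c := by
  rw [ad_apply, ad_apply, map_mul, L.ε_X, ← mul_assoc, L.Y_X, sub_mul, smul_mul_assoc, one_mul,
    mul_sub]
  noncomm_ring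

theorem ad_Y_mul (y y' : U') (c : C) : L.ad y (L.Y y' * c) = -(L.Y y' * L.ad y c) := by
  rw [ad_apply, ad_apply, map_mul, L.ε_Y, ← mul_assoc, L.Y_Y]
  noncomm_ring

theorem ad_ad (y y' : U') (c : C) : L.ad y (L.ad y' c) = -L.ad y' (L.ad y c) := by
  have h : ∀ c, L.Y y * (L.Y y' * c) = -(L.Y y' * (L.Y y * c)) := fun c => by
    rw [← mul_assoc, L.Y_Y, neg_mul, mul_assoc]
  have h' : c * L.Y y' * L.Y y = -(c * L.Y y * L.Y y') := by
    rw [mul_assoc, L.Y_Y, mul_neg, mul_assoc]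
  rw [ad_apply, ad_apply, ad_apply, ad_apply, mul_sub, mul_sub]
  simp only [map_sub, map_mul, sub_mul, L.ε_Y, L.ε_ε, h, neg_mul, mul_neg, h',
    mul_assoc]
  abel

/-- The number of factors in `U`, up to the factor `-2`. -/
noncomputable def numX : Module.End ℂ C :=
  ∑ i, LinearMap.mulLeft ℂ (L.X (L.ux i)) ∘ₗ L.ad (L.uy i)

theorem numX_apply (c : C) : L.numX c = ∑ i, L.X (L.ux i) * L.ad (L.uy i) c := by
  simp [numX]

theorem numX_X_mul (x : U) (c : C) :
    L.numX (L.X x * c) = (-2 : ℂ) • (L.X x * c) + L.X x * L.numX c := by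
  have h : ∀ i, L.X (L.ux i) * L.ad (L.uy i) (L.X x * c) =
      (-2 : ℂ) • (L.X (L.pair (L.uy i) x • L.ux i) * c) +
        L.X x * (L.X (L.ux i) * L.ad (L.uy i) c) := by
    intro i
    rw [ad_X_mul, mul_sub, mul_smul_comm, map_smul, smul_mul_assoc, smul_smul, ← mul_assoc,
      L.X_X, neg_mul (L.X x * _), sub_neg_eq_add, mul_assoc]
  rw [numX_apply, numX_apply, Finset.sum_congr rfl fun i _ => h i, Finset.sum_add_distrib,
    ← Finset.smul_sum, ← Finset.sum_mul, ← map_sum, L.sum_pair, Finset.mul_sum]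

theorem ad_list_prod (y : U') (m : List U') : L.ad y (m.map L.Y).prod = 0 := by
  induction m with
  | nil => simp [ad_one]
  | cons y' m ih => simp [ad_Y_mul, ih]

/-- Each factor from `U` contributes `-2`, from the Clifford relation; factors from `U'`
supercommute with `U'` and contribute nothing. -/
theorem numX_monomial (l : List U) (m : List U') :
    L.numX ((l.map L.X).prod * (m.map L.Y).prod) =
      (-2 * l.length : ℂ) • ((l.map L.X).prod * (m.map L.Y).prod) := by
  induction l with
  | nil => simp [numX_apply, ad_list_prod]
  | cons x l ih =>
    simp only [List.map_cons, List.prod_cons, List.length_cons, Nat.cast_add, Nat.cast_one]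
    rw [mul_assoc, numX_X_mul, ih, mul_smul_comm, ← add_smul]
    congr 1
    ring

/-- The partial derivatives of `S(U)`. -/
noncomputable def deriv (i : Fin L.dim) : Module.End ℂ SU :=
  (exists_symDerivation (L.pair (L.uy i))).choose

theorem deriv_one (i : Fin L.dim) : L.deriv i 1 = 0 :=
  (exists_symDerivation (L.pair (L.uy i))).choose_spec.1

theorem deriv_ι_mul (i : Fin L.dim) (x : U) (f : SU) :
    L.deriv i (ιU x * f) = L.pair (L.uy i) x • f + ιU x * L.deriv i f :=
  (exists_symDerivation (L.pair (L.uy i))).choose_spec.2 x f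

theorem euler_list_prod (l : List U) :
    ∑ i, ιU (L.ux i) * L.deriv i (l.map ιU).prod = (l.length : ℂ) • (l.map ιU).prod := by
  induction l with
  | nil => simp [deriv_one]
  | cons x l ih =>
    have h : ∀ i, ιU (L.ux i) * L.deriv i (ιU x * (l.map ιU).prod) =
        ιU (L.pair (L.uy i) x • L.ux i) * (l.map ιU).prod +
          ιU x * (ιU (L.ux i) * L.deriv i (l.map ιU).prod) := by
      intro i
      rw [deriv_ι_mul, mul_add, mul_smul_comm, map_smul, smul_mul_assoc, mul_left_comm]
    simp only [List.map_cons, List.prod_cons, List.length_cons, Nat.cast_add, Nat.cast_one]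
    rw [Finset.sum_congr rfl fun i _ => h i, Finset.sum_add_distrib, ← Finset.sum_mul, ← map_sum,
      L.sum_pair, ← Finset.mul_sum, ih, mul_smul_comm, add_smul, one_smul, add_comm]

/-- The Koszul differential on `S(U) ⊗ C`. -/
noncomputable def koszul : Module.End ℂ (SU ⊗[ℂ] C) :=
  ∑ i, TensorProduct.map (LinearMap.mulLeft ℂ (ιU (L.ux i))) (L.ad (L.uy i))

/-- The Koszul homotopy on `S(U) ⊗ C`. -/
noncomputable def homotopy : Module.End ℂ (SU ⊗[ℂ] C) :=
  ∑ i, TensorProduct.map (L.deriv i) (LinearMap.mulLeft ℂ (L.X (L.ux i)))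

theorem koszul_tmul (f : SU) (c : C) :
    L.koszul (f ⊗ₜ[ℂ] c) = ∑ i, (ιU (L.ux i) * f) ⊗ₜ[ℂ] L.ad (L.uy i) c := by
  simp [koszul]

theorem homotopy_tmul (f : SU) (c : C) :
    L.homotopy (f ⊗ₜ[ℂ] c) = ∑ i, L.deriv i f ⊗ₜ[ℂ] (L.X (L.ux i) * c) := by
  simp [homotopy]

/-- The products `xᵢxⱼ` are symmetric in `i, j` and the operators `ad yᵢ ad yⱼ` antisymmetric, so
the square equals its own negative. -/
theorem koszul_koszul : L.koszul * L.koszul = 0 := by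
  refine TensorProduct.ext' fun f c => ?_
  rw [Module.End.mul_apply, koszul_tmul, map_sum, LinearMap.zero_apply]
  simp only [koszul_tmul]
  have h : ∑ i, ∑ j, (ιU (L.ux j) * (ιU (L.ux i) * f)) ⊗ₜ[ℂ] L.ad (L.uy j) (L.ad (L.uy i) c) =
      -∑ i, ∑ j, (ιU (L.ux j) * (ιU (L.ux i) * f)) ⊗ₜ[ℂ]
        L.ad (L.uy j) (L.ad (L.uy i) c) := by
    conv_lhs => rw [Finset.sum_comm]
    rw [← Finset.sum_neg_distrib]
    refine Finset.sum_congr rfl fun i _ => ?_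
    rw [← Finset.sum_neg_distrib]
    refine Finset.sum_congr rfl fun j _ => ?_
    rw [ad_ad, TensorProduct.tmul_neg, mul_left_comm]
  exact eq_zero_of_eq_neg h

/-- The Laplacian of the Koszul complex. -/
noncomputable def laplacian : Module.End ℂ (SU ⊗[ℂ] C) :=
  L.koszul * L.homotopy + L.homotopy * L.koszul

/-- The double sums `xᵢ ∂ⱼ f ⊗ xⱼ ad yᵢ c` occur in the two products with opposite signs. What
remains is `-2` times the Euler operator on `S(U)` plus `numX` on `C`. -/
theorem laplacian_tmul (f : SU) (c : C) :
    L.laplacian (f ⊗ₜ[ℂ] c) =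
      (-2 : ℂ) • ((∑ i, ιU (L.ux i) * L.deriv i f) ⊗ₜ[ℂ] c) + f ⊗ₜ[ℂ] L.numX c := by
  have h1 : (L.koszul * L.homotopy) (f ⊗ₜ[ℂ] c) =
      (-2 : ℂ) • ((∑ i, ιU (L.ux i) * L.deriv i f) ⊗ₜ[ℂ] c) -
      ∑ j, ∑ i, (ιU (L.ux i) * L.deriv j f) ⊗ₜ[ℂ] (L.X (L.ux j) * L.ad (L.uy i) c) := by
    rw [Module.End.mul_apply, homotopy_tmul, map_sum, TensorProduct.sum_tmul, Finset.smul_sum,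
      ← Finset.sum_sub_distrib]
    refine Finset.sum_congr rfl fun j _ => ?_
    rw [koszul_tmul]
    simp only [ad_X_mul, TensorProduct.tmul_sub, Finset.sum_sub_distrib]
    congr 1
    conv_rhs => rw [← L.sum_pair (L.ux j)]
    simp only [map_sum, map_smul, Finset.sum_mul, TensorProduct.sum_tmul, Finset.smul_sum]
    refine Finset.sum_congr rfl fun i _ => ?_
    rw [smul_mul_assoc, ← TensorProduct.smul_tmul', TensorProduct.tmul_smul, smul_smul]
  have h2 : (L.homotopy * L.koszul) (f ⊗ₜ[ℂ] c) = f ⊗ₜ[ℂ] L.numX c +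
      ∑ j, ∑ i, (ιU (L.ux i) * L.deriv j f) ⊗ₜ[ℂ] (L.X (L.ux j) * L.ad (L.uy i) c) := by
    rw [Module.End.mul_apply, koszul_tmul, map_sum, numX_apply, TensorProduct.tmul_sum,
      Finset.sum_comm, ← Finset.sum_add_distrib]
    refine Finset.sum_congr rfl fun i _ => ?_
    rw [homotopy_tmul]
    simp only [deriv_ι_mul, TensorProduct.add_tmul, Finset.sum_add_distrib]
    congr 1
    conv_rhs => rw [← L.sum_pair (L.ux i)]
    simp only [map_sum, map_smul, Finset.sum_mul, TensorProduct.tmul_sum]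
    refine Finset.sum_congr rfl fun j _ => ?_
    rw [smul_mul_assoc, TensorProduct.tmul_smul, ← TensorProduct.smul_tmul']
  rw [laplacian, LinearMap.add_apply, h1, h2]
  abel

theorem laplacian_monomial (l m : List U) (n : List U') :
    L.laplacian ((l.map ιU).prod ⊗ₜ[ℂ] ((m.map L.X).prod * (n.map L.Y).prod)) =
      (-2 * (l.length + m.length : ℕ) : ℂ) •
        ((l.map ιU).prod ⊗ₜ[ℂ] ((m.map L.X).prod * (n.map L.Y).prod)) := by
  rw [laplacian_tmul, euler_list_prod, numX_monomial, TensorProduct.tmul_smul,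
    ← TensorProduct.smul_tmul', smul_smul, ← add_smul]
  congr 1
  push_cast
  ring

theorem span_koszul_monomials :
    Submodule.span ℂ (Set.range fun p : List U × List U × List U' =>
      (p.1.map ιU).prod ⊗ₜ[ℂ] ((p.2.1.map L.X).prod * (p.2.2.map L.Y).prod)) = ⊤ := by
  rw [eq_top_iff, ← TensorProduct.span_tmul_eq_top, Submodule.span_le]
  rintro _ ⟨f, c, rfl⟩
  have hf : f ∈ Submodule.span ℂ (Set.range fun l : List U => (l.map ιU).prod) := by
    rw [span_list_prod_ι]; trivial
  have hc : c ∈ Submodule.span ℂ (Set.range fun p : List U × List U' =>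
      (p.1.map L.X).prod * (p.2.map L.Y).prod) := by
    rw [span_monomials]; trivial
  have := Submodule.apply_mem_map₂ (TensorProduct.mk ℂ SU C) hf hc
  rw [Submodule.map₂_span_span] at this
  refine Submodule.span_mono ?_ this
  rintro _ ⟨_, ⟨l, rfl⟩, _, ⟨p, rfl⟩, rfl⟩
  exact ⟨(l, p), rfl⟩

/-- The eigenvector monomials of `laplacian_monomial` span, so the Laplacian is diagonalizable and
has a pseudoinverse. -/
theorem iSup_eigenspace_laplacian : ⨆ μ, Module.End.eigenspace L.laplacian μ = ⊤ := by
  rw [eq_top_iff, ← L.span_koszul_monomials, Submodule.span_le]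
  rintro _ ⟨⟨l, m, n⟩, rfl⟩
  exact Submodule.mem_iSup_of_mem _ (Module.End.mem_eigenspace_iff.mpr (L.laplacian_monomial l m n))

/-- The grading of `S(U) ⊗ C`. -/
noncomputable def scaleKoszul (z : ℂˣ) : Module.End ℂ (SU ⊗[ℂ] C) :=
  TensorProduct.map (scaleSym z).toLinearMap (L.scale z).toLinearMap

/-- The parity automorphism of `H ⊗ C`. -/
noncomputable def parity (H : Type*) [Ring H] [Algebra ℂ H] : H ⊗[ℂ] C →ₐ[ℂ] H ⊗[ℂ] C :=
  Algebra.TensorProduct.map (AlgHom.id ℂ H) L.ε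

theorem parity_parity {H : Type*} [Ring H] [Algebra ℂ H] (a : H ⊗[ℂ] C) : L.parity H (L.parity H a) = a := by
  induction a using TensorProduct.induction_on with
  | zero => simp
  | add p q hp hq => rw [map_add, map_add, hp, hq]
  | tmul a c => simp [parity, L.ε_ε]

/-- The canonical element `∑ xᵢ ⊗ yᵢ` is `W`-invariant, hence so is its image under any bilinear
map. -/
theorem sum_invariant (g : W) {Z : Type*} [AddCommGroup Z] [Module ℂ Z]
    (φ : U →ₗ[ℂ] U' →ₗ[ℂ] Z) :
    ∑ i, φ (D.ρ g (L.ux i)) (D.ρ' g (L.uy i)) = ∑ i, φ (L.ux i) (L.uy i) := by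
  have := congrArg (TensorProduct.lift φ) (L.sum_tmul g)
  simpa using this

end CliffordDatum
end Koszul
-- Contraction of the Koszul complex; filtration and grading of the total space.
section Cohomology

namespace CliffordDatum

variable {W U U' : Type*} [Group W] [AddCommGroup U] [Module ℂ U]
  [AddCommGroup U'] [Module ℂ U'] {D : HeckeDatum W U U'} {C : Type*} [Ring C] [Algebra ℂ C]
  (L : CliffordDatum D C)

local notation "SU" => SymmetricAlgebra ℂ U
local notation "SU'" => SymmetricAlgebra ℂ U'
local notation "ιU" => SymmetricAlgebra.ι ℂ U
local notation "ιU'" => SymmetricAlgebra.ι ℂ U'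

theorem deriv_scaleSym (z : ℂˣ) (i : Fin L.dim) (f : SU) :
    L.deriv i (scaleSym z f) = ((z⁻¹ : ℂˣ) : ℂ) • scaleSym z (L.deriv i f) := by
  have hf : f ∈ Submodule.span ℂ (Set.range fun l : List U => (l.map ιU).prod) := by
    rw [span_list_prod_ι]; trivial
  induction hf using Submodule.span_induction with
  | mem f hf =>
    obtain ⟨l, rfl⟩ := hf
    dsimp only
    induction l with
    | nil => simp [deriv_one]
    | cons x l ih =>
      rw [List.map_cons, List.prod_cons, map_mul, scaleSym_ι, smul_mul_assoc, map_smul,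
        deriv_ι_mul, deriv_ι_mul, ih, map_add, map_smul, map_mul, scaleSym_ι, mul_smul_comm,
        smul_mul_assoc]
  | zero => simp
  | add p q _ _ hp hq => simp only [map_add, smul_add, hp, hq]
  | smul a p _ hp => simp only [map_smul, hp, smul_comm a]

theorem scale_ad (z : ℂˣ) (y : U') (c : C) :
    L.scale z (L.ad y c) = (z : ℂ) • L.ad y (L.scale z c) := by
  simp only [ad_apply, map_sub, map_mul, L.scale_Y, L.scale_ε, smul_sub, smul_mul_assoc,
    mul_smul_comm]

theorem scaleKoszul_commute_koszul (z : ℂˣ) : Commute (L.scaleKoszul z) L.koszul := by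
  refine TensorProduct.ext' fun f c => ?_
  simp only [Module.End.mul_apply, koszul_tmul, map_sum, scaleKoszul, TensorProduct.map_tmul,
    AlgHom.toLinearMap_apply, map_mul, scale_ad, scaleSym_ι, smul_mul_assoc,
    TensorProduct.tmul_smul, ← TensorProduct.smul_tmul', smul_smul, Units.mul_inv, one_smul]

theorem scaleKoszul_commute_homotopy (z : ℂˣ) : Commute (L.scaleKoszul z) L.homotopy := by
  refine TensorProduct.ext' fun f c => ?_
  simp only [Module.End.mul_apply, homotopy_tmul, map_sum, scaleKoszul, TensorProduct.map_tmul,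
    AlgHom.toLinearMap_apply, map_mul, L.scale_X, deriv_scaleSym, smul_mul_assoc,
    TensorProduct.tmul_smul, ← TensorProduct.smul_tmul']

/-- Hodge theory: with `R` the pseudoinverse of the Laplacian, take `k = homotopy * R`. The
differential commutes with the Laplacian and therefore with `R`, so the anticommutator of `koszul`
and `k` is the Laplacian times `R`, that is, `1 - π`. All these operators respect the grading. -/
theorem exists_koszul_contraction : ∃ k π : Module.End ℂ (SU ⊗[ℂ] C),
    (∀ x, L.koszul (k x) + k (L.koszul x) + π x = x) ∧ (∀ x, L.laplacian (π x) = 0) ∧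
    k (1 ⊗ₜ[ℂ] 1) = 0 ∧
    ∀ z, Commute (L.scaleKoszul z) k ∧ Commute (L.scaleKoszul z) π := by
  obtain ⟨R, π, h1, h2, h3, h4⟩ := exists_pseudoinverse L.laplacian L.iSup_eigenspace_laplacian
  have hd : Commute L.koszul L.laplacian := by
    change _ * _ = _ * _
    rw [laplacian, mul_add, add_mul, ← mul_assoc, koszul_koszul, mul_assoc L.homotopy,
      koszul_koszul, zero_mul, mul_zero, zero_add, add_zero, mul_assoc]
  have hs : ∀ z, Commute (L.scaleKoszul z) L.laplacian := fun z =>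
    ((L.scaleKoszul_commute_koszul z).mul_right (L.scaleKoszul_commute_homotopy z)).add_right
      ((L.scaleKoszul_commute_homotopy z).mul_right (L.scaleKoszul_commute_koszul z))
  refine ⟨L.homotopy * R, π, fun x => ?_, h2, ?_, fun z =>
    ⟨(L.scaleKoszul_commute_homotopy z).mul_right (h4 _ (hs z)).1, (h4 _ (hs z)).2⟩⟩
  · have h5 : R (L.koszul x) = L.koszul (R x) := LinearMap.congr_fun (h4 _ hd).1.eq.symm x
    rw [Module.End.mul_apply, Module.End.mul_apply, h5]
    exact h1 x
  · rw [Module.End.mul_apply, h3, map_zero]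
    have := L.laplacian_monomial [] [] []
    simpa using this

/-- The space `S(U) ⊗ C ⊗ S(U') ⊗ ℂ[W]`. -/
abbrev Total (_ : CliffordDatum D C) := (SU ⊗[ℂ] C) ⊗[ℂ] D.Fiber

theorem total_ext {Z : Type*} [AddCommGroup Z] [Module ℂ Z] {A B : L.Total →ₗ[ℂ] Z}
    (h : ∀ f c k g, A ((f ⊗ₜ[ℂ] c) ⊗ₜ[ℂ] (k ⊗ₜ[ℂ] MonoidAlgebra.of ℂ W g)) =
      B ((f ⊗ₜ[ℂ] c) ⊗ₜ[ℂ] (k ⊗ₜ[ℂ] MonoidAlgebra.of ℂ W g))) : A = B := by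
  refine TensorProduct.ext_fourfold' fun f c k z => ?_
  induction z using MonoidAlgebra.induction_on with
  | of g => exact h f c k g
  | add p q hp hq => simp only [TensorProduct.tmul_add, map_add, hp, hq]
  | smul a p hp => simp only [TensorProduct.tmul_smul, map_smul, hp]

theorem model_ext {Z : Type*} [AddCommGroup Z] [Module ℂ Z] {A B : D.Model ⊗[ℂ] C →ₗ[ℂ] Z}
    (h : ∀ f c k g, A ((f ⊗ₜ[ℂ] (k ⊗ₜ[ℂ] MonoidAlgebra.of ℂ W g)) ⊗ₜ[ℂ] c) =
      B ((f ⊗ₜ[ℂ] (k ⊗ₜ[ℂ] MonoidAlgebra.of ℂ W g)) ⊗ₜ[ℂ] c)) : A = B := by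
  refine TensorProduct.ext_threefold fun f p c => ?_
  induction p using TensorProduct.induction_on with
  | zero => simp
  | add p q hp hq => simp only [TensorProduct.tmul_add, TensorProduct.add_tmul, map_add, hp, hq]
  | tmul k z =>
    induction z using MonoidAlgebra.induction_on with
    | of g => exact h f c k g
    | add p q hp hq =>
      simp only [TensorProduct.tmul_add, TensorProduct.add_tmul, map_add, hp, hq]
    | smul a p hp =>
      simp only [TensorProduct.tmul_smul, ← TensorProduct.smul_tmul', map_smul, hp]

/-- The span of the tensors with fewer than `k` factors in `U'`. -/
noncomputable def filtration (k : ℕ) : Submodule ℂ L.Total :=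
  Submodule.span ℂ {q | ∃ (x : SU ⊗[ℂ] C) (l : List U') (g : W), l.length < k ∧
    q = x ⊗ₜ[ℂ] ((l.map ιU').prod ⊗ₜ[ℂ] MonoidAlgebra.of ℂ W g)}

theorem filtration_zero : L.filtration 0 = ⊥ := by
  simp [filtration]

theorem filtration_mono {j k : ℕ} (h : j ≤ k) : L.filtration j ≤ L.filtration k := by
  refine Submodule.span_mono ?_
  rintro _ ⟨f, l, g, hl, rfl⟩
  exact ⟨f, l, g, hl.trans_le h, rfl⟩

theorem tmul_mem_filtration (x : SU ⊗[ℂ] C) (l : List U') (g : W) {k : ℕ} (hl : l.length < k) :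
    x ⊗ₜ[ℂ] ((l.map ιU').prod ⊗ₜ[ℂ] MonoidAlgebra.of ℂ W g) ∈ L.filtration k :=
  Submodule.subset_span ⟨x, l, g, hl, rfl⟩

theorem rTensor_mem_filtration (T : Module.End ℂ (SU ⊗[ℂ] C)) {k : ℕ} {q : L.Total}
    (hq : q ∈ L.filtration k) : LinearMap.rTensor D.Fiber T q ∈ L.filtration k := by
  induction hq using Submodule.span_induction with
  | mem p hp =>
    obtain ⟨x, l, g, hl, rfl⟩ := hp
    exact L.tmul_mem_filtration _ l g hl
  | zero => simp
  | add p q _ _ hp hq => rw [map_add]; exact Submodule.add_mem _ hp hq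
  | smul a p _ hp => rw [map_smul]; exact Submodule.smul_mem _ _ hp

theorem exists_mem_filtration (q : L.Total) : ∃ k, q ∈ L.filtration k := by
  induction q using TensorProduct.induction_on with
  | zero => exact ⟨0, Submodule.zero_mem _⟩
  | add p q hp hq =>
    obtain ⟨j, hj⟩ := hp
    obtain ⟨k, hk⟩ := hq
    exact ⟨max j k, Submodule.add_mem _ (L.filtration_mono (le_max_left _ _) hj)
      (L.filtration_mono (le_max_right _ _) hk)⟩
  | tmul x p =>
    induction p using TensorProduct.induction_on with
    | zero => exact ⟨0, by simp⟩
    | add p q hp hq =>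
      obtain ⟨j, hj⟩ := hp
      obtain ⟨k, hk⟩ := hq
      rw [TensorProduct.tmul_add]
      exact ⟨max j k, Submodule.add_mem _ (L.filtration_mono (le_max_left _ _) hj)
        (L.filtration_mono (le_max_right _ _) hk)⟩
    | tmul f z =>
      induction z using MonoidAlgebra.induction_on with
      | add p q hp hq =>
        obtain ⟨j, hj⟩ := hp
        obtain ⟨k, hk⟩ := hq
        rw [TensorProduct.tmul_add, TensorProduct.tmul_add]
        exact ⟨max j k, Submodule.add_mem _ (L.filtration_mono (le_max_left _ _) hj)
          (L.filtration_mono (le_max_right _ _) hk)⟩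
      | smul a p hp =>
        obtain ⟨j, hj⟩ := hp
        rw [TensorProduct.tmul_smul, TensorProduct.tmul_smul]
        exact ⟨j, Submodule.smul_mem _ _ hj⟩
      | of g =>
        have hf : f ∈ Submodule.span ℂ (Set.range fun l : List U' => (l.map ιU').prod) := by
          rw [span_list_prod_ι]; trivial
        induction hf using Submodule.span_induction with
        | mem f hf =>
          obtain ⟨l, rfl⟩ := hf
          exact ⟨_, L.tmul_mem_filtration x l g (Nat.lt_succ_self _)⟩
        | zero => exact ⟨0, by simp⟩
        | add p q _ _ hp hq =>
          obtain ⟨j, hj⟩ := hp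
          obtain ⟨k, hk⟩ := hq
          rw [TensorProduct.add_tmul, TensorProduct.tmul_add]
          exact ⟨max j k, Submodule.add_mem _ (L.filtration_mono (le_max_left _ _) hj)
            (L.filtration_mono (le_max_right _ _) hk)⟩
        | smul a p _ hp =>
          obtain ⟨j, hj⟩ := hp
          rw [← TensorProduct.smul_tmul', TensorProduct.tmul_smul]
          exact ⟨j, Submodule.smul_mem _ _ hj⟩

/-- The grading of `S(U) ⊗ C ⊗ S(U') ⊗ ℂ[W]`. -/
noncomputable def scaleTotal (z : ℂˣ) : Module.End ℂ L.Total :=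
  TensorProduct.map (L.scaleKoszul z)
    (TensorProduct.map (scaleSym z⁻¹).toLinearMap LinearMap.id)

theorem scaleTotal_tmul (z : ℂˣ) (f : SU) (c : C) (k : SU') (y : MonoidAlgebra ℂ W) :
    L.scaleTotal z ((f ⊗ₜ[ℂ] c) ⊗ₜ[ℂ] (k ⊗ₜ[ℂ] y)) =
      (scaleSym z f ⊗ₜ[ℂ] L.scale z c) ⊗ₜ[ℂ] (scaleSym z⁻¹ k ⊗ₜ[ℂ] y) := rfl

theorem scaleTotal_commute {T : Module.End ℂ (SU ⊗[ℂ] C)} {z : ℂˣ}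
    (hT : Commute (L.scaleKoszul z) T) :
    Commute (L.scaleTotal z) (LinearMap.rTensor D.Fiber T) := by
  refine TensorProduct.ext' fun x p => ?_
  have := LinearMap.congr_fun hT.eq x
  simp only [Module.End.mul_apply] at this
  simp only [Module.End.mul_apply, scaleTotal, LinearMap.rTensor_tmul, TensorProduct.map_tmul,
    this]

/-- The monomials of `S(U) ⊗ C ⊗ S(U') ⊗ ℂ[W]`. -/
noncomputable def monomial (p : (List U × List U × List U') × List U' × W) : L.Total :=
  ((p.1.1.map ιU).prod ⊗ₜ[ℂ] ((p.1.2.1.map L.X).prod * (p.1.2.2.map L.Y).prod)) ⊗ₜ[ℂ]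
    ((p.2.1.map ιU').prod ⊗ₜ[ℂ] MonoidAlgebra.of ℂ W p.2.2)

theorem span_monomial : Submodule.span ℂ (Set.range L.monomial) = ⊤ := by
  have h1 : Submodule.span ℂ (Set.range fun p : List U' × W =>
      (p.1.map ιU').prod ⊗ₜ[ℂ] MonoidAlgebra.of ℂ W p.2) = ⊤ := by
    rw [eq_top_iff, ← TensorProduct.span_tmul_eq_top, Submodule.span_le]
    rintro _ ⟨f, c, rfl⟩
    have hf : f ∈ Submodule.span ℂ (Set.range fun l : List U' => (l.map ιU').prod) := by
      rw [span_list_prod_ι]; trivial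
    have hc : c ∈ Submodule.span ℂ (Set.range (MonoidAlgebra.of ℂ W)) := by
      induction c using MonoidAlgebra.induction_on with
      | of g => exact Submodule.subset_span ⟨g, rfl⟩
      | add p q hp hq => exact Submodule.add_mem _ hp hq
      | smul a p hp => exact Submodule.smul_mem _ _ hp
    have := Submodule.apply_mem_map₂ (TensorProduct.mk ℂ SU' (MonoidAlgebra ℂ W)) hf hc
    rw [Submodule.map₂_span_span] at this
    refine Submodule.span_mono ?_ this
    rintro _ ⟨_, ⟨l, rfl⟩, _, ⟨p, rfl⟩, rfl⟩
    exact ⟨(l, p), rfl⟩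
  rw [eq_top_iff, ← TensorProduct.span_tmul_eq_top, Submodule.span_le]
  rintro _ ⟨x, p, rfl⟩
  have hx := Submodule.mem_top (R := ℂ) (x := x)
  have hp := Submodule.mem_top (R := ℂ) (x := p)
  rw [← L.span_koszul_monomials] at hx
  rw [← h1] at hp
  have := Submodule.apply_mem_map₂ (TensorProduct.mk ℂ (SU ⊗[ℂ] C) D.Fiber) hx hp
  rw [Submodule.map₂_span_span] at this
  refine Submodule.span_mono ?_ this
  rintro _ ⟨_, ⟨l, rfl⟩, _, ⟨p, rfl⟩, rfl⟩
  exact ⟨(l, p), rfl⟩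

theorem scaleSym_list_prod {E : Type*} [AddCommGroup E] [Module ℂ E] (z : ℂˣ) (l : List E) :
    scaleSym z (l.map (SymmetricAlgebra.ι ℂ E)).prod =
      ((z⁻¹ : ℂˣ) : ℂ) ^ l.length • (l.map (SymmetricAlgebra.ι ℂ E)).prod := by
  induction l with
  | nil => simp
  | cons x l ih =>
    rw [List.map_cons, List.prod_cons, map_mul, ih, scaleSym_ι, smul_mul_smul_comm,
      List.length_cons, pow_succ']

theorem scale_list_prod_X (z : ℂˣ) (l : List U) : L.scale z (l.map L.X).prod =
    ((z⁻¹ : ℂˣ) : ℂ) ^ l.length • (l.map L.X).prod := by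
  induction l with
  | nil => simp
  | cons x l ih =>
    rw [List.map_cons, List.prod_cons, map_mul, ih, L.scale_X, smul_mul_smul_comm,
      List.length_cons, pow_succ']

theorem scale_list_prod_Y (z : ℂˣ) (l : List U') : L.scale z (l.map L.Y).prod =
    (z : ℂ) ^ l.length • (l.map L.Y).prod := by
  induction l with
  | nil => simp
  | cons x l ih =>
    rw [List.map_cons, List.prod_cons, map_mul, ih, L.scale_Y, smul_mul_smul_comm,
      List.length_cons, pow_succ']

theorem scaleTotal_monomial (z : ℂˣ) (p : (List U × List U × List U') × List U' × W) :
    L.scaleTotal z (L.monomial p) =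
      (((z⁻¹ : ℂˣ) : ℂ) ^ (p.1.1.length + p.1.2.1.length) *
        (z : ℂ) ^ (p.1.2.2.length + p.2.1.length)) • L.monomial p := by
  rw [monomial, scaleTotal_tmul, scaleSym_list_prod, scaleSym_list_prod, map_mul,
    scale_list_prod_X, scale_list_prod_Y, inv_inv, smul_mul_smul_comm]
  simp only [TensorProduct.tmul_smul, ← TensorProduct.smul_tmul', smul_smul]
  congr 1
  ring

theorem laplacian_rTensor_monomial (p : (List U × List U × List U') × List U' × W) :
    LinearMap.rTensor D.Fiber L.laplacian (L.monomial p) =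
      (-2 * (p.1.1.length + p.1.2.1.length : ℕ) : ℂ) • L.monomial p := by
  rw [monomial, LinearMap.rTensor_tmul, laplacian_monomial, ← TensorProduct.smul_tmul']

/-- Vanishing of the Laplacian excludes all factors from `U`, the only ones of negative weight. The
factors from `U'`, in `C` and in `S(U')`, have positive weight, so in degree zero none of them is
left either. -/
theorem mem_span_of_scale_eq {q : L.Total}
    (h0 : LinearMap.rTensor D.Fiber L.laplacian q = 0) (hq : ∀ z, L.scaleTotal z q = q) :
    q ∈ Submodule.span ℂ (Set.range fun g : W =>
      ((1 : SU) ⊗ₜ[ℂ] (1 : C)) ⊗ₜ[ℂ] ((1 : SU') ⊗ₜ[ℂ] MonoidAlgebra.of ℂ W g)) := by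
  have h1 : q ∈ Submodule.span ℂ (L.monomial '' Set.univ) := by
    rw [Set.image_univ, span_monomial]; trivial
  have h2 := mem_span_of_apply_eq_smul _ L.monomial _ L.laplacian_rTensor_monomial
    (μ := 0) h1 (by rw [h0, zero_smul])
  -- The single scalar `z = 2` detects the weight, as `2 ^ n = 1` only for `n = 0`.
  have h3 := mem_span_of_apply_eq_smul _ L.monomial _ (L.scaleTotal_monomial (Units.mk0 2 two_ne_zero))
    (μ := 1) h2 (by rw [hq, one_smul])
  refine Submodule.span_mono ?_ h3
  rintro _ ⟨⟨⟨l, m, n⟩, k, g⟩, ⟨⟨-, ha⟩, hb⟩, rfl⟩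
  have h4 : l.length + m.length = 0 := by
    have : ((l.length + m.length : ℕ) : ℂ) = 0 := by
      simpa using ha
    exact_mod_cast this
  simp only [h4, pow_zero, one_mul, Units.val_mk0] at hb
  have h5 : n.length + k.length = 0 := by
    have h6 : (2 : ℕ) ^ (n.length + k.length) = 1 := by exact_mod_cast hb
    by_contra h7
    have := Nat.one_lt_two_pow h7
    omega
  have hl : l = [] := List.length_eq_zero_iff.mp (by omega)
  have hm : m = [] := List.length_eq_zero_iff.mp (by omega)
  have hn : n = [] := List.length_eq_zero_iff.mp (by omega)
  have hk : k = [] := List.length_eq_zero_iff.mp (by omega)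
  subst hl hm hn hk
  exact ⟨g, by simp [monomial]⟩

end CliffordDatum
end Cohomology
-- Cohomology of the supercommutator with the Dirac element.
section Cohomology

namespace CliffordDatum

variable {W U U' : Type*} [Group W] [Fintype W] [AddCommGroup U] [Module ℂ U]
  [AddCommGroup U'] [Module ℂ U'] {D : HeckeDatum W U U'} {C : Type*} [Ring C] [Algebra ℂ C]
  (L : CliffordDatum D C) {H : Type*} [Ring H] [Algebra ℂ H] (R : D.Realization H)

local notation "SU" => SymmetricAlgebra ℂ U
local notation "SU'" => SymmetricAlgebra ℂ U'
local notation "ιU" => SymmetricAlgebra.ι ℂ U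
local notation "ιU'" => SymmetricAlgebra.ι ℂ U'

/-- The map `f ⊗ k ⊗ g ⊗ c ↦ f ⊗ k ⊗ g ⊗ c a(g)`. -/
noncomputable def twistMap (D : HeckeDatum W U U') (a : W → C) :
    D.Model ⊗[ℂ] C →ₗ[ℂ] D.Model ⊗[ℂ] C :=
  ∑ g, TensorProduct.map
    (LinearMap.lTensor SU (LinearMap.lTensor SU'
      (((MonoidAlgebra.basis W ℂ).coord g).smulRight (MonoidAlgebra.of ℂ W g))))
    (LinearMap.mulRight ℂ (a g))

theorem twistMap_tmul (a : W → C) (f : SU) (k : SU') (g : W) (c : C) :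
    twistMap D a ((f ⊗ₜ[ℂ] (k ⊗ₜ[ℂ] MonoidAlgebra.of ℂ W g)) ⊗ₜ[ℂ] c) =
      (f ⊗ₜ[ℂ] (k ⊗ₜ[ℂ] MonoidAlgebra.of ℂ W g)) ⊗ₜ[ℂ] (c * a g) := by
  classical
  have h : ∀ g', (MonoidAlgebra.basis W ℂ).coord g' (MonoidAlgebra.of ℂ W g) =
      if g = g' then 1 else 0 := by
    intro g'
    have : MonoidAlgebra.of ℂ W g = MonoidAlgebra.basis W ℂ g := by simp
    rw [this, Module.Basis.coord_apply, Module.Basis.repr_self, Finsupp.single_apply]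
  simp only [twistMap, LinearMap.sum_apply, TensorProduct.map_tmul, LinearMap.lTensor_tmul,
    LinearMap.smulRight_apply, h, LinearMap.mulRight_apply]
  rw [Finset.sum_eq_single g]
  · simp
  · intro b _ hb
    simp [hb.symm]
  · simp

theorem twistMap_comp_twistMap (a b : W → C) (hab : ∀ g, a g * b g = 1) :
    twistMap D b ∘ₗ twistMap D a = LinearMap.id := by
  refine model_ext (D := D) (Z := D.Model ⊗[ℂ] C) (A := twistMap D b ∘ₗ twistMap D a)
    (B := LinearMap.id) fun f c k g => ?_
  rw [LinearMap.comp_apply, twistMap_tmul, twistMap_tmul, mul_assoc, hab, mul_one,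
    LinearMap.id_apply]

/-- The automorphism `f ⊗ k ⊗ g ⊗ c ↦ f ⊗ k ⊗ g ⊗ c a(g)`. -/
noncomputable def twistEquiv : (D.Model ⊗[ℂ] C) ≃ₗ[ℂ] (D.Model ⊗[ℂ] C) :=
  LinearEquiv.ofLinearMap (twistMap D fun g => (L.lift g : C))
    (twistMap D fun g => ((L.lift g)⁻¹ : Cˣ))
    (twistMap_comp_twistMap _ _ fun _ => Units.inv_mul _)
    (twistMap_comp_twistMap _ _ fun _ => Units.mul_inv _)

/-- The isomorphism `S(U) ⊗ C ⊗ S(U') ⊗ ℂ[W] ≃ H ⊗ C`. -/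
noncomputable def totalEquiv : L.Total ≃ₗ[ℂ] H ⊗[ℂ] C :=
  (TensorProduct.rightComm ℂ SU C D.Fiber).trans
    (L.twistEquiv.trans (TensorProduct.congr R.pbw (LinearEquiv.refl ℂ C)))

theorem totalEquiv_tmul (f : SU) (c : C) (k : SU') (g : W) :
    L.totalEquiv R ((f ⊗ₜ[ℂ] c) ⊗ₜ[ℂ] (k ⊗ₜ[ℂ] MonoidAlgebra.of ℂ W g)) =
      (R.symX f * R.symY k * R.γ g) ⊗ₜ[ℂ] (c * L.lift g) := by
  rw [totalEquiv, LinearEquiv.trans_apply, LinearEquiv.trans_apply,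
    TensorProduct.rightComm_tmul]
  change TensorProduct.congr R.pbw (LinearEquiv.refl ℂ C) (twistMap D _ _) = _
  rw [twistMap_tmul, TensorProduct.congr_tmul, R.pbw_tmul, LinearEquiv.refl_apply]

/-- The Dirac element `∑ xᵢ ⊗ yᵢ`. -/
noncomputable def dirac : H ⊗[ℂ] C := ∑ i, R.X (L.ux i) ⊗ₜ[ℂ] L.Y (L.uy i)

/-- The supercommutator with the Dirac element. -/
noncomputable def diff : Module.End ℂ (H ⊗[ℂ] C) :=
  LinearMap.mulLeft ℂ (L.dirac R) - LinearMap.mulRight ℂ (L.dirac R) ∘ₗ (L.parity H).toLinearMap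

/-- The grading of `H ⊗ C`. -/
noncomputable def scaleTensor (z : ℂˣ) : H ⊗[ℂ] C →ₐ[ℂ] H ⊗[ℂ] C :=
  Algebra.TensorProduct.map (R.scale z) (L.scale z)

/-- The part of `H ⊗ C` of degree zero. -/
noncomputable def degreeZero : Submodule ℂ (H ⊗[ℂ] C) :=
  ⨅ z, LinearMap.eqLocus (L.scaleTensor R z).toLinearMap LinearMap.id

theorem mem_degreeZero {a : H ⊗[ℂ] C} :
    a ∈ L.degreeZero R ↔ ∀ z, L.scaleTensor R z a = a := by
  simp [degreeZero, LinearMap.mem_eqLocus]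

/-- The span of the elements `g ⊗ a(g)`. -/
noncomputable def liftSpan : Submodule ℂ (H ⊗[ℂ] C) :=
  Submodule.span ℂ (Set.range fun g => R.γ g ⊗ₜ[ℂ] (L.lift g : C))

theorem diff_apply (a : H ⊗[ℂ] C) :
    L.diff R a = L.dirac R * a - L.parity H a * L.dirac R := rfl

/-- The `xᵢ` commute in `H` and the `yᵢ` anticommute in `C`, so the square equals its own negative.
-/
theorem dirac_mul_dirac : L.dirac R * L.dirac R = 0 := by
  have h : L.dirac R * L.dirac R = -(L.dirac R * L.dirac R) := by
    simp only [dirac, Finset.sum_mul_sum, Algebra.TensorProduct.tmul_mul_tmul]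
    conv_lhs => rw [Finset.sum_comm]
    rw [← Finset.sum_neg_distrib]
    refine Finset.sum_congr rfl fun i _ => ?_
    rw [← Finset.sum_neg_distrib]
    refine Finset.sum_congr rfl fun j _ => ?_
    rw [R.X_comm, L.Y_Y, TensorProduct.tmul_neg]
  exact eq_zero_of_eq_neg h

theorem parity_dirac : L.parity H (L.dirac R) = -L.dirac R := by
  simp [parity, dirac, L.ε_Y, TensorProduct.tmul_neg]

theorem diff_diff (a : H ⊗[ℂ] C) : L.diff R (L.diff R a) = 0 := by
  have h : ∀ x, L.dirac R * (L.dirac R * x) = 0 := fun x => by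
    rw [← mul_assoc, dirac_mul_dirac, zero_mul]
  rw [diff_apply, diff_apply, mul_sub, h, map_sub, sub_mul, map_mul, map_mul, parity_parity,
    parity_dirac, mul_neg, neg_mul, neg_mul, neg_mul, mul_assoc a, dirac_mul_dirac, mul_zero,
    mul_assoc]
  abel

theorem scaleTensor_dirac (z : ℂˣ) : L.scaleTensor R z (L.dirac R) = L.dirac R := by
  simp [scaleTensor, dirac, L.scale_Y, R.scale_X, smul_smul, ← TensorProduct.smul_tmul']

theorem scaleTensor_parity (z : ℂˣ) (a : H ⊗[ℂ] C) :
    L.scaleTensor R z (L.parity H a) = L.parity H (L.scaleTensor R z a) := by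
  induction a using TensorProduct.induction_on with
  | zero => simp
  | add p q hp hq => simp only [map_add, hp, hq]
  | tmul a c => simp [parity, scaleTensor, L.scale_ε]

theorem diff_mem_degreeZero {a : H ⊗[ℂ] C} (ha : a ∈ L.degreeZero R) :
    L.diff R a ∈ L.degreeZero R := by
  rw [mem_degreeZero] at ha ⊢
  intro z
  simp only [diff_apply, map_sub, map_mul, scaleTensor_dirac, scaleTensor_parity, ha z]

theorem liftSpan_le_degreeZero : L.liftSpan R ≤ L.degreeZero R := by
  refine Submodule.span_le.mpr ?_
  rintro _ ⟨g, rfl⟩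
  rw [SetLike.mem_coe, mem_degreeZero]
  intro z
  simp [scaleTensor, R.scale_γ, L.scale_lift]

/-- The lifts are even and conjugation by `g ⊗ a(g)` acts diagonally on the Dirac element, which is
built from dual bases and so is fixed. -/
theorem diff_eq_zero_of_mem_liftSpan {a : H ⊗[ℂ] C} (ha : a ∈ L.liftSpan R) :
    L.diff R a = 0 := by
  induction ha using Submodule.span_induction with
  | mem a ha =>
    obtain ⟨g, rfl⟩ := ha
    dsimp only
    have h1 := L.sum_invariant g ((TensorProduct.mk ℂ H C).compl₁₂
      (LinearMap.mulRight ℂ (R.γ g) ∘ₗ R.X) (LinearMap.mulRight ℂ (L.lift g : C) ∘ₗ L.Y))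
    simp only [LinearMap.compl₁₂_apply, LinearMap.comp_apply, LinearMap.mulRight_apply,
      TensorProduct.mk_apply] at h1
    rw [diff_apply, sub_eq_zero]
    simp only [parity, dirac, Algebra.TensorProduct.map_tmul, L.ε_lift, Finset.sum_mul,
      Finset.mul_sum, Algebra.TensorProduct.tmul_mul_tmul, AlgHom.id_apply, R.γ_X, L.lift_Y]
    exact h1.symm
  | zero => simp
  | add p q _ _ hp hq => rw [map_add, hp, hq, add_zero]
  | smul a p _ hp => rw [map_smul, hp, smul_zero]

/-- The filtration on `H ⊗ C` ignores the Clifford factor: the lift that `totalEquiv` multiplies in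
is a unit and can be cancelled beforehand. -/
theorem tmul_mem_map_filtration {a : H} {k : ℕ} (ha : R.eval a ∈ D.filtration k) (c : C) :
    a ⊗ₜ[ℂ] c ∈ (L.filtration k).map (L.totalEquiv R).toLinearMap := by
  suffices h : ∀ p ∈ D.filtration k, R.pbw p ⊗ₜ[ℂ] c ∈
      (L.filtration k).map (L.totalEquiv R).toLinearMap by
    have := h _ ha
    rwa [show R.pbw (R.eval a) = a from R.ordered_eval a] at this
  intro p hp
  induction hp using Submodule.span_induction with
  | mem p hp =>
    obtain ⟨f, l, g, hl, rfl⟩ := hp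
    refine ⟨_, L.tmul_mem_filtration (f ⊗ₜ[ℂ] (c * ((L.lift g)⁻¹ : Cˣ))) l g hl, ?_⟩
    rw [LinearEquiv.coe_coe, totalEquiv_tmul, R.pbw_tmul, Units.inv_mul_cancel_right]
  | zero => simp
  | add p q _ _ hp hq =>
    rw [map_add, TensorProduct.add_tmul]
    exact Submodule.add_mem _ hp hq
  | smul a p _ hp =>
    rw [map_smul, ← TensorProduct.smul_tmul']
    exact Submodule.smul_mem _ _ hp

/-- The differential agrees with the Koszul differential up to terms of lower degree. -/
theorem diff_sub_koszul_mem {k : ℕ} {q : L.Total} (hq : q ∈ L.filtration (k + 1)) :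
    L.diff R (L.totalEquiv R q) - L.totalEquiv R (LinearMap.rTensor D.Fiber L.koszul q) ∈
      (L.filtration k).map (L.totalEquiv R).toLinearMap := by
  induction hq using Submodule.span_induction with
  | mem q hq =>
    obtain ⟨x, l, g, hl, rfl⟩ := hq
    induction x using TensorProduct.induction_on with
    | zero => simp
    | add p q hp hq =>
      have := Submodule.add_mem _ hp hq
      rw [sub_add_sub_comm] at this
      simpa only [TensorProduct.add_tmul, map_add] using this
    | tmul f c =>
      -- Moving `g ⊗ a(g)` to the right of the Dirac element replaces the dual bases by their
      -- translates under `g`; invariance removes the translation.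
      have h1 := L.sum_invariant g ((TensorProduct.mk ℂ H C).compl₁₂
        (LinearMap.mulRight ℂ (R.γ g) ∘ₗ
          LinearMap.mulLeft ℂ (R.symX f * R.symY (l.map ιU').prod) ∘ₗ R.X)
        (LinearMap.mulRight ℂ (L.lift g : C) ∘ₗ LinearMap.mulLeft ℂ (L.ε c) ∘ₗ L.Y))
      simp only [LinearMap.compl₁₂_apply, LinearMap.comp_apply, LinearMap.mulRight_apply,
        LinearMap.mulLeft_apply, TensorProduct.mk_apply] at h1
      have h2 : L.parity H ((R.symX f * R.symY (l.map ιU').prod * R.γ g) ⊗ₜ[ℂ]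
          (c * L.lift g)) * L.dirac R =
          ∑ i, (R.symX f * R.symY (l.map ιU').prod * R.X (L.ux i) * R.γ g) ⊗ₜ[ℂ]
            (L.ε c * L.Y (L.uy i) * L.lift g) := by
        rw [← h1]
        simp only [parity, dirac, Algebra.TensorProduct.map_tmul, map_mul, L.ε_lift,
          Finset.mul_sum, Algebra.TensorProduct.tmul_mul_tmul, AlgHom.id_apply]
        refine Finset.sum_congr rfl fun i _ => ?_
        rw [mul_assoc _ (R.γ g), R.γ_X, mul_assoc _ (L.lift g : C), L.lift_Y, ← mul_assoc,
          ← mul_assoc]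
      have h3 : ∀ i, R.X (L.ux i) * R.symX f = R.symX f * R.X (L.ux i) := by
        intro i
        have : R.X (L.ux i) = R.symX (ιU (L.ux i)) := (symLift_ι _ _ _).symm
        rw [this, ← map_mul, ← map_mul, mul_comm]
      -- After `g ⊗ a(g)` has been moved, the only discrepancy with the Koszul differential is the
      -- commutator of `xᵢ` with the monomial in `U'`, which has lower degree by `eval_mul_sub_mem`.
      have h4 : L.diff R ((R.symX f * R.symY (l.map ιU').prod * R.γ g) ⊗ₜ[ℂ] (c * L.lift g)) -
          ∑ i, (R.symX (ιU (L.ux i) * f) * R.symY (l.map ιU').prod * R.γ g) ⊗ₜ[ℂ]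
            (L.ad (L.uy i) c * L.lift g) =
          ∑ i, (-(R.symX f * R.symY (l.map ιU').prod * R.X (L.ux i) * R.γ g -
            R.symX f * R.X (L.ux i) * R.symY (l.map ιU').prod * R.γ g)) ⊗ₜ[ℂ]
              (L.ε c * L.Y (L.uy i) * L.lift g) := by
        rw [diff_apply, h2, dirac, Finset.sum_mul, ← Finset.sum_sub_distrib,
          ← Finset.sum_sub_distrib]
        refine Finset.sum_congr rfl fun i _ => ?_
        have h5 : R.symX (ιU (L.ux i) * f) = R.symX f * R.X (L.ux i) := by
          rw [map_mul, ← h3]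
          congr 1
          exact symLift_ι _ _ _
        rw [h5, Algebra.TensorProduct.tmul_mul_tmul, ad_apply, sub_mul (L.Y _ * c),
          TensorProduct.tmul_sub, ← mul_assoc, ← mul_assoc, ← mul_assoc, h3, neg_sub,
          TensorProduct.sub_tmul]
        abel
      rw [totalEquiv_tmul, LinearMap.rTensor_tmul, koszul_tmul, TensorProduct.sum_tmul, map_sum]
      simp only [totalEquiv_tmul]
      rw [h4]
      refine Submodule.sum_mem _ fun i _ => L.tmul_mem_map_filtration R ?_ _
      rw [map_neg]
      exact Submodule.neg_mem _ (D.filtration_mono (Nat.lt_succ_iff.mp hl)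
        (R.eval_mul_sub_mem f l (L.ux i) g))
  | zero => simp
  | add p q _ _ hp hq =>
    have := Submodule.add_mem _ hp hq
    rw [sub_add_sub_comm] at this
    simpa only [map_add] using this
  | smul a p _ hp =>
    have := Submodule.smul_mem _ a hp
    simpa only [map_smul, smul_sub] using this

theorem scaleTensor_totalEquiv (z : ℂˣ) (q : L.Total) :
    L.scaleTensor R z (L.totalEquiv R q) = L.totalEquiv R (L.scaleTotal z q) := by
  have hX : ∀ f, R.scale z (R.symX f) = R.symX (scaleSym z f) := by
    intro f
    induction f using SymmetricAlgebra.induction with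
    | algebraMap r => simp
    | ι x => rw [scaleSym_ι, map_smul, HeckeDatum.Realization.symX, symLift_ι, R.scale_X]
    | mul a b ha hb => simp only [map_mul, ha, hb]
    | add a b ha hb => simp only [map_add, ha, hb]
  -- `scaleSym` gives its generators weight `-1`, whereas `U'` has weight `1`; hence the inverse.
  have hY : ∀ f, R.scale z (R.symY f) = R.symY (scaleSym z⁻¹ f) := by
    intro f
    induction f using SymmetricAlgebra.induction with
    | algebraMap r => simp
    | ι x => rw [scaleSym_ι, map_smul, HeckeDatum.Realization.symY, symLift_ι, R.scale_Y, inv_inv]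
    | mul a b ha hb => simp only [map_mul, ha, hb]
    | add a b ha hb => simp only [map_add, ha, hb]
  have : (L.scaleTensor R z).toLinearMap ∘ₗ (L.totalEquiv R).toLinearMap =
      (L.totalEquiv R).toLinearMap ∘ₗ L.scaleTotal z := by
    refine L.total_ext fun f c k g => ?_
    simp only [LinearMap.comp_apply, LinearEquiv.coe_coe, scaleTotal_tmul, totalEquiv_tmul,
      AlgHom.toLinearMap_apply, scaleTensor, Algebra.TensorProduct.map_tmul, map_mul, hX, hY,
      R.scale_γ, L.scale_lift]
  exact LinearMap.congr_fun this q

/-- The supercommutator with the Dirac element has cohomology represented by `liftSpan`. -/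
theorem diff_cohomology :
    (∀ x ∈ L.degreeZero R, L.diff R x = 0 →
      ∃ y ∈ L.degreeZero R, ∃ z ∈ L.liftSpan R, x = L.diff R y + z) ∧
    ∀ x ∈ L.degreeZero R, L.diff R x ∈ L.liftSpan R → L.diff R x = 0 := by
  obtain ⟨k, π, h1, h2, h3, h4⟩ := L.exists_koszul_contraction
  let e := L.totalEquiv R
  -- Operators on the Koszul complex are extended by the identity on `S(U') ⊗ ℂ[W]` and transported
  -- to `H ⊗ C`.
  let conj : Module.End ℂ (SymmetricAlgebra ℂ U ⊗[ℂ] C) → Module.End ℂ (H ⊗[ℂ] C) := fun T =>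
    e.toLinearMap ∘ₗ LinearMap.rTensor D.Fiber T ∘ₗ e.symm.toLinearMap
  have hconj : ∀ T q, conj T (e q) = e (LinearMap.rTensor D.Fiber T q) := fun T q => by
    simp [conj]
  let F : ℕ → Submodule ℂ (H ⊗[ℂ] C) := fun j => (L.filtration j).map e.toLinearMap
  have hconjF : ∀ T j x, x ∈ F j → conj T x ∈ F j := by
    rintro T j _ ⟨q, hq, rfl⟩
    rw [LinearEquiv.coe_coe, hconj]
    exact ⟨_, L.rTensor_mem_filtration T hq, rfl⟩
  have hscale : ∀ T z x, Commute (L.scaleKoszul z) T → L.scaleTensor R z x = x →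
      L.scaleTensor R z (conj T x) = conj T x := by
    intro T z x hT hx
    obtain ⟨q, rfl⟩ := e.surjective x
    have hq : L.scaleTotal z q = q :=
      e.injective ((L.scaleTensor_totalEquiv R z q).symm.trans hx)
    rw [hconj, scaleTensor_totalEquiv, ← Module.End.mul_apply, (L.scaleTotal_commute hT).eq,
      Module.End.mul_apply, hq]
  -- The transported projection has harmonic values and preserves degree zero, so
  -- `mem_span_of_scale_eq` identifies its values.
  have hπ : ∀ x ∈ L.degreeZero R, conj π x ∈ L.liftSpan R := by
    intro x hx
    have hx' := (L.mem_degreeZero R).mp hx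
    have hfix : ∀ z, L.scaleTensor R z (conj π x) = conj π x := fun z =>
      hscale π z x (h4 z).2 (hx' z)
    obtain ⟨q, rfl⟩ := e.surjective x
    rw [hconj] at hfix ⊢
    have hq := L.mem_span_of_scale_eq (q := LinearMap.rTensor D.Fiber π q)
      (by
        have : L.laplacian ∘ₗ π = 0 := LinearMap.ext h2
        rw [← LinearMap.comp_apply, ← LinearMap.rTensor_comp, this, LinearMap.rTensor_zero,
          LinearMap.zero_apply])
      (fun z => e.injective ((L.scaleTensor_totalEquiv R z _).symm.trans (hfix z)))
    have := Submodule.mem_map_of_mem (f := e.toLinearMap) hq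
    rw [Submodule.map_span, ← Set.range_comp] at this
    refine Submodule.span_mono ?_ this
    rintro _ ⟨g, rfl⟩
    exact ⟨g, (by simp only [map_one, one_mul] :
      R.γ g ⊗ₜ[ℂ] (L.lift g : C) = (R.symX 1 * R.symY 1 * R.γ g) ⊗ₜ[ℂ] (1 * (L.lift g : C))).trans
      (L.totalEquiv_tmul R 1 1 1 g).symm⟩
  have hA : ∀ x ∈ L.degreeZero R, L.diff R x ∈ L.degreeZero R ∧ conj k x ∈ L.degreeZero R ∧
      conj π x ∈ L.liftSpan R := fun x hx =>
    ⟨L.diff_mem_degreeZero R hx, (L.mem_degreeZero R).mpr fun z =>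
      hscale k z x (h4 z).1 ((L.mem_degreeZero R).mp hx z), hπ x hx⟩
  have hF0 : F 0 = ⊥ := by simp only [F, filtration_zero, Submodule.map_bot]
  -- The homotopy identity is exact for the Koszul differential. Replacing that differential by
  -- `diff` in the two products introduces two errors, and both lie one filtration step lower
  -- because `k` preserves the filtration.
  have hF : ∀ j, ∀ x ∈ F (j + 1),
      L.diff R (conj k x) + conj k (L.diff R x) + conj π x - x ∈ F j := by
    rintro j _ ⟨q, hq, rfl⟩
    rw [LinearEquiv.coe_coe]
    have e1 := L.diff_sub_koszul_mem R (L.rTensor_mem_filtration k hq)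
    have e2 := hconjF k j _ (L.diff_sub_koszul_mem R hq)
    rw [map_sub, hconj] at e2
    have e3 : LinearMap.rTensor D.Fiber L.koszul (LinearMap.rTensor D.Fiber k q) +
        LinearMap.rTensor D.Fiber k (LinearMap.rTensor D.Fiber L.koszul q) +
        LinearMap.rTensor D.Fiber π q = q := by
      rw [← LinearMap.comp_apply, ← LinearMap.comp_apply, ← LinearMap.rTensor_comp,
        ← LinearMap.rTensor_comp, ← LinearMap.add_apply, ← LinearMap.add_apply,
        ← LinearMap.rTensor_add, ← LinearMap.rTensor_add]
      have : L.koszul ∘ₗ k + k ∘ₗ L.koszul + π = LinearMap.id := LinearMap.ext h1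
      rw [this, LinearMap.rTensor_id, LinearMap.id_apply]
    have e4 := congrArg e e3
    rw [map_add, map_add] at e4
    rw [hconj, hconj]
    have := Submodule.add_mem _ e1 e2
    have e5 : ∀ a b a' b' p x : H ⊗[ℂ] C, a + b + p = x →
        a' + b' + p - x = (a' - a) + (b' - b) := by
      rintro a b a' b' p x rfl
      abel
    rwa [← e5 _ _ _ _ _ _ e4] at this
  have hκZ : ∀ x ∈ L.liftSpan R, conj k x = 0 := by
    intro x hx
    induction hx using Submodule.span_induction with
    | mem x hx =>
      obtain ⟨g, rfl⟩ := hx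
      have : R.γ g ⊗ₜ[ℂ] (L.lift g : C) = e (((1 : SymmetricAlgebra ℂ U) ⊗ₜ[ℂ] (1 : C)) ⊗ₜ[ℂ]
          ((1 : SymmetricAlgebra ℂ U') ⊗ₜ[ℂ] MonoidAlgebra.of ℂ W g)) := by
        refine Eq.trans ?_ (L.totalEquiv_tmul R 1 1 1 g).symm
        simp only [map_one, one_mul]
      dsimp only
      rw [this, hconj, LinearMap.rTensor_tmul, h3, TensorProduct.zero_tmul, map_zero]
    | zero => simp
    | add p q _ _ hp hq => rw [map_add, hp, hq, add_zero]
    | smul a p _ hp => rw [map_smul, hp, smul_zero]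
  have hex : ∀ x, ∃ j, x ∈ F j := by
    intro x
    obtain ⟨q, rfl⟩ := e.surjective x
    obtain ⟨j, hj⟩ := L.exists_mem_filtration q
    exact ⟨j, _, hj, rfl⟩
  refine ⟨fun x hx hx0 => ?_, fun x hx hxZ => ?_⟩
  · obtain ⟨j, hj⟩ := hex x
    exact exists_eq_add_of_filtered_homotopy F (L.diff R) (conj k) (conj π) hA
      (L.liftSpan_le_degreeZero R) (L.diff_diff R)
      (fun z hz => L.diff_eq_zero_of_mem_liftSpan R hz) hF0 hF x hx hj hx0
  · obtain ⟨j, hj⟩ := hex x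
    exact eq_zero_of_filtered_homotopy F (L.diff R) (conj k) (conj π) hA
      (L.liftSpan_le_degreeZero R) (L.diff_diff R)
      (fun z hz => L.diff_eq_zero_of_mem_liftSpan R hz) hκZ hF0 hF x hx hj hxZ

end CliffordDatum
end Cohomology
-- Lifting elements of the reflection group to the Pin group.
section Lifts

variable {h : Type u} [AddCommGroup h] [Module ℂ h]

local notation "ιQ" => CliffordAlgebra.ι (Q h)

/-- Since `1 - s` has rank one it is `y ↦ α y • v`. Finite order rules out the transvection case `α
v = 0`, and injectivity rules out `α v = 1`. -/
theorem IsPseudoReflection.exists_root [FiniteDimensional ℂ h] {s : h ≃ₗ[ℂ] h}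
    (hs : IsPseudoReflection s) (hfin : IsOfFinOrder s) :
    ∃ (α : Module.Dual ℂ h) (v : h), (∀ y, s y = y - α y • v) ∧ α v ≠ 0 ∧ α v ≠ 1 ∧
      LinearMap.det s.toLinearMap = 1 - α v := by
  set r : h →ₗ[ℂ] h := s.toLinearMap - LinearMap.id with hr
  let e : LinearMap.range r ≃ₗ[ℂ] ℂ :=
    LinearEquiv.ofFinrankEq _ _ (hs.trans (Module.finrank_self ℂ).symm)
  let α : Module.Dual ℂ h := -(e.toLinearMap ∘ₗ r.rangeRestrict)
  let v : h := e.symm 1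
  have hsv : ∀ y, s y = y - α y • v := by
    intro y
    have h1 : e (r.rangeRestrict y) • e.symm 1 = r.rangeRestrict y := by
      rw [← map_smul, smul_eq_mul, mul_one, e.symm_apply_apply]
    have h2 : e (r.rangeRestrict y) • v = r y := congrArg Subtype.val h1
    have h3 : α y • v = -r y := by
      rw [← h2, ← neg_smul]
      rfl
    rw [h3, hr]
    simp
  have hne : s ≠ 1 := by
    rintro rfl
    have h0 : r = 0 := by
      rw [hr]
      ext y
      simp
    have : Module.finrank ℂ (LinearMap.range r) = 1 := hs
    rw [h0, LinearMap.range_zero, finrank_bot] at this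
    exact zero_ne_one this
  refine ⟨α, v, hsv, fun h0 => ?_, fun h1 => ?_, ?_⟩
  · obtain ⟨n, hn, hpow⟩ := isOfFinOrder_iff_pow_eq_one.mp hfin
    -- If `α v = 0`, the powers of `s` drift linearly, so finite order forces `α = 0` or `v = 0`,
    -- that is, `s = 1`.
    have key : ∀ m : ℕ, ∀ y, (s ^ m) y = y - (m : ℂ) • α y • v := by
      intro m
      induction m with
      | zero => intro y; simp
      | succ m ih =>
        intro y
        rw [pow_succ', LinearEquiv.mul_apply, ih, hsv, map_sub, map_smul, map_smul, h0,
          smul_zero, smul_zero, sub_zero]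
        push_cast
        rw [add_smul, one_smul]
        abel
    refine hne (LinearEquiv.ext fun y => ?_)
    have h2 := key n y
    rw [hpow, LinearEquiv.coe_one, id, eq_comm, sub_eq_self, smul_eq_zero,
      or_iff_right (Nat.cast_ne_zero.mpr hn.ne')] at h2
    rw [hsv, h2, sub_zero]
    rfl
  · have h2 : v = 0 := by
      apply s.injective
      rw [hsv, h1, one_smul, sub_self, map_zero]
    rw [h2, map_zero] at h1
    exact zero_ne_one h1
  · have h2 : s.toLinearMap = LinearMap.transvection (-α) v := by
      ext y
      simp [LinearMap.transvection, hsv, sub_eq_add_neg]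
    rw [h2, LinearMap.transvection.det, LinearMap.neg_apply, sub_eq_add_neg]

/-- `a` is a lift of `g` to the even part of the Pin group, fixed by the grading, which acts on the
spinor module by `χ` times the natural action of `g`. -/
structure IsLift (g : h ≃ₗ[ℂ] h) (a : Cl h) (χ : ℂ) : Prop where
  even : a ∈ CliffordAlgebra.even (Q h)
  star_mul_self : star a * a = 1
  mul_star_self : a * star a = 1
  mul_ι : ∀ v, a * ιQ v = ιQ (actV g v) * a
  scale : ∀ z, scaleCl z a = a
  spinor_apply : ∀ z, spinor a z = χ • ExteriorAlgebra.map g.toLinearMap z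
  sq : χ ^ 2 * LinearMap.det g.toLinearMap = 1

theorem IsLift.one : IsLift (1 : h ≃ₗ[ℂ] h) 1 1 where
  even := Subalgebra.one_mem _
  star_mul_self := by simp
  mul_star_self := by simp
  mul_ι v := by simp [actV_one]
  scale z := map_one _
  spinor_apply z := by
    simp
  sq := by
    simp

theorem exteriorMap_mul (g g' : h ≃ₗ[ℂ] h) (z : ExteriorAlgebra ℂ h) :
    ExteriorAlgebra.map (g * g').toLinearMap z =
      ExteriorAlgebra.map g.toLinearMap (ExteriorAlgebra.map g'.toLinearMap z) := by
  have : ExteriorAlgebra.map (g * g').toLinearMap =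
      (ExteriorAlgebra.map g.toLinearMap).comp (ExteriorAlgebra.map g'.toLinearMap) := by
    ext y
    simp
  rw [this, AlgHom.comp_apply]

theorem exteriorMap_one (z : ExteriorAlgebra ℂ h) :
    ExteriorAlgebra.map (1 : h ≃ₗ[ℂ] h).toLinearMap z = z := by
  have : ExteriorAlgebra.map (1 : h ≃ₗ[ℂ] h).toLinearMap = AlgHom.id ℂ _ :=
    ExteriorAlgebra.map_id
  rw [this, AlgHom.id_apply]

theorem IsLift.mul {g g' : h ≃ₗ[ℂ] h} {a a' : Cl h} {χ χ' : ℂ} (ha : IsLift g a χ)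
    (ha' : IsLift g' a' χ') : IsLift (g * g') (a * a') (χ * χ') where
  even := Subalgebra.mul_mem _ ha.even ha'.even
  star_mul_self := by
    rw [star_mul, mul_assoc, ← mul_assoc (star a), ha.star_mul_self, one_mul, ha'.star_mul_self]
  mul_star_self := by
    rw [star_mul, mul_assoc, ← mul_assoc a', ha'.mul_star_self, one_mul, ha.mul_star_self]
  mul_ι v := by rw [actV_mul, mul_assoc, ha'.mul_ι, ← mul_assoc, ha.mul_ι, mul_assoc]
  scale z := by rw [map_mul, ha.scale, ha'.scale]
  spinor_apply z := by
    rw [map_mul, Module.End.mul_apply, ha'.spinor_apply, ha.spinor_apply, exteriorMap_mul, map_smul,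
      smul_smul]
  sq := by
    have : (g * g').toLinearMap = g.toLinearMap * g'.toLinearMap := rfl
    rw [this, map_mul, mul_pow, mul_mul_mul_comm, ha.sq, ha'.sq, one_mul]

theorem IsLift.neg {g : h ≃ₗ[ℂ] h} {a : Cl h} {χ : ℂ} (ha : IsLift g a χ) :
    IsLift g (-a) (-χ) where
  even := Subalgebra.neg_mem _ ha.even
  star_mul_self := by rw [star_neg, neg_mul_neg, ha.star_mul_self]
  mul_star_self := by rw [star_neg, neg_mul_neg, ha.mul_star_self]
  mul_ι v := by rw [neg_mul, ha.mul_ι, mul_neg]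
  scale z := by rw [map_neg, ha.scale]
  spinor_apply z := by rw [map_neg, LinearMap.neg_apply, ha.spinor_apply, neg_smul]
  sq := by rw [neg_sq, ha.sq]

theorem star_mem_even {a : Cl h} (ha : a ∈ CliffordAlgebra.even (Q h)) :
    star a ∈ CliffordAlgebra.even (Q h) := by
  rw [CliffordAlgebra.star_def]
  have h1 : a ∈ CliffordAlgebra.evenOdd (Q h) 0 := ha
  change _ ∈ CliffordAlgebra.evenOdd (Q h) 0
  rwa [CliffordAlgebra.reverse_mem_evenOdd_iff, CliffordAlgebra.involute_mem_evenOdd_iff]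

theorem IsLift.inv {g : h ≃ₗ[ℂ] h} {a : Cl h} {χ : ℂ} (ha : IsLift g a χ) :
    IsLift g⁻¹ (star a) χ⁻¹ where
  even := star_mem_even ha.even
  star_mul_self := by rw [star_star, ha.mul_star_self]
  mul_star_self := by rw [star_star, ha.star_mul_self]
  mul_ι v := by
    have := ha.mul_ι (actV g⁻¹ v)
    rw [← actV_mul, mul_inv_cancel, actV_one] at this
    calc star a * ιQ v = star a * (ιQ v * a) * star a := by
          rw [mul_assoc, mul_assoc, ha.mul_star_self, mul_one]
      _ = ιQ (actV g⁻¹ v) * star a := by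
          rw [← this, ← mul_assoc, ha.star_mul_self, one_mul]
  scale z := by
    calc scaleCl z (star a) = scaleCl z (star a) * (a * star a) := by rw [ha.mul_star_self, mul_one]
      _ = scaleCl z (star a * a) * star a := by rw [map_mul, ha.scale, mul_assoc]
      _ = star a := by rw [ha.star_mul_self, map_one, one_mul]
  spinor_apply z := by
    have h0 : χ ≠ 0 := by
      rintro h0
      have := ha.sq
      simp [h0] at this
    have h1 : spinor a (χ⁻¹ • ExteriorAlgebra.map g⁻¹.toLinearMap z) = z := by
      rw [map_smul, ha.spinor_apply, ← exteriorMap_mul, mul_inv_cancel, exteriorMap_one,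
        inv_smul_smul₀ h0]
    rw [← h1, ← Module.End.mul_apply, ← map_mul, ha.star_mul_self, map_one, Module.End.one_apply, h1]
  sq := by
    have h1 : LinearMap.det g⁻¹.toLinearMap * LinearMap.det g.toLinearMap = 1 :=
      LinearEquiv.det_symm_mul_det g
    rw [inv_pow, eq_inv_of_mul_eq_one_left ha.sq, inv_inv, mul_comm, h1]

/-- Both sides are compared on products `y ∧ z`. The difference would be a term quadratic in `v`,
and `v ∧ v = 0`. -/
theorem exteriorMap_reflection {s : h ≃ₗ[ℂ] h} {α : Module.Dual ℂ h} {v : h}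
    (hs : ∀ y, s y = y - α y • v) (z : ExteriorAlgebra ℂ h) :
    ExteriorAlgebra.map s.toLinearMap z =
      z - ExteriorAlgebra.ι ℂ v *
        CliffordAlgebra.contractLeft (Q := (0 : QuadraticForm ℂ h)) α z := by
  induction z using CliffordAlgebra.left_induction with
  | algebraMap r =>
    rw [CliffordAlgebra.contractLeft_algebraMap, mul_zero, sub_zero]
    exact AlgHom.commutes _ r
  | add a b ha hb => rw [map_add, ha, hb, map_add, mul_add]; abel
  | ι_mul z y hz =>
    have h1 : ExteriorAlgebra.map s.toLinearMap (CliffordAlgebra.ι 0 y) =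
        ExteriorAlgebra.ι ℂ (s y) := ExteriorAlgebra.map_apply_ι _ _
    have h2 : ExteriorAlgebra.ι ℂ v * ExteriorAlgebra.ι ℂ v = 0 := ExteriorAlgebra.ι_sq_zero v
    have h3 : ExteriorAlgebra.ι ℂ v * ExteriorAlgebra.ι ℂ y =
        -(ExteriorAlgebra.ι ℂ y * ExteriorAlgebra.ι ℂ v) :=
      eq_neg_of_add_eq_zero_left (ExteriorAlgebra.ι_add_mul_swap v y)
    rw [CliffordAlgebra.contractLeft_ι_mul, map_mul, h1, hz, hs]
    change _ = ExteriorAlgebra.ι ℂ y * z - ExteriorAlgebra.ι ℂ v *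
      (α y • z - ExteriorAlgebra.ι ℂ y * CliffordAlgebra.contractLeft α z)
    rw [map_sub, map_smul, sub_mul, mul_sub, mul_sub, mul_sub, smul_mul_assoc, smul_mul_assoc,
      ← mul_assoc (ExteriorAlgebra.ι ℂ v) (ExteriorAlgebra.ι ℂ v), h2, zero_mul, smul_zero,
      mul_smul_comm, ← mul_assoc (ExteriorAlgebra.ι ℂ v) (ExteriorAlgebra.ι ℂ y), h3, neg_mul,
      mul_assoc]
    abel

/-- The lift is sought as a combination of `1` and `p = α v ∈ C(V)`. By the Clifford relations `p² =
-2 α(v) p` and `star p = -2 α(v) - p`, so that `p * star p = 0` and all conditions become scalar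
identities in `l = det s = 1 - α(v)`. -/
theorem exists_isLift_reflection {s : h ≃ₗ[ℂ] h} {α : Module.Dual ℂ h} {v : h}
    (hs : ∀ y, s y = y - α y • v) (h1 : α v ≠ 1)
    (hdet : LinearMap.det s.toLinearMap = 1 - α v) : ∃ a χ, IsLift s a χ := by
  obtain ⟨μ, hμ⟩ := IsAlgClosed.exists_pow_nat_eq (1 - α v) (n := 2) two_pos
  have hl0 : 1 - α v ≠ 0 := sub_ne_zero.mpr (Ne.symm h1)
  set l := 1 - α v with hl
  have hαv : α v = 1 - l := by rw [hl]; ring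
  set A := ιQ (α, 0) with hA
  set B := ιQ ((0 : Module.Dual ℂ h), v) with hB
  have hAA : A * A = 0 := by rw [hA, CliffordAlgebra.ι_sq_scalar,
    show Q h _ = 0 by simp [Q], map_zero]
  have hBB : B * B = 0 := by rw [hB, CliffordAlgebra.ι_sq_scalar,
    show Q h _ = 0 by simp [Q], map_zero]
  have hBA : B * A = (-2 * α v) • 1 - A * B := by
    have := cl_anticomm (h := h) (0, v) (α, 0)
    rw [← hA, ← hB] at this
    rw [eq_sub_iff_add_eq, this, Algebra.algebraMap_eq_smul_one]
    simp
  have hpp : A * B * (A * B) = (-2 * α v) • (A * B) := by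
    rw [mul_assoc, ← mul_assoc B, hBA, sub_mul, mul_sub, mul_assoc A B B, hBB, mul_zero,
      mul_zero, sub_zero, smul_mul_assoc, one_mul, mul_smul_comm]
  have hstar : star (A * B) = (-2 * α v) • 1 - A * B := by
    rw [star_mul, hA, hB, CliffordAlgebra.star_ι, CliffordAlgebra.star_ι, neg_mul_neg]
    exact hBA
  have hBAB : B * (A * B) = (-2 * α v) • B := by
    rw [← mul_assoc, hBA, sub_mul, mul_assoc A, hBB, mul_zero, sub_zero, smul_mul_assoc, one_mul]
  have hAAB : A * (A * B) = 0 := by rw [← mul_assoc, hAA, zero_mul]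
  have hev : A * B ∈ CliffordAlgebra.even (Q h) :=
    CliffordAlgebra.ι_mul_ι_mem_evenOdd_zero (Q h) _ _
  set p := A * B with hp
  have hw : ∀ w : V h, p * ιQ w =
      (-2 * w.1 v) • A + (2 * α w.2) • B + ιQ w * p := by
    intro w
    have e1 : B * ιQ w = (-2 * w.1 v) • 1 - ιQ w * B := by
      rw [eq_sub_iff_add_eq, hB, cl_anticomm, Algebra.algebraMap_eq_smul_one]
      simp
    have e2 : A * ιQ w = (-2 * α w.2) • 1 - ιQ w * A := by
      rw [eq_sub_iff_add_eq, hA, cl_anticomm, Algebra.algebraMap_eq_smul_one]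
      simp
    rw [hp, mul_assoc, e1, mul_sub, ← mul_assoc, e2, sub_mul, mul_smul_comm, mul_one,
      smul_mul_assoc, one_mul, mul_assoc]
    module
  have hact : ∀ w : V h, ιQ (actV s w) = ιQ w + (l⁻¹ * w.1 v) • A - α w.2 • B := by
    intro w
    rw [hA, hB, ← map_smul, ← map_smul, ← map_add, ← map_sub]
    congr 1
    refine Prod.ext ?_ ?_
    · refine LinearMap.ext fun y => ?_
      obtain ⟨y, rfl⟩ := s.surjective y
      have e1 : s⁻¹ (s y) = y := s.symm_apply_apply y
      have e2 : dualAct s w.1 (s y) = w.1 y := congrArg w.1 e1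
      simp only [actV, Prod.fst_add, Prod.fst_sub, Prod.smul_fst, smul_zero, sub_zero,
        LinearMap.add_apply, LinearMap.smul_apply, smul_eq_mul]
      rw [e2]
      simp only [hs, map_sub, map_smul, smul_eq_mul, hαv]
      field_simp
      ring
    · simp [actV, hs]
  have hsc : ∀ z, scaleCl z p = p := by
    intro z
    have e1 : scaleCl z A = ((z⁻¹ : ℂˣ) : ℂ) • A := by
      rw [hA, ← map_smul, scaleCl, CliffordAlgebra.map_apply_ι]
      refine congrArg ιQ (?_ : scaleV z (α, 0) = _)
      simp [scaleV]
    have e2 : scaleCl z B = (z : ℂ) • B := by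
      rw [hB, ← map_smul, scaleCl, CliffordAlgebra.map_apply_ι]
      refine congrArg ιQ (?_ : scaleV z (0, v) = _)
      simp [scaleV]
    rw [hp, map_mul, e1, e2, smul_mul_smul_comm]
    simp
  have hsp : ∀ z, spinor p z = (-2 * α v) • z + (2 : ℂ) • (ExteriorAlgebra.ι ℂ v *
      CliffordAlgebra.contractLeft (Q := (0 : QuadraticForm ℂ h)) α z) := by
    intro z
    rw [hp, map_mul, hA, hB, spinor_x, spinor_y, Module.End.mul_apply, LinearMap.smul_apply,
      LinearMap.mulLeft_apply]
    have : CliffordAlgebra.contractLeft (Q := (0 : QuadraticForm ℂ h)) α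
        (ExteriorAlgebra.ι ℂ v * z) = α v • z -
          ExteriorAlgebra.ι ℂ v * CliffordAlgebra.contractLeft α z :=
      CliffordAlgebra.contractLeft_ι_mul (Q := (0 : QuadraticForm ℂ h)) α v z
    rw [this]
    module
  have hstar' : star (μ • (1 - (2 * l)⁻¹ • p)) =
      μ • (1 - (2 * l)⁻¹ • ((-2 * α v) • 1 - p)) := by
    rw [CliffordAlgebra.star_smul, star_sub, star_one, CliffordAlgebra.star_smul, hstar]
  have hμ0 : μ ≠ 0 := by
    rintro rfl
    exact hl0 (by rw [← hμ]; simp)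
  -- By the formula for `p` on the spinor module, `1 - p / (2l)` acts there as `l⁻¹` times the
  -- natural action of `s`, and its product with its star is `l⁻¹`. Hence the normalization by a
  -- square root `μ` of `l`, and the character value `μ / l`, whose square is `(det s)⁻¹`.
  refine ⟨μ • (1 - (2 * l)⁻¹ • p), μ / l, ?_, ?_, ?_, fun w => ?_, fun z => ?_, fun z => ?_, ?_⟩
  · exact Subalgebra.smul_mem _
      (Subalgebra.sub_mem _ (Subalgebra.one_mem _) (Subalgebra.smul_mem _ hev _)) _
  · rw [hstar', smul_mul_smul_comm, ← sq, hμ]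
    simp only [mul_sub, sub_mul, one_mul, mul_one, smul_mul_assoc, mul_smul_comm, hpp, hαv]
    match_scalars <;> field_simp <;> ring
  · rw [hstar', smul_mul_smul_comm, ← sq, hμ]
    simp only [mul_sub, sub_mul, one_mul, mul_one, smul_mul_assoc, mul_smul_comm, hpp, hαv]
    match_scalars <;> field_simp <;> ring
  · rw [hact]
    simp only [mul_sub, sub_mul, add_mul, one_mul, mul_one, smul_mul_assoc, mul_smul_comm, hαv,
      hAAB, hBAB, hw]
    match_scalars <;> field_simp
    ring
  · rw [map_smul, map_sub, map_one, map_smul, hsc]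
  · rw [exteriorMap_reflection hs, map_smul, map_sub, map_one, map_smul, LinearMap.smul_apply,
      LinearMap.sub_apply, LinearMap.smul_apply, hsp, Module.End.one_apply, hαv]
    match_scalars <;> field_simp
    ring
  · rw [hdet, div_pow, hμ]
    field_simp

/-- Every element of a finite complex reflection group lifts to the Pin group. -/
theorem exists_isLift [FiniteDimensional ℂ h] {W : Subgroup (h ≃ₗ[ℂ] h)} [Finite W]
    (hW : IsComplexReflectionGroup W) (g : W) :
    ∃ a χ, IsLift (g : h ≃ₗ[ℂ] h) a χ := by
  suffices H : ∀ g ∈ Subgroup.closure {s : h ≃ₗ[ℂ] h | s ∈ W ∧ IsPseudoReflection s},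
      ∃ a χ, IsLift g a χ from H g (hW.symm ▸ g.2)
  intro g hg
  induction hg using Subgroup.closure_induction with
  | mem s hs =>
    have hfin : IsOfFinOrder s := by
      have := isOfFinOrder_of_finite (⟨s, hs.1⟩ : W)
      exact (Submonoid.isOfFinOrder_coe (H := W.toSubmonoid)).mpr this
    obtain ⟨α, v, h1, -, h2, h3⟩ := hs.2.exists_root hfin
    exact exists_isLift_reflection h1 h2 h3
  | one => exact ⟨1, 1, IsLift.one⟩
  | mul g g' _ _ hg hg' =>
    obtain ⟨a, χ, ha⟩ := hg
    obtain ⟨a', χ', ha'⟩ := hg'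
    exact ⟨_, _, ha.mul ha'⟩
  | inv g _ hg =>
    obtain ⟨a, χ, ha⟩ := hg
    exact ⟨_, _, ha.inv⟩

end Lifts
-- The rational Cherednik algebra as an instance of the abstract setting.
section Instances

/-- Exchange of the two spaces in a commutator form. -/
def HeckeDatum.swap {W U U' : Type*} [Group W] [AddCommGroup U] [Module ℂ U]
    [AddCommGroup U'] [Module ℂ U'] (D : HeckeDatum W U U') : HeckeDatum W U' U where
  ρ := D.ρ'
  ρ' := D.ρ
  κ g := -(D.κ g).flip
  κ_conj g s y x := by simp [D.κ_conj]
  κ_left g y x x' := by simp [D.κ_right g x x' y]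
  κ_right g y y' x := by simp [D.κ_left g x y y']

variable {h : Type u} [AddCommGroup h] [Module ℂ h]

/-- The representation of `W` on `𝔥`. -/
def natRep (W : Subgroup (h ≃ₗ[ℂ] h)) : Representation ℂ W h where
  toFun g := (g : h ≃ₗ[ℂ] h).toLinearMap
  map_one' := rfl
  map_mul' _ _ := rfl

/-- The representation of `W` on `𝔥*`. -/
def dualRep (W : Subgroup (h ≃ₗ[ℂ] h)) : Representation ℂ W (Module.Dual ℂ h) :=
  (natRep W).dual

theorem natRep_apply (W : Subgroup (h ≃ₗ[ℂ] h)) (g : W) (y : h) :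
    natRep W g y = (g : h ≃ₗ[ℂ] h) y := rfl

theorem dualRep_apply (W : Subgroup (h ≃ₗ[ℂ] h)) (g : W) (x : Module.Dual ℂ h) :
    dualRep W g x = dualAct (g : h ≃ₗ[ℂ] h) x := rfl

open Classical in
/-- The extension of `c` by zero from the pseudo-reflections to `W`. -/
noncomputable def extendCoeff {W : Subgroup (h ≃ₗ[ℂ] h)} (c : Reflections W → ℂ) (g : W) : ℂ :=
  if hg : IsPseudoReflection (g : h ≃ₗ[ℂ] h) then c ⟨g, hg⟩ else 0

open Classical in
/-- The coefficient of `g` in the commutator `[y, x]`. -/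
noncomputable def commForm {W : Subgroup (h ≃ₗ[ℂ] h)} (t : ℂ) (c : Reflections W → ℂ) (g : W) :
    h →ₗ[ℂ] Module.Dual ℂ h →ₗ[ℂ] ℂ :=
  (if g = 1 then t else 0) • Module.Dual.eval ℂ h -
    (extendCoeff c g / (1 - LinearMap.det (g : h ≃ₗ[ℂ] h).toLinearMap)) •
      (Module.Dual.eval ℂ h ∘ₗ (LinearMap.id - (g : h ≃ₗ[ℂ] h).toLinearMap))

variable {W : Subgroup (h ≃ₗ[ℂ] h)} (t : ℂ) (c : Reflections W → ℂ)

open Classical in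
theorem commForm_apply (g : W) (y : h) (x : Module.Dual ℂ h) :
    commForm t c g y x = (if g = 1 then t * x y else 0) -
      extendCoeff c g * reflForm (g : h ≃ₗ[ℂ] h) y x := by
  have h1 : commForm t c g y x = (if g = 1 then t else 0) * x y -
      extendCoeff c g / (1 - LinearMap.det (g : h ≃ₗ[ℂ] h).toLinearMap) *
        x (y - (g : h ≃ₗ[ℂ] h) y) := rfl
  rw [h1, reflForm, ite_mul, zero_mul]
  ring

theorem extendCoeff_conj (hc : ∀ s s' : Reflections W, IsConj (s : W) (s' : W) → c s = c s')
    (g s : W) : extendCoeff c (g * s * g⁻¹) = extendCoeff c s := by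
  have h1 : IsPseudoReflection ((g * s * g⁻¹ : W) : h ≃ₗ[ℂ] h) ↔
      IsPseudoReflection (s : h ≃ₗ[ℂ] h) := by
    have h2 : ((g * s * g⁻¹ : W) : h ≃ₗ[ℂ] h).toLinearMap - LinearMap.id =
        (g : h ≃ₗ[ℂ] h).toLinearMap ∘ₗ ((s : h ≃ₗ[ℂ] h).toLinearMap - LinearMap.id) ∘ₗ
          (g : h ≃ₗ[ℂ] h).symm.toLinearMap := by
      ext y
      obtain ⟨y, rfl⟩ := (g : h ≃ₗ[ℂ] h).surjective y
      have h3 : (g : h ≃ₗ[ℂ] h)⁻¹ ((g : h ≃ₗ[ℂ] h) y) = y := (g : h ≃ₗ[ℂ] h).symm_apply_apply y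
      simp [h3]
    unfold IsPseudoReflection
    rw [h2, LinearMap.range_comp, LinearMap.range_comp, LinearEquiv.range, Submodule.map_top]
    rw [LinearEquiv.finrank_map_eq]
  by_cases hs : IsPseudoReflection (s : h ≃ₗ[ℂ] h)
  · rw [extendCoeff, extendCoeff, dif_pos hs, dif_pos (h1.mpr hs)]
    exact hc _ _ (isConj_iff.mpr ⟨g⁻¹, by group⟩)
  · rw [extendCoeff, extendCoeff, dif_neg hs, dif_neg (h1.not.mpr hs)]

/-- Every nonzero coefficient away from the identity comes from a pseudo-reflection `y ↦ y - α y •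
v` and is a multiple of `α y * x v`. This rank-one shape is what yields the Jacobi identities. -/
theorem commForm_eq_zero_or [FiniteDimensional ℂ h] [Finite W] (g : W) :
    g = 1 ∨ commForm t c g = 0 ∨ ∃ (a : ℂ) (α : Module.Dual ℂ h) (v : h),
      (∀ y, (g : h ≃ₗ[ℂ] h) y = y - α y • v) ∧
      ∀ y x, commForm t c g y x = a * (α y * x v) := by
  by_cases hg : g = 1
  · exact Or.inl hg
  refine Or.inr ?_
  by_cases hs : IsPseudoReflection (g : h ≃ₗ[ℂ] h)
  · have hfin : IsOfFinOrder (g : h ≃ₗ[ℂ] h) :=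
      (Submonoid.isOfFinOrder_coe (H := W.toSubmonoid)).mpr (isOfFinOrder_of_finite g)
    obtain ⟨α, v, h1, -⟩ := hs.exists_root hfin
    refine Or.inr ⟨-(extendCoeff c g / (1 - LinearMap.det (g : h ≃ₗ[ℂ] h).toLinearMap)), α, v, h1,
      fun y x => ?_⟩
    rw [commForm_apply, if_neg hg, reflForm, h1, sub_sub_cancel, map_smul, smul_eq_mul]
    ring
  · refine Or.inl (LinearMap.ext₂ fun y x => ?_)
    rw [commForm_apply, if_neg hg, extendCoeff, dif_neg hs]
    simp

/-- The commutator form of the rational Cherednik algebra. -/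
noncomputable def cherednikDatum [FiniteDimensional ℂ h] [Finite W]
    (hc : ∀ s s' : Reflections W, IsConj (s : W) (s' : W) → c s = c s') :
    HeckeDatum W (Module.Dual ℂ h) h where
  ρ := dualRep W
  ρ' := natRep W
  κ := commForm t c
  κ_conj g s y x := by
    have h1 : g * s * g⁻¹ = 1 ↔ s = 1 := by
      rw [mul_inv_eq_one, mul_eq_left]
    have h3 : ∀ y, (g : h ≃ₗ[ℂ] h)⁻¹ ((g : h ≃ₗ[ℂ] h) y) = y :=
      (g : h ≃ₗ[ℂ] h).symm_apply_apply
    have h4 : ∀ y, dualAct (g : h ≃ₗ[ℂ] h) x ((g : h ≃ₗ[ℂ] h) y) = x y := fun y =>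
      congrArg x (h3 y)
    have h5 : ((g * s * g⁻¹ : W) : h ≃ₗ[ℂ] h) ((g : h ≃ₗ[ℂ] h) y) =
        (g : h ≃ₗ[ℂ] h) ((s : h ≃ₗ[ℂ] h) y) := by
      simp [h3]
    have h6 : LinearMap.det ((g * s * g⁻¹ : W) : h ≃ₗ[ℂ] h).toLinearMap =
        LinearMap.det (s : h ≃ₗ[ℂ] h).toLinearMap :=
      LinearMap.det_conj (s : h ≃ₗ[ℂ] h).toLinearMap (g : h ≃ₗ[ℂ] h)
    rw [commForm_apply, commForm_apply, extendCoeff_conj c hc, reflForm, reflForm, natRep_apply,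
      dualRep_apply, h5, h6, ← map_sub, h4, h4]
    by_cases hs : s = 1
    · rw [if_pos hs, if_pos (h1.mpr hs)]
    · rw [if_neg hs, if_neg (h1.not.mpr hs)]
  κ_left g y x x' := by
    obtain rfl | h0 | ⟨a, α, v, h1, h2⟩ := commForm_eq_zero_or t c g
    · simp
    · simp [h0]
    -- The functional `x - g x` is a multiple of one fixed functional, with factor `x v`. Both sides
    -- thus become multiples of `x v * x' v`, symmetric in `x` and `x'`.
    · have h3 : ∀ x : Module.Dual ℂ h, ∀ u, (x - dualRep W g x) ((g : h ≃ₗ[ℂ] h) u) =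
          -(α u * x v) := by
        intro x u
        have h4 : dualRep W g x ((g : h ≃ₗ[ℂ] h) u) = x u :=
          congrArg x ((g : h ≃ₗ[ℂ] h).symm_apply_apply u)
        rw [LinearMap.sub_apply, h4, h1, map_sub, map_smul, smul_eq_mul]
        ring
      refine LinearMap.ext fun u => ?_
      obtain ⟨u, rfl⟩ := (g : h ≃ₗ[ℂ] h).surjective u
      rw [LinearMap.smul_apply, LinearMap.smul_apply, h3, h3, h2, h2, smul_eq_mul, smul_eq_mul]
      ring
  κ_right g y y' x := by
    obtain rfl | h0 | ⟨a, α, v, h1, h2⟩ := commForm_eq_zero_or t c g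
    · simp
    · simp [h0]
    · rw [natRep_apply, natRep_apply, h1, h1, sub_sub_cancel, sub_sub_cancel, h2, h2, smul_smul,
        smul_smul]
      congr 1
      ring

theorem RCA.grp_mul_x (g : W) (x : Module.Dual ℂ h) : RCA.grp W t c g * RCA.vec W t c (x, 0) =
    RCA.vec W t c (dualRep W g x, 0) * RCA.grp W t c g := by
  rw [RCA.grp_mul_vec, dualRep_apply, actV, map_zero]

theorem RCA.grp_mul_y (g : W) (y : h) : RCA.grp W t c g * RCA.vec W t c (0, y) =
    RCA.vec W t c (0, natRep W g y) * RCA.grp W t c g := by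
  have : dualAct (g : h ≃ₗ[ℂ] h) 0 = 0 := LinearMap.zero_comp _
  rw [RCA.grp_mul_vec, natRep_apply, actV, this]

theorem RCA.vec_comm_x (x x' : Module.Dual ℂ h) : RCA.vec W t c (x, 0) * RCA.vec W t c (x', 0) =
    RCA.vec W t c (x', 0) * RCA.vec W t c (x, 0) := by
  have := RCA.mk_rel W t c (Rel.comm_x x x')
  rwa [map_mul, map_mul] at this

theorem RCA.vec_comm_y (y y' : h) : RCA.vec W t c (0, y) * RCA.vec W t c (0, y') =
    RCA.vec W t c (0, y') * RCA.vec W t c (0, y) := by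
  have := RCA.mk_rel W t c (Rel.comm_y y y')
  rwa [map_mul, map_mul] at this

theorem RCA.adjoin_eq_top : Algebra.adjoin ℂ
    (Set.range (fun x => RCA.vec W t c (x, 0)) ∪ Set.range (fun y => RCA.vec W t c (0, y)) ∪
      Set.range (RCA.grp W t c)) = ⊤ := by
  set S := Algebra.adjoin ℂ (Set.range (fun x => RCA.vec W t c (x, 0)) ∪
    Set.range (fun y => RCA.vec W t c (0, y)) ∪ Set.range (RCA.grp W t c)) with hS
  rw [eq_top_iff]
  rintro a -
  obtain ⟨p, rfl⟩ := RingQuot.mkAlgHom_surjective ℂ (Rel W t c) a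
  change RCA.mk W t c p ∈ S
  induction p using FreeAlgebra.induction with
  | grade0 r =>
    rw [AlgHom.commutes]
    exact S.algebraMap_mem r
  | grade1 s =>
    cases s with
    | vec v =>
      have h1 : RCA.vec W t c v = RCA.vec W t c (v.1, 0) + RCA.vec W t c (0, v.2) := by
        rw [← map_add]
        simp
      change RCA.vec W t c v ∈ S
      rw [h1]
      exact S.add_mem (Algebra.subset_adjoin (Or.inl (Or.inl ⟨_, rfl⟩)))
        (Algebra.subset_adjoin (Or.inl (Or.inr ⟨_, rfl⟩)))
    | grp g => exact Algebra.subset_adjoin (Or.inr ⟨g, rfl⟩)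
  | mul a b ha hb => rw [map_mul]; exact S.mul_mem ha hb
  | add a b ha hb => rw [map_add]; exact S.add_mem ha hb

variable [Fintype W]

/-- Reconciles the sum over all of `W`, with coefficient `t` at the identity and zero off the
pseudo-reflections, with the form of the defining relation. -/
theorem commForm_sum {A : Type*} [Ring A] [Algebra ℂ A] (γ : W →* A) (y : h)
    (x : Module.Dual ℂ h) :
    ∑ g, commForm t c g y x • γ g = algebraMap ℂ A (t * x y) -
      ∑ᶠ s : Reflections W, (c s * reflForm ((s : W) : h ≃ₗ[ℂ] h) y x) • γ (s : W) := by
  classical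
  simp only [commForm_apply, sub_smul, Finset.sum_sub_distrib, ite_smul, zero_smul]
  rw [Finset.sum_ite_eq' Finset.univ (1 : W), if_pos (Finset.mem_univ _), map_one,
    Algebra.algebraMap_eq_smul_one, finsum_eq_sum_of_fintype]
  congr 1
  have h1 : ∀ s : Reflections W, (c s * reflForm ((s : W) : h ≃ₗ[ℂ] h) y x) • γ (s : W) =
      (extendCoeff c s * reflForm ((s : W) : h ≃ₗ[ℂ] h) y x) • γ (s : W) := by
    intro s
    rw [extendCoeff, dif_pos s.2]
  simp only [h1]
  rw [← Finset.sum_subtype (Finset.univ.filter fun g : W => IsPseudoReflection (g : h ≃ₗ[ℂ] h))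
    (by simp) (fun g : W => (extendCoeff c g * reflForm (g : h ≃ₗ[ℂ] h) y x) • γ g)]
  symm
  refine Finset.sum_filter_of_ne fun g _ hg => ?_
  by_contra hs
  refine hg ?_
  rw [extendCoeff, dif_neg hs, zero_mul, zero_smul]

theorem RCA.vec_comm_yx (y : h) (x : Module.Dual ℂ h) :
    RCA.vec W t c (0, y) * RCA.vec W t c (x, 0) =
      RCA.vec W t c (x, 0) * RCA.vec W t c (0, y) +
        ∑ g, commForm t c g y x • RCA.grp W t c g := by
  classical
  rw [commForm_sum, ← sub_eq_iff_eq_add', ← one_smul ℂ (_ - _), RCA.comm_yx' W t c y x 1 rfl,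
    map_sub, AlgHom.commutes, finsum_eq_sum_of_fintype, finsum_eq_sum_of_fintype, map_sum]
  simp only [map_smul]
  rfl

/-- The universal property of the rational Cherednik algebra. -/
theorem RCA.exists_lift {A : Type*} [Ring A] [Algebra ℂ A] (X : Module.Dual ℂ h →ₗ[ℂ] A)
    (Y : h →ₗ[ℂ] A) (γ : W →* A) (hX : ∀ x x', X x * X x' = X x' * X x)
    (hY : ∀ y y', Y y * Y y' = Y y' * Y y)
    (hγX : ∀ g x, γ g * X x = X (dualRep W g x) * γ g)
    (hγY : ∀ g y, γ g * Y y = Y (natRep W g y) * γ g)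
    (hYX : ∀ y x, Y y * X x = X x * Y y + ∑ g, commForm t c g y x • γ g) :
    ∃ f : RCA W t c →ₐ[ℂ] A, (∀ x, f (RCA.vec W t c (x, 0)) = X x) ∧
      (∀ y, f (RCA.vec W t c (0, y)) = Y y) ∧ ∀ g, f (RCA.grp W t c g) = γ g := by
  let T : V h →ₗ[ℂ] A := X.coprod Y
  let F : FreeAlgebra ℂ (Gen W) →ₐ[ℂ] A := FreeAlgebra.lift ℂ fun s => match s with
    | Gen.vec v => T v
    | Gen.grp g => γ g
  have hFv : ∀ v, F (fv W v) = T v := fun v => by simp [F, fv]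
  have hFg : ∀ g, F (fg W g) = γ g := fun g => by simp [F, fg]
  have hTx : ∀ x, T (x, 0) = X x := fun x => by simp [T]
  have hTy : ∀ y, T (0, y) = Y y := fun y => by simp [T]
  have hrel : ∀ ⦃p q⦄, Rel W t c p q → F p = F q := by
    classical
    intro p q hpq
    cases hpq with
    | add v v' => simp only [map_add, hFv]
    | smul a v => simp only [map_smul, hFv]
    | one => simp only [map_one, hFg]
    | mul g g' => simp only [map_mul, hFg]
    | conj g v =>
      simp only [map_mul, hFv, hFg]
      change γ g * (X v.1 + Y v.2) = (X (dualRep W g v.1) + Y (natRep W g v.2)) * γ g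
      rw [mul_add, add_mul, hγX, hγY]
    | comm_x x x' => simp only [map_mul, hFv, hTx, hX x x']
    | comm_y y y' => simp only [map_mul, hFv, hTy, hY y y']
    | comm_yx y x =>
      have := commForm_sum t c γ y x
      rw [map_sub, map_mul, map_mul, hFv, hFv, hTx, hTy, hYX, add_sub_cancel_left, this, map_sub,
        AlgHom.commutes, finsum_eq_sum_of_fintype, finsum_eq_sum_of_fintype, map_sum]
      simp only [map_smul, hFg]
  let f : RCA W t c →ₐ[ℂ] A := RingQuot.liftAlgHom ℂ ⟨F, hrel⟩
  have hf : ∀ p, f (RCA.mk W t c p) = F p := fun p =>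
    RingQuot.liftAlgHom_mkAlgHom_apply ℂ F hrel p
  exact ⟨f, fun x => (hf _).trans ((hFv _).trans (hTx x)),
    fun y => (hf _).trans ((hFv _).trans (hTy y)), fun g => (hf _).trans (hFg g)⟩

/-- The model operators satisfy every defining relation of `H`; the action so obtained is what the
proof of the Poincaré-Birkhoff-Witt theorem needs. The commutator form is a hypothesis rather than
the concrete datum, so that the operators stay abstract. -/
theorem HeckeDatum.exists_rep (D : HeckeDatum W (Module.Dual ℂ h) h) (hρ : D.ρ = dualRep W)
    (hρ' : D.ρ' = natRep W) (hκ : D.κ = commForm t c) :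
    ∃ f : RCA W t c →ₐ[ℂ] Module.End ℂ D.Model,
      (∀ x p, f (RCA.vec W t c (x, 0)) p = SymmetricAlgebra.ι ℂ _ x • p) ∧
      (∀ y p, f (RCA.vec W t c (0, y)) p = D.vecOp y p) ∧
      ∀ g p, f (RCA.grp W t c g) p = D.grpOp g p := by
  let X : Module.Dual ℂ h →ₗ[ℂ] Module.End ℂ D.Model :=
    (Algebra.lsmul ℂ ℂ D.Model).toLinearMap ∘ₗ SymmetricAlgebra.ι ℂ (Module.Dual ℂ h)
  have hX : ∀ x x', X x * X x' = X x' * X x := fun x x' => LinearMap.ext fun p =>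
    smul_comm (SymmetricAlgebra.ι ℂ _ x) (SymmetricAlgebra.ι ℂ _ x') p
  have hY : ∀ y y', D.vecOp y * D.vecOp y' = D.vecOp y' * D.vecOp y := fun y y' =>
    LinearMap.ext fun p => D.vecOp_comm y y' p
  have hγX : ∀ g x, D.grpOp g * X x = X (dualRep W g x) * D.grpOp g := fun g x =>
    LinearMap.ext fun p => (D.grpOp_smul g x p).trans (by rw [hρ]; rfl)
  have hγY : ∀ g y, D.grpOp g * D.vecOp y = D.vecOp (natRep W g y) * D.grpOp g := fun g y =>
    LinearMap.ext fun p => (D.grpOp_vecOp g y p).trans (by rw [hρ']; rfl)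
  have hYX : ∀ y x, D.vecOp y * X x =
      X x * D.vecOp y + ∑ g, commForm t c g y x • D.grpOp g := fun y x =>
    LinearMap.ext fun p => (D.vecOp_smul y x p).trans (by
      rw [add_comm, D.commOp_apply, hκ, LinearMap.add_apply, LinearMap.sum_apply]
      rfl)
  obtain ⟨f, h1, h2, h3⟩ := RCA.exists_lift (A := Module.End ℂ D.Model) t c X D.vecOp D.grpOp hX hY hγX hγY hYX
  exact ⟨f, fun x p => by rw [h1]; rfl, fun y p => by rw [h2], fun g p => by rw [h3]⟩

theorem HeckeDatum.exists_rep_swap (D : HeckeDatum W h (Module.Dual ℂ h)) (hρ : D.ρ = natRep W)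
    (hρ' : D.ρ' = dualRep W) (hκ : ∀ g x y, D.κ g x y = -commForm t c g y x) :
    ∃ f : RCA W t c →ₐ[ℂ] Module.End ℂ D.Model,
      (∀ y p, f (RCA.vec W t c (0, y)) p = SymmetricAlgebra.ι ℂ _ y • p) ∧
      (∀ x p, f (RCA.vec W t c (x, 0)) p = D.vecOp x p) ∧
      ∀ g p, f (RCA.grp W t c g) p = D.grpOp g p := by
  let Y : h →ₗ[ℂ] Module.End ℂ D.Model :=
    (Algebra.lsmul ℂ ℂ D.Model).toLinearMap ∘ₗ SymmetricAlgebra.ι ℂ h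
  have hX : ∀ x x', D.vecOp x * D.vecOp x' = D.vecOp x' * D.vecOp x := fun x x' =>
    LinearMap.ext fun p => D.vecOp_comm x x' p
  have hY : ∀ y y', Y y * Y y' = Y y' * Y y := fun y y' => LinearMap.ext fun p =>
    smul_comm (SymmetricAlgebra.ι ℂ _ y) (SymmetricAlgebra.ι ℂ _ y') p
  have hγX : ∀ g x, D.grpOp g * D.vecOp x = D.vecOp (dualRep W g x) * D.grpOp g := fun g x =>
    LinearMap.ext fun p => (D.grpOp_vecOp g x p).trans (by rw [hρ']; rfl)
  have hγY : ∀ g y, D.grpOp g * Y y = Y (natRep W g y) * D.grpOp g := fun g y =>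
    LinearMap.ext fun p => (D.grpOp_smul g y p).trans (by rw [hρ]; rfl)
  have hYX : ∀ y x, Y y * D.vecOp x =
      D.vecOp x * Y y + ∑ g, commForm t c g y x • D.grpOp g := fun y x =>
    LinearMap.ext fun p => by
      -- With the roles exchanged the commutator is `[x, y] = -[y, x]`, so the two sums cancel.
      have e1 : D.commOp x y p + ∑ g, commForm t c g y x • D.grpOp g p = 0 := by
        rw [D.commOp_apply, ← Finset.sum_add_distrib]
        refine Finset.sum_eq_zero fun g _ => ?_
        rw [hκ, ← add_smul, neg_add_cancel, zero_smul]
      rw [LinearMap.add_apply, LinearMap.sum_apply]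
      change SymmetricAlgebra.ι ℂ _ y • D.vecOp x p =
        D.vecOp x (SymmetricAlgebra.ι ℂ _ y • p) + ∑ g, commForm t c g y x • D.grpOp g p
      rw [D.vecOp_smul, add_right_comm, e1, zero_add]
  obtain ⟨f, h1, h2, h3⟩ := RCA.exists_lift (A := Module.End ℂ D.Model) t c D.vecOp Y D.grpOp hX hY hγX hγY hYX
  exact ⟨f, fun x p => by rw [h2]; rfl, fun y p => by rw [h1], fun g p => by rw [h3]⟩

theorem scaleH_vec (a : ℂˣ) (v : V h) :
    scaleH W t c a (RCA.vec W t c v) = RCA.vec W t c (scaleV a v) :=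
  (RingQuot.liftAlgHom_mkAlgHom_apply ℂ _ _ _).trans (scaleFree_fv W t c a v)

theorem scaleH_grp (a : ℂˣ) (g : W) :
    scaleH W t c a (RCA.grp W t c g) = RCA.grp W t c g :=
  (RingQuot.liftAlgHom_mkAlgHom_apply ℂ _ _ _).trans (scaleFree_fg W t c a g)

theorem scaleV_x (a : ℂˣ) (x : Module.Dual ℂ h) :
    scaleV a (x, (0 : h)) = ((a⁻¹ : ℂˣ) : ℂ) • (x, 0) := by
  simp [scaleV]

theorem scaleV_y (a : ℂˣ) (y : h) :
    scaleV a ((0 : Module.Dual ℂ h), y) = (a : ℂ) • (0, y) := by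
  simp [scaleV]

variable [FiniteDimensional ℂ h]
  (hc : ∀ s s' : Reflections W, IsConj (s : W) (s' : W) → c s = c s')

/-- The rational Cherednik algebra as a realization of its commutator form, with `U = 𝔥*`. -/
noncomputable def realizationX : (cherednikDatum t c hc).Realization (RCA W t c) where
  X := RCA.vec W t c ∘ₗ LinearMap.inl ℂ _ _
  Y := RCA.vec W t c ∘ₗ LinearMap.inr ℂ _ _
  γ := RCA.grp W t c
  X_comm := RCA.vec_comm_x t c
  Y_comm := RCA.vec_comm_y t c
  γ_X g x := RCA.grp_mul_x t c g x
  γ_Y g y := RCA.grp_mul_y t c g y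
  Y_X := RCA.vec_comm_yx t c
  adjoin_eq := RCA.adjoin_eq_top t c
  rep := ((cherednikDatum t c hc).exists_rep t c rfl rfl rfl).choose
  rep_X := ((cherednikDatum t c hc).exists_rep t c rfl rfl rfl).choose_spec.1
  rep_Y := ((cherednikDatum t c hc).exists_rep t c rfl rfl rfl).choose_spec.2.1
  rep_γ := ((cherednikDatum t c hc).exists_rep t c rfl rfl rfl).choose_spec.2.2
  scale := scaleH W t c
  scale_X z x := (scaleH_vec t c z _).trans (by
    rw [LinearMap.inl_apply, scaleV_x, map_smul]; rfl)
  scale_Y z y := (scaleH_vec t c z _).trans (by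
    rw [LinearMap.inr_apply, scaleV_y, map_smul]; rfl)
  scale_γ := scaleH_grp t c

/-- The rational Cherednik algebra as a realization of its commutator form, with `U = 𝔥`. -/
noncomputable def realizationY : (cherednikDatum t c hc).swap.Realization (RCA W t c) where
  X := RCA.vec W t c ∘ₗ LinearMap.inr ℂ _ _
  Y := RCA.vec W t c ∘ₗ LinearMap.inl ℂ _ _
  γ := RCA.grp W t c
  X_comm := RCA.vec_comm_y t c
  Y_comm := RCA.vec_comm_x t c
  γ_X g y := RCA.grp_mul_y t c g y
  γ_Y g x := RCA.grp_mul_x t c g x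
  Y_X x y := by
    have e1 : ∑ g, (cherednikDatum t c hc).swap.κ g x y • RCA.grp W t c g =
        -∑ g, commForm t c g y x • RCA.grp W t c g := by
      rw [← Finset.sum_neg_distrib]
      exact Finset.sum_congr rfl fun g _ => neg_smul _ _
    rw [e1]
    exact eq_add_neg_of_add_eq (RCA.vec_comm_yx t c y x).symm
  adjoin_eq := (congrArg (fun s => Algebra.adjoin ℂ (s ∪ _)) (Set.union_comm _ _)).trans
    (RCA.adjoin_eq_top t c)
  rep := ((cherednikDatum t c hc).swap.exists_rep_swap t c rfl rfl fun _ _ _ => rfl).choose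
  rep_X := ((cherednikDatum t c hc).swap.exists_rep_swap t c rfl rfl fun _ _ _ => rfl).choose_spec.1
  rep_Y :=
    ((cherednikDatum t c hc).swap.exists_rep_swap t c rfl rfl fun _ _ _ => rfl).choose_spec.2.1
  rep_γ :=
    ((cherednikDatum t c hc).swap.exists_rep_swap t c rfl rfl fun _ _ _ => rfl).choose_spec.2.2
  -- The abstract convention gives `U` weight `-1`; here `U = 𝔥` has weight `1`, so the `ℂ*`-action
  -- is inverted.
  scale z := scaleH W t c z⁻¹
  scale_X z y := (scaleH_vec t c z⁻¹ _).trans (by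
    rw [LinearMap.inr_apply, scaleV_y, map_smul]; rfl)
  scale_Y z x := (scaleH_vec t c z⁻¹ _).trans (by
    rw [LinearMap.inl_apply, scaleV_x, map_smul, inv_inv]; rfl)
  scale_γ z := scaleH_grp t c z⁻¹

end Instances
-- The Clifford algebra as an instance of the abstract setting.
section CliffordInstances

variable {h : Type u} [AddCommGroup h] [Module ℂ h]

local notation "ιQ" => CliffordAlgebra.ι (Q h)

theorem scaleCl_ι (z : ℂˣ) (v : V h) : scaleCl z (ιQ v) = ιQ (scaleV z v) := by
  rw [scaleCl, CliffordAlgebra.map_apply_ι]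
  rfl

theorem scaleCl_involute (z : ℂˣ) (a : Cl h) :
    scaleCl z (CliffordAlgebra.involute a) = CliffordAlgebra.involute (scaleCl z a) := by
  have : (scaleCl z).comp (CliffordAlgebra.involute (Q := Q h)) =
      CliffordAlgebra.involute.comp (scaleCl z) := by
    refine CliffordAlgebra.hom_ext (LinearMap.ext fun v => ?_)
    simp only [LinearMap.comp_apply, AlgHom.toLinearMap_apply, AlgHom.comp_apply,
      CliffordAlgebra.involute_ι, map_neg, scaleCl_ι]
  exact DFunLike.congr_fun this a

theorem clifford_x_x (x x' : Module.Dual ℂ h) :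
    ιQ (x, 0) * ιQ (x', 0) = -(ιQ (x', 0) * ιQ (x, 0)) := by
  refine eq_neg_of_add_eq_zero_left ?_
  rw [cl_anticomm]
  simp only [map_zero, add_zero, mul_zero]

theorem clifford_y_y (y y' : h) :
    ιQ (0, y) * ιQ (0, y') = -(ιQ (0, y') * ιQ (0, y)) := by
  refine eq_neg_of_add_eq_zero_left ?_
  rw [cl_anticomm]
  simp only [LinearMap.zero_apply, add_zero, mul_zero, map_zero]

theorem clifford_y_x (y : h) (x : Module.Dual ℂ h) :
    ιQ (0, y) * ιQ (x, 0) = (-2 * x y) • 1 - ιQ (x, 0) * ιQ (0, y) := by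
  rw [eq_sub_iff_add_eq, cl_anticomm, Algebra.algebraMap_eq_smul_one]
  simp

theorem clifford_adjoin : Algebra.adjoin ℂ
    (Set.range (fun x => ιQ (x, 0)) ∪ Set.range (fun y => ιQ (0, y))) = ⊤ := by
  refine top_unique ((CliffordAlgebra.adjoin_range_ι (Q := Q h)).symm.le.trans
    (Algebra.adjoin_le ?_))
  rintro _ ⟨⟨x, y⟩, rfl⟩
  have : ιQ (x, y) = ιQ (x, 0) + ιQ (0, y) := by rw [← map_add]; simp
  rw [SetLike.mem_coe, this]
  exact Subalgebra.add_mem _ (Algebra.subset_adjoin (Or.inl ⟨x, rfl⟩))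
    (Algebra.subset_adjoin (Or.inr ⟨y, rfl⟩))

variable [FiniteDimensional ℂ h] {W : Subgroup (h ≃ₗ[ℂ] h)} [Fintype W]
  (t : ℂ) (c : Reflections W → ℂ)
  (hc : ∀ s s' : Reflections W, IsConj (s : W) (s' : W) → c s = c s')
  (a : W → Cl h) (χ : W → ℂ) (ha : ∀ g : W, IsLift (g : h ≃ₗ[ℂ] h) (a g) (χ g))

theorem sum_coord_smul_coord (x : Module.Dual ℂ h) :
    ∑ i, x (Module.finBasis ℂ h i) • (Module.finBasis ℂ h).coord i = x := by
  refine (Module.finBasis ℂ h).ext fun j => ?_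
  rw [LinearMap.sum_apply, Finset.sum_eq_single j]
  · simp
  · intro i _ hij
    simp [hij.symm]
  · simp

/-- The unit given by a lift. -/
def IsLift.unit {g : h ≃ₗ[ℂ] h} {a : Cl h} {χ : ℂ} (ha : IsLift g a χ) : (Cl h)ˣ :=
  ⟨a, star a, ha.mul_star_self, ha.star_mul_self⟩

/-- The Clifford algebra of `V`, with `U = 𝔥*`. -/
noncomputable def cliffordX : CliffordDatum (cherednikDatum t c hc) (Cl h) where
  X := ιQ ∘ₗ LinearMap.inl ℂ _ _
  Y := ιQ ∘ₗ LinearMap.inr ℂ _ _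
  pair := Module.Dual.eval ℂ h
  ε := CliffordAlgebra.involute
  scale := scaleCl
  dim := Module.finrank ℂ h
  ux := (Module.finBasis ℂ h).coord
  uy := Module.finBasis ℂ h
  lift g := (ha g).unit
  X_X := clifford_x_x
  Y_Y := clifford_y_y
  Y_X := clifford_y_x
  ε_X _ := CliffordAlgebra.involute_ι _
  ε_Y _ := CliffordAlgebra.involute_ι _
  ε_ε := CliffordAlgebra.involute_involute
  scale_X z x := (scaleCl_ι z _).trans (by rw [LinearMap.inl_apply, scaleV_x, map_smul]; rfl)
  scale_Y z y := (scaleCl_ι z _).trans (by rw [LinearMap.inr_apply, scaleV_y, map_smul]; rfl)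
  scale_ε := scaleCl_involute
  adjoin_eq := clifford_adjoin
  sum_pair := sum_coord_smul_coord
  sum_tmul g := sum_dual_invariant (TensorProduct.mk ℂ (Module.Dual ℂ h) h) (g : h ≃ₗ[ℂ] h)
  ε_lift g := CliffordAlgebra.involute_eq_of_mem_even (ha g).even
  scale_lift z g := (ha g).scale z
  lift_Y g y := ((ha g).mul_ι (0, y)).trans (by
    have : dualAct (g : h ≃ₗ[ℂ] h) 0 = 0 := LinearMap.zero_comp _
    rw [actV, this]; rfl)

/-- The Clifford algebra of `V`, with `U = 𝔥`. -/
noncomputable def cliffordY : CliffordDatum (cherednikDatum t c hc).swap (Cl h) where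
  X := ιQ ∘ₗ LinearMap.inr ℂ _ _
  Y := ιQ ∘ₗ LinearMap.inl ℂ _ _
  pair := (Module.Dual.eval ℂ h).flip
  ε := CliffordAlgebra.involute
  scale z := scaleCl z⁻¹
  dim := Module.finrank ℂ h
  ux := Module.finBasis ℂ h
  uy := (Module.finBasis ℂ h).coord
  lift g := (ha g).unit
  X_X := clifford_y_y
  Y_Y := clifford_x_x
  Y_X x y := eq_sub_of_add_eq (by
    rw [add_comm]
    exact add_eq_of_eq_sub (clifford_y_x y x))
  ε_X _ := CliffordAlgebra.involute_ι _
  ε_Y _ := CliffordAlgebra.involute_ι _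
  ε_ε := CliffordAlgebra.involute_involute
  scale_X z y := (scaleCl_ι z⁻¹ _).trans (by rw [LinearMap.inr_apply, scaleV_y, map_smul]; rfl)
  scale_Y z x := (scaleCl_ι z⁻¹ _).trans (by
    rw [LinearMap.inl_apply, scaleV_x, map_smul, inv_inv]; rfl)
  scale_ε z := scaleCl_involute z⁻¹
  adjoin_eq := (congrArg (Algebra.adjoin ℂ) (Set.union_comm _ _)).trans clifford_adjoin
  sum_pair := (Module.finBasis ℂ h).sum_repr
  sum_tmul g := sum_dual_invariant (TensorProduct.mk ℂ h (Module.Dual ℂ h)).flip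
    (g : h ≃ₗ[ℂ] h)
  ε_lift g := CliffordAlgebra.involute_eq_of_mem_even (ha g).even
  scale_lift z g := (ha g).scale z⁻¹
  lift_Y g x := ((ha g).mul_ι (x, 0)).trans (by
    rw [actV, map_zero]; rfl)

end CliffordInstances

/-! ### Elements of the double cover given by lifts. -/

section Cover

variable {h : Type u} [AddCommGroup h] [Module ℂ h] {W : Subgroup (h ≃ₗ[ℂ] h)}

/-- The element of `W̃` given by a lift. -/
def IsLift.toCover {g : W} {a : Cl h} {χ : ℂ} (ha : IsLift (g : h ≃ₗ[ℂ] h) a χ) :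
    doubleCover W :=
  ⟨(g, ha.unit), ha.even, ha.star_mul_self, ha.mul_ι⟩

theorem coverIncl_negOne : coverIncl W (negOne W) = -1 := rfl

theorem cover_ext {g g' : doubleCover W} (h1 : coverMap W g = coverMap W g')
    (h2 : coverIncl W g = coverIncl W g') : g = g' :=
  Subtype.ext (Prod.ext h1 (Units.ext h2))

end Cover

/-! ### The kernel of the covering map and the spin character. -/

section Kernel

/-- Such an element is killed by `numX`, whose eigenvalue on a monomial counts the factors from `U`;
hence only monomials in `U'` occur. -/
theorem CliffordDatum.mem_span_of_ad_eq_zero {W U U' : Type*} [Group W] [AddCommGroup U]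
    [Module ℂ U] [AddCommGroup U'] [Module ℂ U'] {D : HeckeDatum W U U'} {C : Type*} [Ring C]
    [Algebra ℂ C] (L : CliffordDatum D C) {a : C} (ha : ∀ y, L.ad y a = 0) :
    a ∈ Submodule.span ℂ (Set.range fun m : List U' => (m.map L.Y).prod) := by
  have h1 : L.numX a = (0 : ℂ) • a := by
    rw [L.numX_apply, zero_smul]
    exact Finset.sum_eq_zero fun i _ => by rw [ha, mul_zero]
  have h2 := mem_span_of_apply_eq_smul L.numX
    (fun p : List U × List U' => (p.1.map L.X).prod * (p.2.map L.Y).prod)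
    (fun p => -2 * p.1.length) (fun p => L.numX_monomial p.1 p.2) (s := Set.univ) (a := a)
    (by rw [Set.image_univ, L.span_monomials]; trivial) h1
  refine Submodule.span_mono ?_ h2
  rintro _ ⟨⟨l, m⟩, ⟨-, hl⟩, rfl⟩
  have : l = [] := by simpa using hl
  exact ⟨m, by simp [this]⟩

variable {h : Type u} [AddCommGroup h] [Module ℂ h] [FiniteDimensional ℂ h]

/-- An even element of the Clifford algebra commuting with `V` is a scalar. -/
theorem exists_eq_algebraMap_of_commute {a : Cl h} (h0 : a ∈ CliffordAlgebra.even (Q h))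
    (h1 : ∀ v, a * CliffordAlgebra.ι (Q h) v = CliffordAlgebra.ι (Q h) v * a) :
    ∃ r : ℂ, a = algebraMap ℂ (Cl h) r := by
  -- Only the Clifford algebra matters here; the trivial group and zero parameters make the two
  -- abstract instances available.
  let W : Subgroup (h ≃ₗ[ℂ] h) := ⊥
  have hc : ∀ s s' : Reflections W, IsConj (s : W) (s' : W) → (0 : ℂ) = 0 := fun _ _ _ => rfl
  have hl : ∀ g : W, IsLift (g : h ≃ₗ[ℂ] h) 1 1 := by
    rintro ⟨g, hg⟩
    obtain rfl := Subgroup.mem_bot.mp hg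
    exact IsLift.one
  let L := cliffordX 0 (fun _ => 0) hc _ _ hl
  let L' := cliffordY 0 (fun _ => 0) hc _ _ hl
  have hε : CliffordAlgebra.involute a = a := CliffordAlgebra.involute_eq_of_mem_even h0
  have h2 : ∀ y, L.ad y a = 0 := fun y => by
    rw [L.ad_apply, sub_eq_zero]
    exact (h1 (0, y)).symm.trans (congrArg (· * _) hε.symm)
  have h3 : ∀ x, L'.ad x a = 0 := fun x => by
    rw [L'.ad_apply, sub_eq_zero]
    exact (h1 (x, 0)).symm.trans (congrArg (· * _) hε.symm)
  have h4 := L.mem_span_of_ad_eq_zero h2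
  have h5 : L'.numX a = (0 : ℂ) • a := by
    rw [L'.numX_apply, zero_smul]
    exact Finset.sum_eq_zero fun i _ => by rw [h3, mul_zero]
  -- The element already lies in the span of the monomials in `𝔥`; counting factors from `𝔥` with
  -- the exchanged datum leaves only the empty monomial.
  have h6 := mem_span_of_apply_eq_smul L'.numX (fun m : List h => (m.map L'.X).prod)
    (fun m => -2 * m.length) (fun m => by simpa using L'.numX_monomial m [])
    (s := Set.univ) (a := a) (by rw [Set.image_univ]; exact h4) h5
  have h7 : a ∈ Submodule.span ℂ {(1 : Cl h)} := by
    refine Submodule.span_mono ?_ h6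
    rintro _ ⟨m, ⟨-, hm⟩, rfl⟩
    have : m = [] := by simpa using hm
    simp [this]
  obtain ⟨r, hr⟩ := Submodule.mem_span_singleton.mp h7
  exact ⟨r, by rw [← hr, Algebra.algebraMap_eq_smul_one]⟩

variable {W : Subgroup (h ≃ₗ[ℂ] h)}

/-- An element over `1` is even and commutes with `V`, so it is a scalar; the normalization by
`star` makes its square `1`. -/
theorem eq_one_or_eq_negOne {g : doubleCover W} (hg : coverMap W g = 1) :
    g = 1 ∨ g = negOne W := by
  have h3 : ∀ v, coverIncl W g * CliffordAlgebra.ι (Q h) v =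
      CliffordAlgebra.ι (Q h) v * coverIncl W g := fun v => by
    have := g.2.2.2 v
    have hg' : (g : W × (Cl h)ˣ).1 = 1 := hg
    rw [hg', Subgroup.coe_one, actV_one] at this
    exact this
  obtain ⟨r, hr⟩ := exists_eq_algebraMap_of_commute g.2.1 h3
  have h4 : star (coverIncl W g) * coverIncl W g = 1 := g.2.2.1
  have hr' : coverIncl W g = algebraMap ℂ (Cl h) r := hr
  rw [hr', CliffordAlgebra.star_algebraMap, ← map_mul, ← map_one (algebraMap ℂ (Cl h))] at h4
  have h5 := (algebraMap ℂ (Cl h)).injective h4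
  rcases mul_self_eq_one_iff.mp h5 with h6 | h6
  · refine Or.inl (cover_ext hg ?_)
    rw [hr', h6, map_one, map_one]
  · refine Or.inr (cover_ext hg ?_)
    rw [hr', h6, map_neg, map_one, coverIncl_negOne]

theorem eq_or_eq_mul_negOne {g g' : doubleCover W} (hg : coverMap W g = coverMap W g') :
    g = g' ∨ g = g' * negOne W := by
  have h1 : coverMap W (g'⁻¹ * g) = 1 := by rw [map_mul, map_inv, hg, inv_mul_cancel]
  rcases eq_one_or_eq_negOne h1 with h2 | h2
  · exact Or.inl (inv_mul_eq_one.mp h2).symm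
  · exact Or.inr (by rw [← h2, mul_inv_cancel_left])

variable [Finite W]

/-- Every element of `W̃` is a constructed lift up to sign, and both signs have the properties
collected in `IsLift`, including invariance under the grading. -/
theorem exists_isLift_cover (hW : IsComplexReflectionGroup W) (g : doubleCover W) :
    ∃ χ, IsLift ((coverMap W g : W) : h ≃ₗ[ℂ] h) (coverIncl W g) χ := by
  obtain ⟨a, χ, ha⟩ := exists_isLift hW (coverMap W g)
  rcases eq_or_eq_mul_negOne (g := g) (g' := ha.toCover) rfl with h1 | h1
  · refine ⟨χ, ?_⟩
    have : coverIncl W g = a := by rw [h1]; rfl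
    rwa [this]
  · refine ⟨-χ, ?_⟩
    have : coverIncl W g = -a := by
      rw [h1, map_mul, coverIncl_negOne, mul_neg, mul_one]
      rfl
    rw [this]
    exact ha.neg

theorem finite_doubleCover (hW : IsComplexReflectionGroup W) : Finite (doubleCover W) := by
  choose a χ ha using exists_isLift hW
  refine Finite.of_surjective (fun p : W × Bool =>
    if p.2 then (ha p.1).toCover else (ha p.1).toCover * negOne W) fun g => ?_
  rcases eq_or_eq_mul_negOne (g := g) (g' := (ha (coverMap W g)).toCover) rfl with h1 | h1
  · exact ⟨(coverMap W g, true), h1.symm⟩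
  · exact ⟨(coverMap W g, false), h1.symm⟩

/-- The scalars are read off from the action on `1 ∈ ⋀𝔥`, which the natural action fixes;
multiplicativity follows. The square comes from `IsLift.sq`. -/
theorem exists_spinCharacter (hW : IsComplexReflectionGroup W) :
    ∃ χ : doubleCover W →* ℂˣ, IsSpinCharacter W χ ∧
    χ (negOne W) = -1 ∧ ∀ g : doubleCover W, (χ g : ℂ) ^ 2 =
      LinearMap.det (((coverMap W g : W) : h ≃ₗ[ℂ] h)⁻¹.toLinearMap.dualMap) := by
  choose χ hχ using exists_isLift_cover hW
  have h1 : ∀ g, spinor (coverIncl W g) 1 = algebraMap ℂ (ExteriorAlgebra ℂ h) (χ g) := fun g => by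
    rw [(hχ g).spinor_apply, map_one, Algebra.algebraMap_eq_smul_one]
  have hinj : Function.Injective (algebraMap ℂ (ExteriorAlgebra ℂ h)) :=
    (ExteriorAlgebra.algebraMap_leftInverse h).injective
  let f : doubleCover W →* ℂ :=
    { toFun := χ
      map_one' := hinj (by
        rw [← h1, map_one (coverIncl W), map_one spinor, Module.End.one_apply, map_one])
      map_mul' := fun g g' => hinj (by
        rw [← h1, map_mul, map_mul, Module.End.mul_apply, h1, Algebra.algebraMap_eq_smul_one,
          map_smul, h1, map_mul, Algebra.smul_def, Algebra.commutes]) }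
  refine ⟨f.toHomUnits, fun g z => (hχ g).spinor_apply z, ?_, fun g => ?_⟩
  · refine Units.ext (hinj ?_)
    change algebraMap ℂ _ (χ (negOne W)) = _
    rw [← h1, coverIncl_negOne, map_neg, map_one spinor]
    simp
  · change χ g ^ 2 = _
    have h2 : LinearMap.det ((coverMap W g : W) : h ≃ₗ[ℂ] h)⁻¹.toLinearMap *
        LinearMap.det ((coverMap W g : W) : h ≃ₗ[ℂ] h).toLinearMap = 1 :=
      LinearEquiv.det_symm_mul_det _
    rw [LinearMap.det_dualMap, eq_inv_of_mul_eq_one_left (hχ g).sq, eq_inv_of_mul_eq_one_left h2]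

end Kernel
-- Averaging over a finite group.
section Average

variable {G : Type*} [Group G] [Fintype G] {A : Type*} [Ring A] [Algebra ℂ A]

/-- The average of `g x g⁻¹` over a finite group. -/
noncomputable def average (φ : G →* A) : A →ₗ[ℂ] A :=
  (Fintype.card G : ℂ)⁻¹ • ∑ g, LinearMap.mulLeft ℂ (φ g) ∘ₗ LinearMap.mulRight ℂ (φ g⁻¹)

theorem average_apply (φ : G →* A) (x : A) :
    average φ x = (Fintype.card G : ℂ)⁻¹ • ∑ g, φ g * (x * φ g⁻¹) := by
  simp [average]

theorem mul_average (φ : G →* A) (k : G) (x : A) :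
    φ k * average φ x = average φ x * φ k := by
  rw [average_apply, mul_smul_comm, smul_mul_assoc, Finset.mul_sum, Finset.sum_mul]
  congr 1
  refine Fintype.sum_equiv (Equiv.mulLeft k) _ _ fun g => ?_
  simp only [Equiv.coe_mulLeft, map_mul, mul_inv_rev, mul_assoc]
  rw [← map_mul φ k⁻¹, inv_mul_cancel, map_one, mul_one]

theorem average_of_commute (φ : G →* A) {x : A} (hx : ∀ g, φ g * x = x * φ g) :
    average φ x = x := by
  have h1 : ∀ g, φ g * (x * φ g⁻¹) = x := fun g => by
    rw [← mul_assoc, hx, mul_assoc, ← map_mul, mul_inv_cancel, map_one, mul_one]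
  simp only [average_apply, h1, Finset.sum_const, Finset.card_univ]
  rw [← Nat.cast_smul_eq_nsmul ℂ, smul_smul,
    inv_mul_cancel₀ (Nat.cast_ne_zero.mpr Fintype.card_ne_zero), one_smul]

theorem map_average {B : Type*} [Ring B] [Algebra ℂ B] (φ : G →* A) (f : A →ₐ[ℂ] B) (x : A) :
    f (average φ x) = average (f.toMonoidHom.comp φ) (f x) := by
  simp [average_apply]

theorem average_mem_center (p : MonoidAlgebra ℂ G) :
    average (MonoidAlgebra.of ℂ G) p ∈ Subalgebra.center ℂ (MonoidAlgebra ℂ G) := by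
  rw [Subalgebra.mem_center_iff]
  intro q
  induction q using MonoidAlgebra.induction_on with
  | of g => exact mul_average _ g p
  | add p q hp hq => rw [add_mul, mul_add, hp, hq]
  | smul r p hp => rw [smul_mul_assoc, mul_smul_comm, hp]

end Average

/-! ### The diagonal embedding of the group algebra and the derivation rule for δ. -/

section Diagonal

variable {h : Type u} [AddCommGroup h] [Module ℂ h]
  {W : Subgroup (h ≃ₗ[ℂ] h)} {t : ℂ} {c : Reflections W → ℂ}

theorem diag_of (g : doubleCover W) : diag W t c (MonoidAlgebra.of ℂ _ g) =
    RCA.grp W t c (coverMap W g) ⊗ₜ[ℂ] coverIncl W g := by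
  rw [diag, MonoidAlgebra.lift_of]
  rfl

theorem eps_diag (p : MonoidAlgebra ℂ (doubleCover W)) :
    eps W t c (diag W t c p) = diag W t c p := by
  induction p using MonoidAlgebra.induction_on with
  | of g =>
    rw [diag_of, eps, Algebra.TensorProduct.map_tmul, AlgHom.id_apply]
    congr 1
    exact CliffordAlgebra.involute_eq_of_mem_even g.2.1
  | add p q hp hq => rw [map_add, map_add, hp, hq]
  | smul r p hp => rw [map_smul, map_smul, hp]

theorem delta_apply (D a : HC W t c) : delta D a = D * a - eps W t c a * D := rfl

/-- The rule behind both the compatibility of δ with averaging and the multiplicativity of the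
projection. -/
theorem delta_mul (D a b : HC W t c) :
    delta D (a * b) = delta D a * b + eps W t c a * delta D b := by
  simp only [delta_apply, map_mul, sub_mul, mul_sub, mul_assoc]
  abel

theorem eps_eps (a : HC W t c) : eps W t c (eps W t c a) = a := by
  induction a using TensorProduct.induction_on with
  | zero => simp
  | add p q hp hq => rw [map_add, map_add, hp, hq]
  | tmul a b => simp [eps]

/-- The two lifts of an element of `W` differ by a sign, so one lift per element suffices to span
`Δ(ℂ[W̃])`. -/
theorem mem_span_lifts_iff [FiniteDimensional ℂ h] {a : W → Cl h} {χ : W → ℂ}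
    (ha : ∀ g : W, IsLift (g : h ≃ₗ[ℂ] h) (a g) (χ g)) (x : HC W t c) :
    x ∈ Submodule.span ℂ (Set.range fun g => RCA.grp W t c g ⊗ₜ[ℂ] a g) ↔
      ∃ p, x = diag W t c p := by
  constructor
  · intro hx
    have : Submodule.span ℂ (Set.range fun g => RCA.grp W t c g ⊗ₜ[ℂ] a g) ≤
        LinearMap.range (diag W t c).toLinearMap := by
      refine Submodule.span_le.mpr ?_
      rintro _ ⟨g, rfl⟩
      exact ⟨MonoidAlgebra.of ℂ _ (ha g).toCover, diag_of _⟩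
    obtain ⟨p, hp⟩ := this hx
    exact ⟨p, hp.symm⟩
  · rintro ⟨p, rfl⟩
    induction p using MonoidAlgebra.induction_on with
    | of g =>
      have h0 : RCA.grp W t c (coverMap W g) ⊗ₜ[ℂ] a (coverMap W g) ∈
          Submodule.span ℂ (Set.range fun g => RCA.grp W t c g ⊗ₜ[ℂ] a g) :=
        Submodule.subset_span ⟨_, rfl⟩
      rw [diag_of]
      rcases eq_or_eq_mul_negOne (g := g) (g' := (ha (coverMap W g)).toCover) rfl with h1 | h1
      · have h2 : coverIncl W g = a (coverMap W g) := by
          conv_lhs => rw [h1]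
          rfl
        rwa [h2]
      · have h2 : coverIncl W g = -a (coverMap W g) := by
          conv_lhs => rw [h1, map_mul, coverIncl_negOne, mul_neg, mul_one]
          rfl
        rw [h2, TensorProduct.tmul_neg]
        exact Submodule.neg_mem _ h0
    | add p q hp hq => rw [map_add]; exact Submodule.add_mem _ hp hq
    | smul r p hp => rw [map_smul]; exact Submodule.smul_mem _ _ hp

end Diagonal

/-! ### The decomposition of `ker δ` on `W̃`-invariants. -/

section Projection

variable {h : Type u} [AddCommGroup h] [Module ℂ h]
  {W : Subgroup (h ≃ₗ[ℂ] h)} [Finite W] {t : ℂ} {c : Reflections W → ℂ}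

theorem mem_algA {x : HC W t c} : x ∈ algA W t c ↔
    ∀ a : ℂˣ, Algebra.TensorProduct.map (scaleH W t c a) (scaleCl a) x = x := by
  simp [algA, Algebra.mem_iInf, AlgHom.mem_equalizer]

theorem mem_algAW {x : HC W t c} : x ∈ algAW W t c ↔ x ∈ algA W t c ∧
    ∀ g, diag W t c (MonoidAlgebra.of ℂ _ g) * x = x * diag W t c (MonoidAlgebra.of ℂ _ g) := by
  rw [algAW, Algebra.mem_inf, Subalgebra.mem_centralizer_iff]
  refine and_congr_right fun _ => ⟨fun H g => H _ ⟨_, rfl⟩, ?_⟩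
  rintro H _ ⟨p, rfl⟩
  change diag W t c p * x = x * diag W t c p
  induction p using MonoidAlgebra.induction_on with
  | of g => exact H g
  | add p q hp hq => rw [map_add, add_mul, mul_add, hp, hq]
  | smul r p hp => rw [map_smul, smul_mul_assoc, mul_smul_comm, hp]

theorem eps_mem_algA {x : HC W t c} (hx : x ∈ algA W t c) : eps W t c x ∈ algA W t c := by
  rw [mem_algA] at hx ⊢
  intro a
  have h1 : ∀ x, Algebra.TensorProduct.map (scaleH W t c a) (scaleCl a) (eps W t c x) =
      eps W t c (Algebra.TensorProduct.map (scaleH W t c a) (scaleCl a) x) := by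
    intro x
    induction x using TensorProduct.induction_on with
    | zero => simp
    | add p q hp hq => simp only [map_add, hp, hq]
    | tmul p q => simp [eps, scaleCl_involute]
  rw [h1, hx]

theorem eps_mem_algAW {x : HC W t c} (hx : x ∈ algAW W t c) : eps W t c x ∈ algAW W t c := by
  rw [mem_algAW] at hx ⊢
  refine ⟨eps_mem_algA hx.1, fun g => ?_⟩
  have := congrArg (eps W t c) (hx.2 g)
  rwa [map_mul, map_mul, eps_diag] at this

theorem diag_mem_algA [FiniteDimensional ℂ h] (hW : IsComplexReflectionGroup W)
    (p : MonoidAlgebra ℂ (doubleCover W)) : diag W t c p ∈ algA W t c := by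
  have := Fintype.ofFinite W
  induction p using MonoidAlgebra.induction_on with
  | of g =>
    obtain ⟨χ, hχ⟩ := exists_isLift_cover hW g
    rw [mem_algA]
    intro a
    rw [diag_of, Algebra.TensorProduct.map_tmul, scaleH_grp, hχ.scale]
  | add p q hp hq => rw [map_add]; exact Subalgebra.add_mem _ hp hq
  | smul r p hp => rw [map_smul]; exact Subalgebra.smul_mem _ hp r

theorem diagCenter_le_algAW [FiniteDimensional ℂ h] (hW : IsComplexReflectionGroup W) :
    diagCenter W t c ≤ algAW W t c := by
  rintro _ ⟨p, hp, rfl⟩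
  refine mem_algAW.mpr ⟨diag_mem_algA hW p, fun g => ?_⟩
  have := Subalgebra.mem_center_iff.mp hp (MonoidAlgebra.of ℂ _ g)
  exact (map_mul _ _ _).symm.trans ((congrArg _ this).trans (map_mul _ _ _))

/-- The properties of `D_x` and `D_y` from which the projection is constructed. -/
structure IsDiracElement (D : HC W t c) : Prop where
  commute : ∀ g, Commute (diag W t c (MonoidAlgebra.of ℂ _ g)) D
  mem_algA : D ∈ algA W t c
  odd : eps W t c D = -D
  sq : D * D = 0
  exists_eq : ∀ x ∈ algA W t c, delta D x = 0 →
    ∃ y ∈ algA W t c, ∃ p, x = delta D y + diag W t c p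
  eq_zero : ∀ x ∈ algA W t c, (∃ p, delta D x = diag W t c p) → delta D x = 0

namespace IsDiracElement

variable {D : HC W t c}

theorem delta_diag (hD : IsDiracElement D) (p : MonoidAlgebra ℂ (doubleCover W)) :
    delta D (diag W t c p) = 0 := by
  rw [delta_apply, eps_diag, sub_eq_zero]
  induction p using MonoidAlgebra.induction_on with
  | of g => exact (hD.commute g).eq.symm
  | add p q hp hq => rw [map_add, add_mul, mul_add, hp, hq]
  | smul r p hp => rw [map_smul, smul_mul_assoc, mul_smul_comm, hp]

theorem delta_delta (hD : IsDiracElement D) (a : HC W t c) : delta D (delta D a) = 0 := by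
  have h1 : ∀ x, D * (D * x) = 0 := fun x => by rw [← mul_assoc, hD.sq, zero_mul]
  rw [delta_apply, delta_apply, mul_sub, h1, map_sub, sub_mul, map_mul, map_mul, eps_eps, hD.odd,
    mul_neg, neg_mul, neg_mul, neg_mul, mul_assoc a, hD.sq, mul_zero, mul_assoc]
  abel

theorem mem_algAW (hD : IsDiracElement D) : D ∈ algAW W t c :=
  Cherednik.mem_algAW.mpr ⟨hD.mem_algA, fun g => (hD.commute g).eq⟩

theorem delta_mem_algAW (hD : IsDiracElement D) {a : HC W t c} (ha : a ∈ algAW W t c) :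
    delta D a ∈ algAW W t c :=
  Subalgebra.sub_mem _ (Subalgebra.mul_mem _ hD.mem_algAW ha)
    (Subalgebra.mul_mem _ (eps_mem_algAW ha) hD.mem_algAW)

/-- A cocycle is `δ y + Δ(p)` with `y` and `p` not yet invariant. Averaging over `W̃` fixes the
cocycle, commutes with δ because `Δ(w̃)` is even and killed by δ, and sends `p` into the centre. -/
theorem kerDelta_eq [FiniteDimensional ℂ h] (hD : IsDiracElement D)
    (hW : IsComplexReflectionGroup W) :
    kerDelta D = imDelta D ⊔ (diagCenter W t c).toSubmodule := by
  have := finite_doubleCover hW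
  have := Fintype.ofFinite (doubleCover W)
  apply le_antisymm
  · rintro x ⟨hx, hx0⟩
    have hx' := Cherednik.mem_algAW.mp hx
    obtain ⟨y, hy, p, hxy⟩ := hD.exists_eq x hx'.1 hx0
    let φ : doubleCover W →* HC W t c :=
      (diag W t c).toMonoidHom.comp (MonoidAlgebra.of ℂ (doubleCover W))
    have h1 : average φ x = x := average_of_commute φ hx'.2
    have h2 : ∀ g, delta D (φ g) = 0 := fun g => hD.delta_diag _
    have h3 : average φ (delta D y) = delta D (average φ y) := by
      rw [average_apply, average_apply, map_smul, map_sum]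
      congr 1
      refine Finset.sum_congr rfl fun g _ => ?_
      have h4 : eps W t c (φ g) = φ g := eps_diag _
      rw [delta_mul, delta_mul, h2, h2, zero_mul, zero_add, mul_zero, add_zero, h4]
    rw [← h1, hxy, map_add, h3]
    refine Submodule.add_mem_sup ⟨average φ y, ?_, rfl⟩ ?_
    · refine Cherednik.mem_algAW.mpr ⟨?_, fun g => mul_average φ g y⟩
      rw [average_apply]
      exact Subalgebra.smul_mem _ (Subalgebra.sum_mem _ fun g _ =>
        Subalgebra.mul_mem _ (diag_mem_algA hW _)
          (Subalgebra.mul_mem _ hy (diag_mem_algA hW _))) _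
    · exact ⟨_, average_mem_center p, map_average _ (diag W t c) p⟩
  · refine sup_le ?_ fun x hx => ⟨diagCenter_le_algAW hW hx, ?_⟩
    · rintro _ ⟨y, hy, rfl⟩
      exact ⟨hD.delta_mem_algAW hy, hD.delta_delta y⟩
    · obtain ⟨p, -, rfl⟩ := hx
      exact hD.delta_diag p

theorem disjoint (hD : IsDiracElement D) :
    Disjoint (imDelta D) (diagCenter W t c).toSubmodule := by
  rw [Submodule.disjoint_def]
  rintro _ ⟨y, hy, rfl⟩ ⟨p, -, hp⟩
  exact hD.eq_zero y (Cherednik.mem_algAW.mp hy).1 ⟨p, hp.symm⟩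

end IsDiracElement

variable [FiniteDimensional ℂ h]

/-- Translates the cohomology computation for the abstract Dirac element, with the span of the lifts
read as `Δ(ℂ[W̃])`. -/
theorem isDiracElement_Dx (hW : IsComplexReflectionGroup W)
    (hc : ∀ s s' : Reflections W, IsConj (s : W) (s' : W) → c s = c s') :
    IsDiracElement (Dx W t c) := by
  have := Fintype.ofFinite W
  choose a χ ha using exists_isLift hW
  let L := cliffordX t c hc a χ ha
  let R := realizationX t c hc
  have hA : ∀ x, x ∈ algA W t c ↔ x ∈ L.degreeZero R := fun x =>
    mem_algA.trans (L.mem_degreeZero R).symm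
  have hZ : ∀ x, x ∈ L.liftSpan R ↔ ∃ p, x = diag W t c p :=
    mem_span_lifts_iff ha
  obtain ⟨h1, h2⟩ := L.diff_cohomology R
  refine ⟨diag_commute_Dx t c, ?_, L.parity_dirac R, L.dirac_mul_dirac R, ?_, ?_⟩
  · rw [mem_algA]
    exact L.scaleTensor_dirac R
  · intro x hx hx0
    obtain ⟨y, hy, z, hz, hxy⟩ := h1 x ((hA x).mp hx) hx0
    obtain ⟨p, rfl⟩ := (hZ z).mp hz
    exact ⟨y, (hA y).mpr hy, p, hxy⟩
  · intro x hx hp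
    exact h2 x ((hA x).mp hx) ((hZ _).mpr hp)

theorem isDiracElement_Dy (hW : IsComplexReflectionGroup W)
    (hc : ∀ s s' : Reflections W, IsConj (s : W) (s' : W) → c s = c s') :
    IsDiracElement (Dy W t c) := by
  have := Fintype.ofFinite W
  choose a χ ha using exists_isLift hW
  let L := cliffordY t c hc a χ ha
  let R := realizationY t c hc
  have hA : ∀ x, x ∈ algA W t c ↔ x ∈ L.degreeZero R := fun x => by
    rw [mem_algA, L.mem_degreeZero R]
    -- In the exchanged realization the `ℂ*`-action is inverted, which does not change the
    -- invariants.
    exact (Equiv.inv ℂˣ).forall_congr_right.symm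
  have hZ : ∀ x, x ∈ L.liftSpan R ↔ ∃ p, x = diag W t c p :=
    mem_span_lifts_iff ha
  obtain ⟨h1, h2⟩ := L.diff_cohomology R
  refine ⟨diag_commute_Dy t c, ?_, L.parity_dirac R, L.dirac_mul_dirac R, ?_, ?_⟩
  · exact (hA _).mpr ((L.mem_degreeZero R).mpr (L.scaleTensor_dirac R))
  · intro x hx hx0
    obtain ⟨y, hy, z, hz, hxy⟩ := h1 x ((hA x).mp hx) hx0
    obtain ⟨p, rfl⟩ := (hZ z).mp hz
    exact ⟨y, (hA y).mpr hy, p, hxy⟩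
  · intro x hx hp
    exact h2 x ((hA x).mp hx) ((hZ _).mpr hp)

end Projection
-- Irreducible representations and Schur's lemma.
section Irreducible

variable {G : Type*} [Group G] {E : Type*} [AddCommGroup E] [Module ℂ E]

/-- A representation without proper nonzero invariant subspaces. -/
def HasNoInvariants (ρ : Representation ℂ G E) : Prop :=
  ∀ S : Submodule ℂ E, (∀ g, ∀ e ∈ S, ρ g e ∈ S) → S = ⊥ ∨ S = ⊤

theorem hasNoInvariants_of_isIrreducible {ρ : Representation ℂ G E} (hρ : ρ.IsIrreducible) :
    HasNoInvariants ρ := by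
  intro S hS
  have := hρ
  rcases eq_bot_or_eq_top (⟨S, fun g e he => hS g e he⟩ : Subrepresentation ρ) with h1 | h1
  · exact Or.inl (congrArg Subrepresentation.toSubmodule h1)
  · exact Or.inr (congrArg Subrepresentation.toSubmodule h1)

theorem exists_ne_zero_of_isIrreducible {ρ : Representation ℂ G E} (hρ : ρ.IsIrreducible) :
    ∃ e : E, e ≠ 0 := by
  by_contra! H
  have := hρ
  refine bot_ne_top (α := Subrepresentation ρ) (Subrepresentation.toSubmodule_injective ?_)
  ext e
  rw [H e]
  exact ⟨fun _ => Submodule.zero_mem _, fun _ => Submodule.zero_mem _⟩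

/-- Schur's lemma for a finite group. -/
theorem exists_eq_smul_of_commute [Finite G] {ρ : Representation ℂ G E} (hρ : ρ.IsIrreducible)
    (f : Module.End ℂ E) (hf : ∀ g e, f (ρ g e) = ρ g (f e)) : ∃ r : ℂ, ∀ e, f e = r • e := by
  have hS := hasNoInvariants_of_isIrreducible hρ
  obtain ⟨e₀, he₀⟩ := exists_ne_zero_of_isIrreducible hρ
  -- The orbit of a nonzero vector is finite and spans an invariant subspace, so the representation
  -- is finite-dimensional and an eigenvalue exists.
  have hspan : Submodule.span ℂ (Set.range fun g => ρ g e₀) = ⊤ := by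
    refine (hS _ fun g e he => ?_).resolve_left fun h0 => he₀ ?_
    · induction he using Submodule.span_induction with
      | mem e he =>
        obtain ⟨k, rfl⟩ := he
        refine Submodule.subset_span ⟨g * k, ?_⟩
        exact LinearMap.congr_fun (map_mul ρ g k) e₀
      | zero => rw [map_zero]; exact Submodule.zero_mem _
      | add p q _ _ hp hq => rw [map_add]; exact Submodule.add_mem _ hp hq
      | smul r p _ hp => rw [map_smul]; exact Submodule.smul_mem _ _ hp
    · rw [← Submodule.mem_bot ℂ, ← h0]
      exact Submodule.subset_span ⟨1, by simp⟩
  have : FiniteDimensional ℂ E :=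
    Module.finite_def.mpr (hspan ▸ Submodule.fg_span (Set.finite_range _))
  have : Nontrivial E := ⟨e₀, 0, he₀⟩
  obtain ⟨r, hr⟩ := Module.End.exists_eigenvalue f
  refine ⟨r, ?_⟩
  have h1 : Module.End.eigenspace f r = ⊤ := by
    refine (hS _ fun g e he => ?_).resolve_left hr
    rw [Module.End.mem_eigenspace_iff] at he ⊢
    rw [hf, he, map_smul]
  intro e
  rw [← Module.End.mem_eigenspace_iff, h1]
  trivial

end Irreducible

/-! ### Construction of the homomorphism ζ. -/

section VoganMap

variable {h : Type u} [AddCommGroup h] [Module ℂ h]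
  {W : Subgroup (h ≃ₗ[ℂ] h)} {t : ℂ} {c : Reflections W → ℂ}

theorem IsVoganSubalgebra.delta_eq_zero [Finite W] {D : HC W t c} {B : Subalgebra ℂ (HC W t c)}
    (hB : IsVoganSubalgebra D B) (b : B) : delta D (b : HC W t c) = 0 :=
  (hB.mem_ker b b.2).2

theorem eps_of_mem_diagCenter {z : HC W t c} (hz : z ∈ diagCenter W t c) : eps W t c z = z := by
  obtain ⟨p, -, rfl⟩ := hz
  exact eps_diag p

/-- Directness of the decomposition makes `ζ b` the unique element of `Δ(ℂ[W̃]^W̃)` congruent to `b`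
modulo `im δ`, so each algebra identity for ζ reduces to exhibiting a primitive. -/
theorem exists_voganProjection [FiniteDimensional ℂ h] [Finite W]
    (hW : IsComplexReflectionGroup W) {D : HC W t c} (hD : IsDiracElement D)
    {B : Subalgebra ℂ (HC W t c)} (hB : IsVoganSubalgebra D B) :
    ∃ ζ : B →ₐ[ℂ] diagCenter W t c, IsVoganProjection D B ζ := by
  have h1 : ∀ b : B, ∃ z : diagCenter W t c, (b : HC W t c) - z ∈ imDelta D := by
    intro b
    have h2 := hB.mem_ker b b.2
    rw [hD.kerDelta_eq hW] at h2
    obtain ⟨y, hy, z, hz, hyz⟩ := Submodule.mem_sup.mp h2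
    exact ⟨⟨z, hz⟩, by rw [← hyz, add_sub_cancel_right]; exact hy⟩
  choose ζ hζ using h1
  have huniq : ∀ (b : B) (z : diagCenter W t c), (b : HC W t c) - z ∈ imDelta D → ζ b = z := by
    intro b z hz
    have h2 := Submodule.sub_mem _ hz (hζ b)
    rw [sub_sub_sub_cancel_left] at h2
    have h3 := Submodule.disjoint_def.mp hD.disjoint _ h2
      (Subalgebra.sub_mem _ (ζ b).2 z.2)
    exact Subtype.ext (sub_eq_zero.mp h3)
  have hmul : ∀ b b' : B, ζ (b * b') = ζ b * ζ b' := by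
    intro b b'
    refine huniq _ _ ?_
    obtain ⟨u, hu, hu'⟩ := hζ b
    obtain ⟨v, hv, hv'⟩ := hζ b'
    obtain ⟨p, -, hp⟩ := (ζ b).2
    -- With `b - ζ b = δ u` and `b' - ζ b' = δ v`, the derivation rule gives `(b - ζ b) b' + ζ b (b'
    -- - ζ b')`, because δ kills `b'` and `ζ b` and the latter is even.
    refine ⟨u * b' + ζ b * v, Subalgebra.add_mem _ (Subalgebra.mul_mem _ hu (hB.mem_ker b' b'.2).1)
      (Subalgebra.mul_mem _ (diagCenter_le_algAW hW (ζ b).2) hv), ?_⟩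
    have h2 : delta D (ζ b : HC W t c) = 0 := by
      rw [← hp]
      exact hD.delta_diag p
    rw [map_add, delta_mul, delta_mul, hB.delta_eq_zero, hu', hv', h2,
      eps_of_mem_diagCenter (ζ b).2]
    simp only [Subalgebra.coe_mul, mul_zero, zero_mul, add_zero, zero_add, sub_mul, mul_sub]
    abel
  refine ⟨AlgHom.ofLinearMap ⟨⟨ζ, fun b b' => huniq _ _ ?_⟩, fun r b => huniq _ _ ?_⟩
    (huniq _ _ ?_) hmul, hζ⟩
  · have := Submodule.add_mem _ (hζ b) (hζ b')
    rwa [sub_add_sub_comm] at this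
  · have := Submodule.smul_mem _ r (hζ b)
    rwa [smul_sub] at this
  · simp

end VoganMap

/-! ### Coefficient functionals for the group elements of `H`. -/

section Coordinates

variable {W U U' : Type*} [Group W] [Fintype W] [AddCommGroup U] [Module ℂ U]
  [AddCommGroup U'] [Module ℂ U'] {D : HeckeDatum W U U'} {H : Type*} [Ring H] [Algebra ℂ H]

/-- The coefficient of `g` in the Poincaré-Birkhoff-Witt basis. -/
theorem HeckeDatum.Realization.exists_coord [DecidableEq W] (R : D.Realization H) (g : W) :
    ∃ θ : H →ₗ[ℂ] ℂ, ∀ k, θ (R.γ k) = if k = g then 1 else 0 := by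
  let augU : SymmetricAlgebra ℂ U →ₐ[ℂ] ℂ := SymmetricAlgebra.lift 0
  let augU' : SymmetricAlgebra ℂ U' →ₐ[ℂ] ℂ := SymmetricAlgebra.lift 0
  let θ' : D.Model →ₗ[ℂ] ℂ := LinearMap.mul' ℂ ℂ ∘ₗ TensorProduct.map augU.toLinearMap
    (LinearMap.mul' ℂ ℂ ∘ₗ TensorProduct.map augU'.toLinearMap
      ((MonoidAlgebra.basis W ℂ).coord g))
  refine ⟨θ' ∘ₗ R.eval, fun k => ?_⟩
  have h1 : MonoidAlgebra.of ℂ W k = MonoidAlgebra.basis W ℂ k := by simp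
  rw [LinearMap.comp_apply, R.eval_γ, h1]
  simp only [θ', LinearMap.comp_apply, TensorProduct.map_tmul, LinearMap.mul'_apply,
    AlgHom.toLinearMap_apply, map_one, one_mul, Module.Basis.coord_apply,
    Module.Basis.repr_self, Finsupp.single_apply]

end Coordinates

/-! ### The value of ζ on genuine representations. -/

section Genuine

variable {h : Type u} [AddCommGroup h] [Module ℂ h] [FiniteDimensional ℂ h]
  {W : Subgroup (h ≃ₗ[ℂ] h)} [Finite W] {t : ℂ} {c : Reflections W → ℂ}

/-- On a genuine representation, `p ∈ ℂ[W̃]` acts through `Δ(p)`. -/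
theorem asAlgebraHom_eq_of_diag_eq (hW : IsComplexReflectionGroup W)
    (hc : ∀ s s' : Reflections W, IsConj (s : W) (s' : W) → c s = c s')
    {E : Type*} [AddCommGroup E] [Module ℂ E] {ρ : Representation ℂ (doubleCover W) E}
    (hρ : IsGenuine ρ) {p q : MonoidAlgebra ℂ (doubleCover W)}
    (hpq : diag W t c p = diag W t c q) : ρ.asAlgebraHom p = ρ.asAlgebraHom q := by
  classical
  have := Fintype.ofFinite W
  choose a χ ha using exists_isLift hW
  -- Choosing one lift per element of `W`, the same coefficients express `Δ(p)` and the action of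
  -- `p`: the sign of the other lift appears in `Δ` through the Clifford factor and in `ρ` through
  -- genuineness.
  have key : ∀ p, ∃ v : W → ℂ,
      diag W t c p = ∑ g, v g • (RCA.grp W t c g ⊗ₜ[ℂ] a g) ∧
      ρ.asAlgebraHom p = ∑ g, v g • ρ (ha g).toCover := by
    intro p
    induction p using MonoidAlgebra.induction_on with
    | of g =>
      rcases eq_or_eq_mul_negOne (g := g) (g' := (ha (coverMap W g)).toCover) rfl with h1 | h1
      · have h2 : coverIncl W g = a (coverMap W g) := by
          conv_lhs => rw [h1]
          rfl
        refine ⟨Pi.single (coverMap W g) 1, ?_, ?_⟩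
        · simp [Pi.single_apply, ite_smul, diag_of, h2, -MonoidAlgebra.of_apply]
        · rw [Representation.asAlgebraHom_of]
          conv_lhs => rw [h1]
          simp [Pi.single_apply, ite_smul]
      · have h2 : coverIncl W g = -a (coverMap W g) := by
          conv_lhs => rw [h1, map_mul, coverIncl_negOne, mul_neg, mul_one]
          rfl
        refine ⟨Pi.single (coverMap W g) (-1), ?_, ?_⟩
        · simp [Pi.single_apply, ite_smul, diag_of, h2, -MonoidAlgebra.of_apply,
            TensorProduct.tmul_neg]
        · have h3 : ρ (negOne W) = -1 := LinearMap.ext hρ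
          rw [Representation.asAlgebraHom_of]
          conv_lhs => rw [h1, map_mul, h3]
          simp [Pi.single_apply, ite_smul]
    | add p q hp hq =>
      obtain ⟨v, hv, hv'⟩ := hp
      obtain ⟨u, hu, hu'⟩ := hq
      exact ⟨v + u, by simp [hv, hu, add_smul, Finset.sum_add_distrib],
        by simp [hv', hu', add_smul, Finset.sum_add_distrib]⟩
    | smul r p hp =>
      obtain ⟨v, hv, hv'⟩ := hp
      exact ⟨r • v, by simp [hv, mul_smul, Finset.smul_sum],
        by simp [hv', mul_smul, Finset.smul_sum]⟩
  obtain ⟨v, hv, hv'⟩ := key (p - q)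
  rw [← sub_eq_zero, ← map_sub, hv']
  rw [map_sub, hpq, sub_self] at hv
  refine Finset.sum_eq_zero fun k _ => ?_
  obtain ⟨θ, hθ⟩ := (realizationX t c hc).exists_coord k
  have hθ' : ∀ g, θ (RCA.grp W t c g) = if g = k then 1 else 0 := hθ
  -- Applying the coefficient functional of `k` to the factor in `H` isolates `v k • a k`, and `a k`
  -- is nonzero because it is invertible.
  have h1 := congrArg ((TensorProduct.lid ℂ (Cl h)).toLinearMap ∘ₗ LinearMap.rTensor (Cl h) θ) hv
  have h2 : v k • a k = 0 := by
    simpa [hθ', ite_smul, smul_ite] using h1.symm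
  have h3 : a k ≠ 0 := fun h0 => by
    have := (ha k).star_mul_self
    rw [h0, mul_zero] at this
    exact zero_ne_one this
  rw [(smul_eq_zero.mp h2).resolve_right h3, zero_smul]

/-- Schur's lemma gives a scalar for each central preimage of `ζ b`. On a genuine representation the
preimage does not matter, so the scalar can be computed from any preimage; sums and products of
preimages then show that it is a character. -/
theorem existsUnique_isVoganValue (hW : IsComplexReflectionGroup W)
    (hc : ∀ s s' : Reflections W, IsConj (s : W) (s' : W) → c s = c s')
    {B : Subalgebra ℂ (HC W t c)} (ζ : B →ₐ[ℂ] diagCenter W t c)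
    {E : Type*} [AddCommGroup E] [Module ℂ E] {ρ : Representation ℂ (doubleCover W) E}
    (hρ : ρ.IsIrreducible) (hg : IsGenuine ρ) : ∃! β : B →ₐ[ℂ] ℂ, IsVoganValue ζ ρ β := by
  have := finite_doubleCover hW
  obtain ⟨e₀, he₀⟩ := exists_ne_zero_of_isIrreducible hρ
  have h1 : ∀ b : B, ∃ z ∈ Subalgebra.center ℂ (MonoidAlgebra ℂ (doubleCover W)),
      diag W t c z = ζ b := fun b => (ζ b).2
  choose z hz hzb using h1
  have h2 : ∀ b, ∃ r : ℂ, ∀ e, ρ.asAlgebraHom (z b) e = r • e := by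
    intro b
    refine exists_eq_smul_of_commute hρ _ fun g e => ?_
    have h3 := Subalgebra.mem_center_iff.mp (hz b) (MonoidAlgebra.of ℂ _ g)
    have h4 := congrArg ρ.asAlgebraHom h3
    rw [map_mul, map_mul, Representation.asAlgebraHom_of] at h4
    exact (LinearMap.congr_fun h4 e).symm
  choose β hβ using h2
  have huniq : ∀ b (p : MonoidAlgebra ℂ (doubleCover W)) (r : ℂ), diag W t c p = ζ b →
      ρ.asAlgebraHom p e₀ = r • e₀ → β b = r := by
    intro b p r hp hr
    rw [asAlgebraHom_eq_of_diag_eq hW hc hg (hp.trans (hzb b).symm), hβ] at hr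
    exact smul_left_injective ℂ he₀ hr
  have hadd : ∀ b b', β (b + b') = β b + β b' := fun b b' => by
    refine huniq _ (z b + z b') _ ?_ ?_
    · rw [map_add, map_add, hzb, hzb, Subalgebra.coe_add]
    · rw [map_add, LinearMap.add_apply, hβ, hβ, add_smul]
  have hsmul : ∀ (r : ℂ) b, β (r • b) = r • β b := fun r b => by
    refine huniq _ (r • z b) _ ?_ ?_
    · rw [map_smul, map_smul, hzb, Subalgebra.coe_smul]
    · rw [map_smul, LinearMap.smul_apply, hβ, smul_assoc]
  have hone : β 1 = 1 := by
    refine huniq _ 1 _ ?_ ?_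
    · rw [map_one, map_one, Subalgebra.coe_one]
    · rw [map_one, Module.End.one_apply, one_smul]
  have hmul : ∀ b b', β (b * b') = β b * β b' := fun b b' => by
    refine huniq _ (z b * z b') _ ?_ ?_
    · rw [map_mul, map_mul, hzb, hzb, Subalgebra.coe_mul]
    · rw [map_mul, Module.End.mul_apply, hβ, hβ, smul_smul]
  let f : B →ₐ[ℂ] ℂ := AlgHom.ofLinearMap ⟨⟨β, hadd⟩, hsmul⟩ hone hmul
  refine ⟨f, fun b p _ hp e => ?_, fun β' hβ' => AlgHom.ext fun b => ?_⟩
  · rw [asAlgebraHom_eq_of_diag_eq hW hc hg (hp.trans (hzb b).symm), hβ]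
    rfl
  · exact (huniq b (z b) _ (hzb b) (hβ' b (z b) (hz b) (hzb b) e₀)).symm

end Genuine

/-! ### From the homology of the Dirac element to the values of the Vogan map. -/

section Main

variable {h : Type u} [AddCommGroup h] [Module ℂ h]
  {W : Subgroup (h ≃ₗ[ℂ] h)} {t : ℂ} {c : Reflections W → ℂ}

/-- A joint isotypic component of the homology of `D` determines a value of the Vogan map. -/
theorem isVoganValue_of_hasIsotypic [Finite W] {D : HC W t c}
    {B : Subalgebra ℂ (HC W t c)} {ζ : B →ₐ[ℂ] diagCenter W t c} (hζ : IsVoganProjection D B ζ)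
    {X : Type*} [AddCommGroup X] [Module ℂ X] (ψ : HC W t c →ₐ[ℂ] Module.End ℂ X)
    {D' : Module.End ℂ X} {r : ℂ} (hD' : ψ D = r • D')
    (hG : ∀ p, Commute (ψ (diag W t c p)) D') (hB' : ∀ b : B, Commute (ψ b) D')
    {E : Type*} [AddCommGroup E] [Module ℂ E] {ρ : Representation ℂ (doubleCover W) E}
    (hρ : HasNoInvariants ρ) {β : B →ₐ[ℂ] ℂ} {f : E →ₗ[ℂ] Homology D'} (hf : f ≠ 0)
    (hfG : ∀ g e, f (ρ g e) =
      homologyAlg D' (ψ.comp (diag W t c)) hG (MonoidAlgebra.of ℂ _ g) (f e))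
    (hfB : ∀ b e, homologyAlg D' (ψ.comp B.val) hB' b (f e) = β b • f e) :
    IsVoganValue ζ ρ β := by
  -- A nonzero equivariant map out of an irreducible representation is injective, so the asserted
  -- identity can be tested in the homology.
  have hker : LinearMap.ker f = ⊥ := by
    refine (hρ _ fun g e he => ?_).resolve_right fun h0 => hf (LinearMap.ker_eq_top.mp h0)
    rw [LinearMap.mem_ker] at he ⊢
    rw [hfG, he, map_zero]
  have hfp : ∀ p e, f (ρ.asAlgebraHom p e) =
      homologyAlg D' (ψ.comp (diag W t c)) hG p (f e) := by
    intro p e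
    induction p using MonoidAlgebra.induction_on with
    | of g => rw [Representation.asAlgebraHom_of, hfG]
    | add p q hp hq => rw [map_add, LinearMap.add_apply, map_add, hp, hq, map_add,
        LinearMap.add_apply]
    | smul a p hp => rw [map_smul, LinearMap.smul_apply, map_smul, hp, map_smul,
        LinearMap.smul_apply]
  intro b p _ hp e
  refine LinearMap.ker_eq_bot.mp hker ?_
  rw [hfp, map_smul, ← hfB]
  obtain ⟨⟨m, hm⟩, hq⟩ := Submodule.Quotient.mk_surjective _ (f e)
  rw [← hq]
  change Submodule.Quotient.mk (kerMap D' (ψ (diag W t c p)) (hG p) ⟨m, hm⟩) =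
    Submodule.Quotient.mk (kerMap D' (ψ b) (hB' b) ⟨m, hm⟩)
  rw [eq_comm, Submodule.Quotient.eq]
  obtain ⟨a, -, ha⟩ := hζ b
  refine ⟨r • ψ a m, ?_⟩
  have h1 : ψ D m = 0 := by
    rw [hD', LinearMap.smul_apply, LinearMap.mem_ker.mp hm, smul_zero]
  -- On a cycle `m` the term `ε(a) D m` vanishes, so `b - ζ(b) = D a - ε(a) D` sends `m` to a
  -- boundary. The factor `r` allows `D` to act as a multiple of the differential `D'`.
  have h2 : ψ b m - ψ (diag W t c p) m = r • D' (ψ a m) := by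
    rw [hp, ← LinearMap.sub_apply, ← map_sub, ← ha, delta_apply, map_sub, map_mul, map_mul,
      LinearMap.sub_apply, Module.End.mul_apply, Module.End.mul_apply, h1, map_zero, sub_zero, hD',
      LinearMap.smul_apply]
  rw [map_smul]
  exact h2.symm

/-- Twisting by nonzero scalars does not change the invariant subspaces, and `W̃` surjects onto `W`.
-/
theorem hasNoInvariants_twist {E : Type*} [AddCommGroup E] [Module ℂ E]
    (hsurj : Function.Surjective (coverMap W)) {σ : Representation ℂ W E}
    (hσ : HasNoInvariants σ) (χ : doubleCover W →* ℂˣ) : HasNoInvariants (twist σ χ) := by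
  intro S hS
  refine hσ S fun g e he => ?_
  obtain ⟨k, rfl⟩ := hsurj g
  have h1 : (χ k : ℂ) • σ (coverMap W k) e ∈ S := hS k e he
  exact (S.smul_mem_iff (χ k).ne_zero).mp h1

/-- Links the two group actions on `M ⊗ ⋀𝔥`: a component `σ` for `W` is a component `σ ⊗ χ` for
`W̃`. -/
theorem actMS_diag_of (M : Type v) [AddCommGroup M] [Module ℂ M] [Module (RCA W t c) M]
    [IsScalarTower ℂ (RCA W t c) M] {χ : doubleCover W →* ℂˣ} (hχ : IsSpinCharacter W χ)
    (g : doubleCover W) :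
    actMS M (diag W t c (MonoidAlgebra.of ℂ _ g)) = (χ g : ℂ) • repW W t c M (coverMap W g) := by
  have h1 : spinor (coverIncl W g) = (χ g : ℂ) •
      (ExteriorAlgebra.map ((coverMap W g : W) : h ≃ₗ[ℂ] h).toLinearMap).toLinearMap :=
    LinearMap.ext (hχ g)
  rw [diag_of, actMS_tmul, h1, TensorProduct.map_smul_right]
  rfl

theorem smul_homologyRep_repW (M : Type v) [AddCommGroup M] [Module ℂ M] [Module (RCA W t c) M]
    [IsScalarTower ℂ (RCA W t c) M] {χ : doubleCover W →* ℂˣ} (hχ : IsSpinCharacter W χ)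
    (D : Module.End ℂ (MS h M)) (hR : ∀ g, Commute (repW W t c M g) D)
    (hG : ∀ p, Commute (((actMS M).comp (diag W t c)) p) D) (g : doubleCover W) (q : Homology D) :
    (χ g : ℂ) • homologyRep D (repW W t c M) hR (coverMap W g) q =
      homologyAlg D ((actMS M).comp (diag W t c)) hG (MonoidAlgebra.of ℂ _ g) q := by
  obtain ⟨m, rfl⟩ := Submodule.Quotient.mk_surjective _ q
  exact congrArg Submodule.Quotient.mk
    (Subtype.ext (LinearMap.congr_fun (actMS_diag_of M hχ g) (m : MS h M)).symm)

theorem coverMap_surjective [FiniteDimensional ℂ h] [Finite W]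
    (hW : IsComplexReflectionGroup W) : Function.Surjective (coverMap W) := fun g => by
  obtain ⟨a, χ, ha⟩ := exists_isLift hW g
  exact ⟨ha.toCover, rfl⟩

theorem commute_diag [Finite W] {D : HC W t c} (hD : IsDiracElement D)
    (p : MonoidAlgebra ℂ (doubleCover W)) : Commute (diag W t c p) D := by
  have := hD.delta_diag p
  rw [delta_apply, eps_diag, sub_eq_zero] at this
  exact this.symm

end Main

end Cherednik

open Cherednik
theorem theoremA
    {h : Type u} [AddCommGroup h] [Module ℂ h] [FiniteDimensional ℂ h]
    (W : Subgroup (h ≃ₗ[ℂ] h)) [Finite W] (hW : IsComplexReflectionGroup W)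
    (t : ℂ) (c : Reflections W → ℂ)
    (hc : ∀ s s' : Reflections W, IsConj (s : W) (s' : W) → c s = c s') :
    -- the projections onto `Δ(ℂ[W̃]^W̃)` are defined
    (kerDelta (Dx W t c) = imDelta (Dx W t c) ⊔ (diagCenter W t c).toSubmodule ∧
      Disjoint (imDelta (Dx W t c)) (diagCenter W t c).toSubmodule) ∧
    (kerDelta (Dy W t c) = imDelta (Dy W t c) ⊔ (diagCenter W t c).toSubmodule ∧
      Disjoint (imDelta (Dy W t c)) (diagCenter W t c).toSubmodule) ∧
    -- the genuine character `χ` of `W̃`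
    ∃ χ : doubleCover W →* ℂˣ, IsSpinCharacter W χ ∧ χ (negOne W) = -1 ∧
      (∀ g : doubleCover W, (χ g : ℂ) ^ 2 =
        LinearMap.det (((coverMap W g : W) : h ≃ₗ[ℂ] h)⁻¹.toLinearMap.dualMap)) ∧
    -- the statement for `D_x` and `H^•(𝔥*, M)`
    (∀ (B : Subalgebra ℂ (HC W t c)) (hB : IsVoganSubalgebra (Dx W t c) B),
      ∃ ζ : B →ₐ[ℂ] diagCenter W t c, IsVoganProjection (Dx W t c) B ζ ∧
        (∀ (E : Type w) [AddCommGroup E] [Module ℂ E] (ρ : Representation ℂ (doubleCover W) E),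
          ρ.IsIrreducible → IsGenuine ρ → ∃! β : B →ₐ[ℂ] ℂ, IsVoganValue ζ ρ β) ∧
        ∀ (M : Type v) [AddCommGroup M] [Module ℂ M] [Module (RCA W t c) M]
          [IsScalarTower ℂ (RCA W t c) M] (E : Type w) [AddCommGroup E] [Module ℂ E]
          (β : B →ₐ[ℂ] ℂ),
          (∀ ρ : Representation ℂ (doubleCover W) E, ρ.IsIrreducible →
            HasIsotypic ρ β (repKerDx W t c M) (algKer M hB) → IsVoganValue ζ ρ β) ∧
          (∀ σ : Representation ℂ W E, σ.IsIrreducible →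
            HasIsotypic σ β (repCohom W t c M) (algCohom M hB) →
              IsVoganValue ζ (twist σ χ) β)) ∧
    -- the statement for `D_y` and `H_•(𝔥, M)`
    (∀ (B : Subalgebra ℂ (HC W t c)) (hB : IsVoganSubalgebra (Dy W t c) B),
      ∃ ζ : B →ₐ[ℂ] diagCenter W t c, IsVoganProjection (Dy W t c) B ζ ∧
        (∀ (E : Type w) [AddCommGroup E] [Module ℂ E] (ρ : Representation ℂ (doubleCover W) E),
          ρ.IsIrreducible → IsGenuine ρ → ∃! β : B →ₐ[ℂ] ℂ, IsVoganValue ζ ρ β) ∧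
        ∀ (M : Type v) [AddCommGroup M] [Module ℂ M] [Module (RCA W t c) M]
          [IsScalarTower ℂ (RCA W t c) M] (E : Type w) [AddCommGroup E] [Module ℂ E]
          (β : B →ₐ[ℂ] ℂ),
          (∀ ρ : Representation ℂ (doubleCover W) E, ρ.IsIrreducible →
            HasIsotypic ρ β (repKerDy W t c M) (algKer M hB) → IsVoganValue ζ ρ β) ∧
          (∀ σ : Representation ℂ W E, σ.IsIrreducible →
            HasIsotypic σ β (repHom W t c M) (algHomol M hB) →
              IsVoganValue ζ (twist σ χ) β)) := by
  have hDx := isDiracElement_Dx (t := t) hW hc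
  have hDy := isDiracElement_Dy (t := t) hW hc
  obtain ⟨χ, hχ, hχ1, hχ2⟩ := exists_spinCharacter hW
  refine ⟨⟨hDx.kerDelta_eq hW, hDx.disjoint⟩, ⟨hDy.kerDelta_eq hW, hDy.disjoint⟩,
    χ, hχ, hχ1, hχ2, fun B hB => ?_, fun B hB => ?_⟩
  · obtain ⟨ζ, hζ⟩ := exists_voganProjection hW hDx hB
    refine ⟨ζ, hζ, fun E _ _ ρ hρ hg => existsUnique_isVoganValue hW hc ζ hρ hg,
      fun M _ _ _ _ E _ _ β => ⟨fun ρ hρ H => ?_, fun σ hσ H => ?_⟩⟩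
    · obtain ⟨f, hf, hfG, hfB⟩ := H
      exact isVoganValue_of_hasIsotypic hζ (actMS M) (one_smul ℂ _).symm
        (fun p => (commute_diag hDx p).map (actMS M)) (fun b => (hB.commute b).map (actMS M))
        (hasNoInvariants_of_isIrreducible hρ) hf hfG hfB
    · obtain ⟨f, hf, hfG, hfB⟩ := H
      have h1 : actMS M (Dx W t c) = (1 : ℂ) • cohomD W t c M := by rw [actMS_Dx, one_smul]
      have h2 : ∀ T : Module.End ℂ (MS h M), Commute T (actMS M (Dx W t c)) →
          Commute T (cohomD W t c M) := fun T hT => by rwa [actMS_Dx] at hT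
      have h3 : ∀ p, Commute (actMS M (diag W t c p)) (cohomD W t c M) := fun p =>
        h2 _ ((commute_diag hDx p).map (actMS M))
      refine isVoganValue_of_hasIsotypic hζ (actMS M) h1 h3
        (fun b => h2 _ ((hB.commute b).map (actMS M)))
        (hasNoInvariants_twist (coverMap_surjective hW) (hasNoInvariants_of_isIrreducible hσ) χ)
        hf (fun g e => ?_) hfB
      rw [← smul_homologyRep_repW M hχ _ (repW_commute_cohomD M) h3]
      exact (map_smul f _ _).trans (congrArg _ (hfG _ e))
  · obtain ⟨ζ, hζ⟩ := exists_voganProjection hW hDy hB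
    refine ⟨ζ, hζ, fun E _ _ ρ hρ hg => existsUnique_isVoganValue hW hc ζ hρ hg,
      fun M _ _ _ _ E _ _ β => ⟨fun ρ hρ H => ?_, fun σ hσ H => ?_⟩⟩
    · obtain ⟨f, hf, hfG, hfB⟩ := H
      exact isVoganValue_of_hasIsotypic hζ (actMS M) (one_smul ℂ _).symm
        (fun p => (commute_diag hDy p).map (actMS M)) (fun b => (hB.commute b).map (actMS M))
        (hasNoInvariants_of_isIrreducible hρ) hf hfG hfB
    · obtain ⟨f, hf, hfG, hfB⟩ := H
      -- Since D_y acts as `2∂`, the general result is applied with `r = 2`; commuting with D_y and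
      -- with `∂` are equivalent.
      have h1 : actMS M (Dy W t c) = (2 : ℂ) • homD W t c M := actMS_Dy M
      have h2 : ∀ T : Module.End ℂ (MS h M), Commute T (actMS M (Dy W t c)) →
          Commute T (homD W t c M) := fun T hT => by
        have h4 := hT.smul_right (2 : ℂ)⁻¹
        rwa [h1, smul_smul, inv_mul_cancel₀ two_ne_zero, one_smul] at h4
      have h3 : ∀ p, Commute (actMS M (diag W t c p)) (homD W t c M) := fun p =>
        h2 _ ((commute_diag hDy p).map (actMS M))
      refine isVoganValue_of_hasIsotypic hζ (actMS M) h1 h3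
        (fun b => h2 _ ((hB.commute b).map (actMS M)))
        (hasNoInvariants_twist (coverMap_surjective hW) (hasNoInvariants_of_isIrreducible hσ) χ)
        hf (fun g e => ?_) hfB
      rw [← smul_homologyRep_repW M hχ _ (repW_commute_homD M) h3]
      exact (map_smul f _ _).trans (congrArg _ (hfG _ e))
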